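/- Let $L,a,\kappa>0$ and let $\Omega=\mathbb T^2_L\times[0,a]$, where $\mathbb T^2_L=(\mathbb R/L\mathbb Z)^2$, with coordinates $(x_1,x_2,z)$ and $e_z=(0,0,1)$. Let $H_0(\mathrm{curl};\Omega)$ be the closure, in the norm $(\|E\|_{L^2}^2+\|\nabla\times E\|_{L^2}^2)^{1/2}$ on $H(\mathrm{curl};\Omega)$, of the smooth laterally periodic fields $\Omega\to\mathbb C^3$ whose tangential components vanish at $z=0$ and $z=a$. Put $$V_{\mathrm{PEC}}=\{E\in H_0(\mathrm{curl};\Omega):\nabla\cdot E=0 \text{ in the sense of distributions on } \mathbb T^2_L\times(0,a)\},$$ $$H_{\mathrm{PEC}}=\overline{V_{\mathrm{PEC}}}^{L^2},\qquad h_0=(L^2a)^{-1/2}e_z,\qquad H_{\mathrm{phys}}=H_{\mathrm{PEC}}\ominus\mathrm{span}\{h_0\},\qquad V_{\mathrm{phys}}=V_{\mathrm{PEC}}\cap H_{\mathrm{phys}}.$$ Let $\mathcal L_{\mathrm{Mx}}$ be the self-adjoint operator on $H_{\mathrm{phys}}$ associated with the closed form $q[E,F]=\int_\Omega(\nabla\times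 E)\cdot\overline{(\nabla\times F)}\,dx$ on $V_{\mathrm{phys}}$. On the Hilbert space tensor product $\mathcal H=H_{\mathrm{phys}}\otimes L^2(\mathbb R^3_y)$ let $\mathcal L_{\mathrm{amb}}=\mathcal L_{\mathrm{Mx}}\otimes I+I\otimes(-\Delta_y)$, that is, the closure of this operator on the algebraic tensor product of the domains. Put $g=\kappa/(6\pi^2)$ and $$\mathcal V_{\mathrm{Mx}}=\kappa\int_{\mathbb R^3}\frac{d^3q}{(2\pi)^3}\,(\mathcal L_{\mathrm{Mx}}+|q|^2)^{-5/2}.$$ **Proposition.** The operators $\mathcal L_{\mathrm{Mx}}$, $\mathcal L_{\mathrm{amb}}$ and $\mathcal L_{\mathrm{Mx}}+|q|^2$ ($q\in\mathbb R^3$) have bounded, everywhere defined, positive inverses, and the integral defining $\mathcal V_{\mathrm{Mx}}$ converges absolutely in operator norm. Let $\eta\in C_c^\infty(\mathbb R^3)$ satisfy $\int_{\mathbb R^3}\eta(y)\,dy=1$, and for $\varepsilon>0$ and $J\in H_{\mathrm{phys}}$ set $\eta_\varepsilon(y)=\varepsilon^{-3}\eta(y/\varepsilon)$ and $R_\varepsilon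 J=J\otimes\eta_\varepsilon\in\mathcal H$. Then for all $J,K\in H_{\mathrm{phys}}$, $$\lim_{\varepsilon\to0^+}\langle R_\varepsilon J,\ \kappa\,\mathcal L_{\mathrm{amb}}^{-5/2}R_\varepsilon K\rangle_{\mathcal H}=\langle J,\mathcal V_{\mathrm{Mx}}K\rangle_{H_{\mathrm{phys}}}=\langle J,\,g\,\mathcal L_{\mathrm{Mx}}^{-1}K\rangle_{H_{\mathrm{phys}}}.$$ In particular, the limit does not depend on the mollifier $\eta$. -/

import Mathlib

open MeasureTheory Filter Topology
open scoped ContDiff TensorProduct InnerProductSpace SchwartzMap Laplacian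

noncomputable section

namespace MaxwellSlab

/-! ### Inverses and negative powers of unbounded operators -/

section Abstract

variable {H K : Type*} [NormedAddCommGroup H] [InnerProductSpace ℂ H]
  [NormedAddCommGroup K] [InnerProductSpace ℂ K]

/-- `T` is the everywhere defined bounded two-sided inverse of the unbounded operator `A`. -/
def IsBoundedInverse (A : H →ₗ.[ℂ] H) (T : H →L[ℂ] H) : Prop :=
  (∀ x : H, ∃ h : T x ∈ A.domain, A ⟨T x, h⟩ = x) ∧ ∀ u : A.domain, T (A u) = (u : H)

open Classical in
/-- The bounded inverse `A⁻¹` (zero if there is none). -/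
def boundedInv (A : H →ₗ.[ℂ] H) : H →L[ℂ] H :=
  if h : ∃ T, IsBoundedInverse A T then h.choose else 0

/-- `A⁻¹` exists as a bounded operator on the whole space and is positive. Equivalently, `A` is
self-adjoint and bounded below by a strictly positive constant. -/
def IsStrictlyPositiveOp [CompleteSpace H] (A : H →ₗ.[ℂ] H) : Prop :=
  IsBoundedInverse A (boundedInv A) ∧ 0 ≤ boundedInv A

/-- For a self-adjoint operator `A` bounded below by a strictly positive constant, the power
`A^{-s}`, `s > 0`, of the functional calculus: it is `(A⁻¹)^s`, the continuous functional calculus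
of the bounded positive operator `A⁻¹` applied to `t ↦ t^s`. -/
def negPow [CompleteSpace H] (A : H →ₗ.[ℂ] H) (s : ℝ) : H →L[ℂ] H :=
  boundedInv A ^ s

/-- The operator `A + c I`, with the domain of `A`. -/
def shift (A : H →ₗ.[ℂ] H) (c : ℝ) : H →ₗ.[ℂ] H :=
  ((c : ℂ) • LinearMap.id : H →ₗ[ℂ] H) +ᵥ A

variable (H K) in
/-- The Hilbert space tensor product: the completion of the algebraic tensor product for the inner
product with `⟪u ⊗ f, v ⊗ g⟫ = ⟪u, v⟫ ⟪f, g⟫`. -/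
def HilbertTensor : Type _ := UniformSpace.Completion (H ⊗[ℂ] K)

instance : NormedAddCommGroup (HilbertTensor H K) :=
  inferInstanceAs (NormedAddCommGroup (UniformSpace.Completion (H ⊗[ℂ] K)))

instance : InnerProductSpace ℂ (HilbertTensor H K) :=
  inferInstanceAs (InnerProductSpace ℂ (UniformSpace.Completion (H ⊗[ℂ] K)))

instance : CompleteSpace (HilbertTensor H K) :=
  inferInstanceAs (CompleteSpace (UniformSpace.Completion (H ⊗[ℂ] K)))

/-- The elementary tensor `u ⊗ f` in the Hilbert space tensor product. -/
def elem (u : H) (f : K) : HilbertTensor H K :=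
  ((u ⊗ₜ[ℂ] f : H ⊗[ℂ] K) : UniformSpace.Completion (H ⊗[ℂ] K))

/-- The operator `A ⊗ I + I ⊗ B`: the closure of the operator with domain the linear span of the
`u ⊗ f`, `u ∈ Dom A`, `f ∈ Dom B`, that sends `u ⊗ f` to `A u ⊗ f + u ⊗ B f`. -/
def tensorSum (A : H →ₗ.[ℂ] H) (B : K →ₗ.[ℂ] K) : HilbertTensor H K →ₗ.[ℂ] HilbertTensor H K :=
  (Submodule.span ℂ {p : HilbertTensor H K × HilbertTensor H K |
    ∃ (u : A.domain) (f : B.domain),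
      p = (elem (u : H) (f : K), elem (A u) (f : K) + elem (u : H) (B f))}).topologicalClosure
    |>.toLinearPMap

end Abstract

/-! ### Fields on the slab `𝕋²_L × [0, a]`

Points are `x = (x 0, x 1, x 2)`, with lateral coordinates `x 0, x 1` of period `L` and plate
coordinate `x 2 ∈ [0, a]`. The slab is represented by one lateral period cell, and smooth fields on
it by smooth laterally periodic fields on `ℝ³`. -/

/-- One period cell `[0, L] × [0, L] × [0, a]`. -/
def cell (L a : ℝ) : Set (Fin 3 → ℝ) := Set.Icc 0 ![L, L, a]

/-- Lebesgue measure on the slab. -/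
abbrev cellMeasure (L a : ℝ) : Measure (Fin 3 → ℝ) := volume.restrict (cell L a)

instance (L a : ℝ) : IsFiniteMeasure (cellMeasure L a) :=
  isFiniteMeasure_restrict.2 (isCompact_Icc : IsCompact (Set.Icc 0 ![L, L, a])).measure_ne_top

/-- `L²(Ω; ℂ³)`. -/
abbrev FieldL2 (L a : ℝ) : Type := Lp (EuclideanSpace ℂ (Fin 3)) 2 (cellMeasure L a)

/-- The partial derivative `∂ᵢ f`. -/
def pderiv (i : Fin 3) (f : (Fin 3 → ℝ) → ℂ) (x : Fin 3 → ℝ) : ℂ :=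
  fderiv ℝ f x (Pi.single i 1)

/-- The classical curl. -/
def curl (Φ : (Fin 3 → ℝ) → EuclideanSpace ℂ (Fin 3)) (x : Fin 3 → ℝ) :
    EuclideanSpace ℂ (Fin 3) :=
  !₂[pderiv 1 (fun y => Φ y 2) x - pderiv 2 (fun y => Φ y 1) x,
     pderiv 2 (fun y => Φ y 0) x - pderiv 0 (fun y => Φ y 2) x,
     pderiv 0 (fun y => Φ y 1) x - pderiv 1 (fun y => Φ y 0) x]

/-- Periodicity with period `L` in the two lateral variables. -/
def IsLateralPeriodic {V : Type*} (L : ℝ) (f : (Fin 3 → ℝ) → V) : Prop :=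
  ∀ x, f (x + Pi.single 0 L) = f x ∧ f (x + Pi.single 1 L) = f x

/-- Test functions on the slab: smooth, laterally periodic, with support in a compact subset of
the open interval `(0, a)` in the plate variable. -/
structure IsTest {V : Type*} [NormedAddCommGroup V] [NormedSpace ℝ V] (L a : ℝ)
    (φ : (Fin 3 → ℝ) → V) : Prop where
  smooth : ContDiff ℝ ∞ φ
  periodic : IsLateralPeriodic L φ
  support : ∃ δ > 0, ∀ x, φ x ≠ 0 → δ ≤ x 2 ∧ x 2 ≤ a - δ

/-- Smooth laterally periodic fields, smooth up to the plates, with vanishing tangential components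
on the plates `x 2 = 0` and `x 2 = a`. -/
structure IsSmoothPEC (L a : ℝ) (Φ : (Fin 3 → ℝ) → EuclideanSpace ℂ (Fin 3)) : Prop where
  smooth : ContDiff ℝ ∞ Φ
  periodic : IsLateralPeriodic L Φ
  tangential : ∀ x, x 2 = 0 ∨ x 2 = a → Φ x 0 = 0 ∧ Φ x 1 = 0

theorem integrable_coord_mul {L a : ℝ} (E : FieldL2 L a) (i : Fin 3) {g : (Fin 3 → ℝ) → ℂ}
    (hg : Continuous g) : Integrable (fun x => E x i * g x) (cellMeasure L a) := by
  have h1 : Integrable (E : (Fin 3 → ℝ) → EuclideanSpace ℂ (Fin 3)) (cellMeasure L a) :=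
    (Lp.memLp E).integrable (by norm_num)
  have h2 : Integrable (fun x => E x i) (cellMeasure L a) :=
    (EuclideanSpace.proj (𝕜 := ℂ) i).integrable_comp h1
  obtain ⟨C, hC⟩ := (isCompact_Icc : IsCompact (cell L a)).exists_bound_of_continuousOn
    hg.continuousOn
  refine h2.mul_bdd hg.aestronglyMeasurable (c := C) ?_
  filter_upwards [ae_restrict_mem (measurableSet_Icc : MeasurableSet (cell L a))] with x hx
  exact hC x hx

/-- `∫_Ω E · g`, the bilinear pairing of a square integrable field with a (continuous) field. -/
def pair {L a : ℝ} (E : FieldL2 L a) (g : Fin 3 → (Fin 3 → ℝ) → ℂ) : ℂ :=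
  ∫ x, ∑ i, E x i * g i x ∂(cellMeasure L a)

theorem pair_add {L a : ℝ} (E F : FieldL2 L a) {g : Fin 3 → (Fin 3 → ℝ) → ℂ}
    (hg : ∀ i, Continuous (g i)) : pair (E + F) g = pair E g + pair F g := by
  unfold pair
  rw [← integral_add (integrable_finsetSum _ fun i _ => integrable_coord_mul E i (hg i))
    (integrable_finsetSum _ fun i _ => integrable_coord_mul F i (hg i))]
  refine integral_congr_ae ?_
  filter_upwards [Lp.coeFn_add E F] with x hx
  simp only [hx, Pi.add_apply, PiLp.add_apply, add_mul, Finset.sum_add_distrib]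

theorem pair_smul {L a : ℝ} (c : ℂ) (E : FieldL2 L a) (g : Fin 3 → (Fin 3 → ℝ) → ℂ) :
    pair (c • E) g = c * pair E g := by
  unfold pair
  rw [← integral_const_mul]
  refine integral_congr_ae ?_
  filter_upwards [Lp.coeFn_smul c E] with x hx
  simp only [hx, Pi.smul_apply, PiLp.smul_apply, smul_eq_mul, Finset.mul_sum, mul_assoc]

theorem pair_zero {L a : ℝ} (g : Fin 3 → (Fin 3 → ℝ) → ℂ) :
    pair (0 : FieldL2 L a) g = 0 := by
  simpa using pair_smul (0 : ℂ) (0 : FieldL2 L a) g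

theorem continuous_pderiv {f : (Fin 3 → ℝ) → ℂ} (hf : ContDiff ℝ ∞ f) (i : Fin 3) :
    Continuous (pderiv i f) :=
  (hf.continuous_fderiv (by simp)).clm_apply continuous_const

theorem contDiff_coord {Φ : (Fin 3 → ℝ) → EuclideanSpace ℂ (Fin 3)} (h : ContDiff ℝ ∞ Φ)
    (i : Fin 3) : ContDiff ℝ ∞ fun y => Φ y i :=
  ((EuclideanSpace.proj (𝕜 := ℂ) i).restrictScalars ℝ).contDiff.comp h

theorem continuous_curl {Φ : (Fin 3 → ℝ) → EuclideanSpace ℂ (Fin 3)} (h : ContDiff ℝ ∞ Φ)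
    (i : Fin 3) : Continuous fun x => curl Φ x i := by
  have hc := fun j k => continuous_pderiv (contDiff_coord h j) k
  fin_cases i
  · exact (hc 2 1).sub (hc 1 2)
  · exact (hc 0 2).sub (hc 2 0)
  · exact (hc 1 0).sub (hc 0 1)

/-- The pairs `(E, ∇ × E)` with `E ∈ H(curl)`: both fields are square integrable and
`∇ × E` is the curl of `E` in the sense of distributions. -/
def curlGraph (L a : ℝ) : Submodule ℂ (FieldL2 L a × FieldL2 L a) where
  carrier := {p | ∀ φ : (Fin 3 → ℝ) → EuclideanSpace ℂ (Fin 3), IsTest L a φ →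
    pair p.2 (fun i x => φ x i) = pair p.1 (fun i x => curl φ x i)}
  zero_mem' φ _ := by simp [pair_zero]
  add_mem' {p q} hp hq φ hφ := by
    have h1 : ∀ i, Continuous fun x => φ x i := fun i => (contDiff_coord hφ.smooth i).continuous
    rw [Prod.snd_add, Prod.fst_add, pair_add _ _ h1, pair_add _ _ (continuous_curl hφ.smooth),
      hp φ hφ, hq φ hφ]
  smul_mem' c p hp φ hφ := by
    rw [Prod.smul_snd, Prod.smul_fst, pair_smul, pair_smul, hp φ hφ]

/-- The pairs `(Φ, ∇ × Φ)` with `Φ` smooth and tangentially vanishing on the plates. -/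
def smoothPECPairs (L a : ℝ) : Set (FieldL2 L a × FieldL2 L a) :=
  {p | ∃ Φ, IsSmoothPEC L a Φ ∧ p.1 =ᵐ[cellMeasure L a] Φ ∧ p.2 =ᵐ[cellMeasure L a] curl Φ}

/-- The pairs `(E, ∇ × E)` with `E ∈ H₀(curl)`, the closure in the graph norm of the smooth fields
with vanishing tangential components on the plates. (These smooth fields form a linear space, so
that taking the span changes nothing.) -/
def curlZeroGraph (L a : ℝ) : Submodule ℂ (FieldL2 L a × FieldL2 L a) :=
  curlGraph L a ⊓ (Submodule.span ℂ (smoothPECPairs L a)).topologicalClosure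

/-- The space `H₀(curl)`. -/
def HZeroCurl (L a : ℝ) : Submodule ℂ (FieldL2 L a) :=
  (curlZeroGraph L a).map (LinearMap.fst ℂ _ _)

/-- The square integrable fields with `∇ · E = 0` in the sense of distributions. -/
def divFree (L a : ℝ) : Submodule ℂ (FieldL2 L a) where
  carrier := {E | ∀ φ : (Fin 3 → ℝ) → ℂ, IsTest L a φ → pair E (fun i => pderiv i φ) = 0}
  zero_mem' φ _ := pair_zero _
  add_mem' {E F} hE hF φ hφ := by
    rw [pair_add _ _ (continuous_pderiv hφ.smooth), hE φ hφ, hF φ hφ, add_zero]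
  smul_mem' c E hE φ hφ := by rw [pair_smul, hE φ hφ, mul_zero]

/-- The divergence-free perfect-conductor form domain. -/
def VPEC (L a : ℝ) : Submodule ℂ (FieldL2 L a) := HZeroCurl L a ⊓ divFree L a

/-- The `L²`-closure of the form domain. -/
def HPEC (L a : ℝ) : Submodule ℂ (FieldL2 L a) := (VPEC L a).topologicalClosure

/-- The normalized static normal mode `(L² a)^{-1/2} e_z`. -/
def staticMode (L a : ℝ) : FieldL2 L a :=
  (((L ^ 2 * a) ^ (-(1 / 2) : ℝ) : ℝ) : ℂ) •
    Lp.const 2 (cellMeasure L a) (EuclideanSpace.single 2 (1 : ℂ))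

/-- The fields in `HPEC` orthogonal to the static normal mode. -/
def physSubmodule (L a : ℝ) : Submodule ℂ (FieldL2 L a) :=
  HPEC L a ⊓ (Submodule.span ℂ {staticMode L a})ᗮ

theorem isClosed_physSubmodule (L a : ℝ) : IsClosed (physSubmodule L a : Set (FieldL2 L a)) :=
  (VPEC L a).isClosed_topologicalClosure.inter (Submodule.isClosed_orthogonal _)

/-- The reduced physical Hilbert space: the orthogonal complement of the static normal mode in
`HPEC`, with the inner product of `L²(Ω; ℂ³)`. -/
def Hphys (L a : ℝ) : Type := physSubmodule L a

instance (L a : ℝ) : NormedAddCommGroup (Hphys L a) :=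
  inferInstanceAs (NormedAddCommGroup (physSubmodule L a))

instance (L a : ℝ) : InnerProductSpace ℂ (Hphys L a) :=
  inferInstanceAs (InnerProductSpace ℂ (physSubmodule L a))

instance (L a : ℝ) : CompleteSpace (Hphys L a) :=
  (isClosed_physSubmodule L a).completeSpace_coe

/-- The inclusion of `Hphys` in `L²(Ω; ℂ³)`. -/
def incl (L a : ℝ) : Hphys L a →ₗᵢ[ℂ] FieldL2 L a := (physSubmodule L a).subtypeₗᵢ

/-! ### The reduced Maxwell operator -/

/-- The graph of the reduced Maxwell operator, that is of the operator of the form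
`q[E, F] = ∫_Ω (∇ × E) · conj (∇ × F)` on `Vphys = VPEC ∩ Hphys`: the pairs `(E, G)` with
`E ∈ Vphys`, `G ∈ Hphys` and `q[E, F] = ∫_Ω G · conj F` for all `F ∈ Vphys`. Here `C = ∇ × E`
and `D = ∇ × F`; Mathlib's inner product is conjugate linear in the first variable. -/
def maxwellGraph (L a : ℝ) : Submodule ℂ (Hphys L a × Hphys L a) where
  carrier := {p | incl L a p.1 ∈ VPEC L a ∧
    ∃ C : FieldL2 L a, (incl L a p.1, C) ∈ curlGraph L a ∧
      ∀ (F : Hphys L a) (D : FieldL2 L a), incl L a F ∈ VPEC L a →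
        (incl L a F, D) ∈ curlGraph L a → ⟪D, C⟫_ℂ = ⟪F, p.2⟫_ℂ}
  zero_mem' := ⟨by simp, 0, by simp [Prod.mk_zero_zero], fun F D _ _ => by simp⟩
  add_mem' := by
    rintro ⟨E, G⟩ ⟨E', G'⟩ ⟨hp, C, hC, h⟩ ⟨hq, C', hC', h'⟩
    refine ⟨?_, C + C', ?_, fun F D hF hD => ?_⟩
    · simpa using (VPEC L a).add_mem hp hq
    · simpa using (curlGraph L a).add_mem hC hC'
    · rw [inner_add_right, h F D hF hD, h' F D hF hD]
      exact (inner_add_right F G G').symm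
  smul_mem' := by
    rintro c ⟨E, G⟩ ⟨hp, C, hC, h⟩
    refine ⟨?_, c • C, ?_, fun F D hF hD => ?_⟩
    · simpa using (VPEC L a).smul_mem c hp
    · simpa using (curlGraph L a).smul_mem c hC
    · rw [inner_smul_right, h F D hF hD]
      exact (inner_smul_right F G c).symm

/-- The reduced perfect-conductor Maxwell operator on `Hphys`. -/
def LMx (L a : ℝ) : Hphys L a →ₗ.[ℂ] Hphys L a := (maxwellGraph L a).toLinearPMap

/-! ### The ambient operator and the mollified transverse restriction -/

/-- The transverse space `ℝ³`. -/
abbrev R3 : Type := EuclideanSpace ℝ (Fin 3)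

/-- `L²(ℝ³)`. -/
abbrev L2R3 : Type := Lp ℂ 2 (volume : Measure R3)

/-- The graph of `-Δ` on `L²(ℝ³)`: the pairs `(f, h)` of square integrable functions with
`Δ f = -h` in the sense of (tempered) distributions, so that the domain is `H²(ℝ³)`. -/
def negLaplacianGraph : Submodule ℂ (L2R3 × L2R3) :=
  let T : L2R3 →ₗ[ℂ] 𝓢'(R3, ℂ) := (Lp.toTemperedDistributionCLM ℂ (volume : Measure R3) 2 :)
  LinearMap.eqLocus
    ((LineDeriv.laplacianCLM ℂ R3 𝓢'(R3, ℂ) : 𝓢'(R3, ℂ) →ₗ[ℂ] 𝓢'(R3, ℂ)) ∘ₗ T ∘ₗ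
      LinearMap.fst ℂ _ _)
    (-(T ∘ₗ LinearMap.snd ℂ _ _))

theorem mem_negLaplacianGraph {f h : L2R3} :
    (f, h) ∈ negLaplacianGraph ↔ Δ (f : 𝓢'(R3, ℂ)) = -(h : 𝓢'(R3, ℂ)) := by
  rw [← TemperedDistribution.laplacianCLM_apply]
  rfl

/-- The self-adjoint operator `-Δ` on `L²(ℝ³)`. -/
def negLaplacian : L2R3 →ₗ.[ℂ] L2R3 := negLaplacianGraph.toLinearPMap

/-- The ambient Hilbert space `Hphys ⊗ L²(ℝ³)`. -/
abbrev Hamb (L a : ℝ) : Type := HilbertTensor (Hphys L a) L2R3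

/-- The ambient product operator `LMx ⊗ I + I ⊗ (-Δ)`. -/
def Lamb (L a : ℝ) : Hamb L a →ₗ.[ℂ] Hamb L a := tensorSum (LMx L a) negLaplacian

/-- The rescaled function `η_ε(y) = ε⁻³ η(y / ε)`. -/
def mollify (η : R3 → ℂ) (ε : ℝ) (y : R3) : ℂ := ((ε ^ 3)⁻¹ : ℝ) * η (ε⁻¹ • y)

theorem memLp_mollify {η : R3 → ℂ} (hη : Continuous η) (hc : HasCompactSupport η) (ε : ℝ) :
    MemLp (mollify η ε) 2 (volume : Measure R3) := by
  rcases eq_or_ne ε 0 with rfl | hε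
  · have h : mollify η 0 = fun _ => 0 := by funext y; simp [mollify]
    rw [h]
    exact MemLp.zero'
  · refine Continuous.memLp_of_hasCompactSupport ?_ ?_
    · exact continuous_const.mul (hη.comp (continuous_const_smul _))
    · exact (hc.comp_smul (inv_ne_zero hε)).mul_left

/-- `R_ε J = J ⊗ η_ε`. -/
def mollifiedLift {L a : ℝ} {η : R3 → ℂ} (hη : ContDiff ℝ ∞ η) (hc : HasCompactSupport η)
    (ε : ℝ) (J : Hphys L a) : Hamb L a :=
  elem J ((memLp_mollify hη.continuous hc ε).toLp (mollify η ε))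

/-- The integrand `(LMx + |q|²)^{-5/2}` of the transverse Riesz integral. -/
def rieszIntegrand (L a : ℝ) (q : R3) : Hphys L a →L[ℂ] Hphys L a :=
  negPow (shift (LMx L a) (‖q‖ ^ 2)) (5 / 2)

/-- The transversely reduced mediator `κ ∫ (LMx + |q|²)^{-5/2} d³q / (2π)³`, an operator-norm
Bochner integral. -/
def VMx (L a κ : ℝ) : Hphys L a →L[ℂ] Hphys L a :=
  (κ * ((2 * Real.pi) ^ 3)⁻¹) • ∫ q : R3, rieszIntegrand L a q

end MaxwellSlab

end

noncomputable section

namespace MaxwellSlab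

/-! ### Bounded inverses, shifts, and the operator of a coercive form -/

section BoundedInverse

variable {H K : Type*} [NormedAddCommGroup H] [InnerProductSpace ℂ H]
  [NormedAddCommGroup K] [InnerProductSpace ℂ K]

/-! The whole statement reduces to the functional calculus of the single bounded positive operator
`T`, the inverse of the Maxwell operator. The shifted inverses are `T (1 + |q|² T)⁻¹`. The Fourier
transform in `y` identifies `H ⊗ L²(ℝ³)` with `L²(ℝ³; H)`, and there the inverse of the ambient
operator is multiplication by `q ↦ T (1 + |2πq|² T)⁻¹` (`isBoundedInverse_tensorSum`); the factor
`2π` comes from the normalization of the Fourier transform. Real powers can then be taken fibre by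
fibre, so the mollified matrix element is the integral of `|η̂(εq)|² ⟪J, (LMx + |2πq|²)^(-5/2) K⟫`
(`inner_negPow_tensorSum`). Since `η̂(0) = ∫ η = 1` and the operator factor is bounded by a multiple
of `(1 + |2πq|²)^(-5/2)`, integrable in dimension three, dominated convergence gives the limit, and
the substitution `q ↦ 2πq` produces the factor `(2π)⁻³` (`tendsto_inner_mollify`).

The local answer comes from a scalar identity: the integral over `ℝ³` of `(t / (1 + |q|² t))^(5/2)`
is `4π t / 3` (`integral_rieszSymbol`). It is linear in `t` because scaling gives `t^(5/2)
t^(-3/2)`. Inserting `T` for `t` turns the Riesz integral into a multiple of `T`, with constant `κ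
(2π)⁻³ 4π/3 = κ / (6π²)`.

It remains to construct `T`. For a closed, densely defined form this needs only the coercive bound
`‖E‖ ≤ c ‖∇ × E‖` (`exists_inverse_of_coercive`), which is proved by Parseval
(`spectralGap_mul_sq_norm_le`). The tangential components of `E` are expanded in sines of the plate
variable and the normal one in cosines, and the other way round for the curl. On coefficients the
curl becomes a cross product with the frequency vector and the divergence a dot product, so
Lagrange's identity multiplies the squared coefficients of a divergence-free field by the squared
frequency. That is bounded below away from the zero frequency, where only the static mode survives,
and it has been removed. The waves are complete by Stone–Weierstrass. The boundary condition enters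
through integration by parts: because `E` has no tangential trace, its curl may be tested with
fields that do not vanish on the plates, whereas the divergence is tested with sines, which are
limits of compactly supported functions. -/

theorem IsBoundedInverse.unique {A : H →ₗ.[ℂ] H} {T T' : H →L[ℂ] H}
    (h : IsBoundedInverse A T) (h' : IsBoundedInverse A T') : T = T' := by
  ext x
  obtain ⟨hx, hAx⟩ := h.1 x
  have := h'.2 ⟨T x, hx⟩
  rw [hAx] at this
  exact this.symm

/-- Uniqueness makes the choice in `boundedInv` harmless: exhibiting any inverse determines it. -/
theorem IsBoundedInverse.boundedInv_eq {A : H →ₗ.[ℂ] H} {T : H →L[ℂ] H}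
    (h : IsBoundedInverse A T) : boundedInv A = T := by
  have hex : ∃ T, IsBoundedInverse A T := ⟨T, h⟩
  rw [boundedInv, dif_pos hex]
  exact hex.choose_spec.unique h

theorem IsBoundedInverse.isStrictlyPositiveOp [CompleteSpace H] {A : H →ₗ.[ℂ] H} {T : H →L[ℂ] H}
    (h : IsBoundedInverse A T) (hT : 0 ≤ T) : IsStrictlyPositiveOp A := by
  rw [IsStrictlyPositiveOp, h.boundedInv_eq]
  exact ⟨h, hT⟩

theorem IsBoundedInverse.eq_zero_of_apply_eq_zero {A : H →ₗ.[ℂ] H} {T : H →L[ℂ] H}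
    (h : IsBoundedInverse A T) {x : H} (hx : T x = 0) : x = 0 := by
  obtain ⟨h1, h2⟩ := h.1 x
  rw [← h2]
  have : (⟨T x, h1⟩ : A.domain) = 0 := Subtype.ext hx
  rw [this, LinearPMap.map_zero]

/-- A graph that is contained in the flipped graph of an injective bounded operator `T`, and
contains it, defines an unbounded operator with inverse `T`. -/
theorem isBoundedInverse_toLinearPMap {g : Submodule ℂ (H × H)} {T : H →L[ℂ] H}
    (hT : ∀ x, T x = 0 → x = 0) (hg : ∀ p ∈ g, T p.2 = p.1) (hs : ∀ x, (T x, x) ∈ g) :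
    IsBoundedInverse g.toLinearPMap T := by
  have hfun : ∀ x ∈ g, x.fst = 0 → x.snd = 0 := fun x hx h0 => hT _ (by rw [hg x hx, h0])
  have hgr := Submodule.toLinearPMap_graph_eq g hfun
  refine ⟨fun x => ?_, fun u => ?_⟩
  · have hx := hs x
    rw [← hgr] at hx
    obtain ⟨y, hy1, hy2⟩ := (LinearPMap.mem_graph_iff _).1 hx
    simp only at hy1 hy2
    refine ⟨hy1 ▸ y.2, ?_⟩
    exact (congrArg _ (Subtype.ext hy1.symm)).trans hy2
  · have := LinearPMap.mem_graph g.toLinearPMap u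
    rw [hgr] at this
    exact hg _ this

/-- The resolvent `(A + c)⁻¹ = T (1 + c T)⁻¹`, where `T = A⁻¹`. -/
def resolventOf [CompleteSpace H] (T : H →L[ℂ] H) (c : ℝ) : H →L[ℂ] H :=
  cfc (fun t : ℝ => t / (1 + c * t)) T

section Resolvent

variable [CompleteSpace H] {T : H →L[ℂ] H} {c : ℝ}

theorem spectrum_nonneg (hT : 0 ≤ T) {t : ℝ} (ht : t ∈ spectrum ℝ T) : 0 ≤ t :=
  spectrum_nonneg_of_nonneg hT ht

theorem one_add_mul_pos (hT : 0 ≤ T) (hc : 0 ≤ c) {t : ℝ} (ht : t ∈ spectrum ℝ T) :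
    0 < 1 + c * t := by
  have := mul_nonneg hc (spectrum_nonneg hT ht)
  linarith

theorem continuousOn_inv_one_add (hT : 0 ≤ T) (hc : 0 ≤ c) :
    ContinuousOn (fun t : ℝ => (1 + c * t)⁻¹) (spectrum ℝ T) :=
  ContinuousOn.inv₀ (by fun_prop) fun _ ht => (one_add_mul_pos hT hc ht).ne'

theorem continuousOn_div_one_add (hT : 0 ≤ T) (hc : 0 ≤ c) :
    ContinuousOn (fun t : ℝ => t / (1 + c * t)) (spectrum ℝ T) :=
  ContinuousOn.div (by fun_prop) (by fun_prop) fun _ ht => (one_add_mul_pos hT hc ht).ne'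

theorem resolventOf_nonneg (hT : 0 ≤ T) (hc : 0 ≤ c) : 0 ≤ resolventOf T c :=
  cfc_nonneg fun _ ht => div_nonneg (spectrum_nonneg hT ht) (one_add_mul_pos hT hc ht).le

theorem resolventOf_eq_mul (hT : 0 ≤ T) (hc : 0 ≤ c) :
    resolventOf T c = T * cfc (fun t : ℝ => (1 + c * t)⁻¹) T := by
  have hsa : IsSelfAdjoint T := .of_nonneg hT
  nth_rewrite 2 [← cfc_id ℝ T]
  rw [resolventOf, ← cfc_mul _ _ T (by fun_prop) (continuousOn_inv_one_add hT hc)]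
  rfl

theorem one_add_smul_eq_cfc (hT : 0 ≤ T) :
    1 + (c : ℂ) • T = cfc (fun t : ℝ => 1 + c * t) T := by
  have hsa : IsSelfAdjoint T := .of_nonneg hT
  rw [cfc_add (a := T) (fun _ : ℝ => (1 : ℝ)) (fun t : ℝ => c * t) (by fun_prop) (by fun_prop),
    cfc_const_one ℝ T, cfc_const_mul_id c T]
  rfl

theorem inv_mul_one_add (hT : 0 ≤ T) (hc : 0 ≤ c) :
    cfc (fun t : ℝ => (1 + c * t)⁻¹) T * (1 + (c : ℂ) • T) = 1 := by
  have hsa : IsSelfAdjoint T := .of_nonneg hT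
  rw [one_add_smul_eq_cfc hT, ← cfc_mul _ _ T (continuousOn_inv_one_add hT hc) (by fun_prop),
    ← cfc_const_one ℝ T]
  exact cfc_congr fun t ht => inv_mul_cancel₀ (one_add_mul_pos hT hc ht).ne'

theorem one_add_mul_inv (hT : 0 ≤ T) (hc : 0 ≤ c) :
    (1 + (c : ℂ) • T) * cfc (fun t : ℝ => (1 + c * t)⁻¹) T = 1 := by
  have hsa : IsSelfAdjoint T := .of_nonneg hT
  rw [one_add_smul_eq_cfc hT, ← cfc_mul _ _ T (by fun_prop) (continuousOn_inv_one_add hT hc),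
    ← cfc_const_one ℝ T]
  exact cfc_congr fun t ht => mul_inv_cancel₀ (one_add_mul_pos hT hc ht).ne'

theorem resolventOf_apply_add (hT : 0 ≤ T) (hc : 0 ≤ c) (w : H) :
    resolventOf T c (w + (c : ℂ) • T w) = T w := by
  have h := congrArg (fun B : H →L[ℂ] H => T (B w)) (inv_mul_one_add hT hc)
  rw [resolventOf_eq_mul hT hc]
  simpa using h

/-- With `y = (1 + cT)⁻¹ x` one has `(A + c) T y = y + c T y = x`. Positivity of `T` and `c ≥ 0`
keep `1 + ct` away from zero on the spectrum, so `y` exists. -/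
theorem IsBoundedInverse.shift {A : H →ₗ.[ℂ] H} (h : IsBoundedInverse A T) (hT : 0 ≤ T)
    (hc : 0 ≤ c) : IsBoundedInverse (shift A c) (resolventOf T c) := by
  refine ⟨fun x => ?_, fun u => ?_⟩
  · set y := cfc (fun t : ℝ => (1 + c * t)⁻¹) T x with hy
    have hR : resolventOf T c x = T y := by rw [resolventOf_eq_mul hT hc]; rfl
    obtain ⟨hd, hA⟩ := h.1 y
    rw [hR]
    refine ⟨hd, ?_⟩
    have h1 : MaxwellSlab.shift A c ⟨T y, hd⟩ = (c : ℂ) • T y + A ⟨T y, hd⟩ := rfl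
    rw [h1, hA]
    have h2 := congrArg (fun B : H →L[ℂ] H => B x) (one_add_mul_inv hT hc)
    have h3 : y + (c : ℂ) • T y = x := by simpa using h2
    rw [add_comm, h3]
  · have h1 : MaxwellSlab.shift A c u = (c : ℂ) • (u : H) + A u := rfl
    have h2 : T (A u) = (u : H) := h.2 u
    rw [h1, ← h2, add_comm, resolventOf_apply_add hT hc]

end Resolvent

/-- The operator of a closed, densely defined and coercive form `⟪C, C⟫`, where `C` runs through the
values of a closed linear relation `Γ`, has a positive bounded inverse. -/
theorem exists_inverse_of_coercive [CompleteSpace H] [CompleteSpace K] (Γ : Submodule ℂ (H × K))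
    (hΓ : IsClosed (Γ : Set (H × K))) {c : ℝ} (hc : ∀ p ∈ Γ, ‖p.1‖ ≤ c * ‖p.2‖)
    (hd : Dense ((Γ.map (LinearMap.fst ℂ H K) : Submodule ℂ H) : Set H)) :
    ∃ T : H →L[ℂ] H, 0 ≤ T ∧ (∀ x, T x = 0 → x = 0) ∧ ∀ E G, T G = E ↔
      ∃ C, (E, C) ∈ Γ ∧ ∀ F D, (F, D) ∈ Γ → ⟪D, C⟫_ℂ = ⟪F, G⟫_ℂ := by
  -- The second projection of `Γ` is injective by coercivity. Its inverse followed by the first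
  -- projection is a bounded map `S` on the range `W`: for the curl, it recovers the field from its
  -- curl.
  let s : Γ →ₗ[ℂ] K := LinearMap.snd ℂ H K ∘ₗ Γ.subtype
  have hs : Function.Injective s := by
    refine (injective_iff_map_eq_zero s).2 fun p hp => ?_
    have h2 : p.1.2 = 0 := hp
    have h1 := hc p.1 p.2
    rw [h2, norm_zero, mul_zero] at h1
    exact Subtype.ext (Prod.ext (norm_le_zero_iff.1 h1) h2)
  let e := LinearEquiv.ofInjective s hs
  let W : Submodule ℂ K := LinearMap.range s
  have he : ∀ D : W, (((e.symm D : Γ) : H × K)).2 = D := fun D =>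
    congrArg Subtype.val (e.apply_symm_apply D)
  let S : W →L[ℂ] H := LinearMap.mkContinuous
    (LinearMap.fst ℂ H K ∘ₗ Γ.subtype ∘ₗ e.symm.toLinearMap) c fun D => by
      have := hc _ (e.symm D).2
      rwa [he D] at this
  have hSD : ∀ D : W, (S D, (D : K)) ∈ Γ := fun D => by
    have h := (e.symm D).2
    have h2 : ((e.symm D : Γ) : H × K) = (S D, (D : K)) := Prod.ext rfl (he D)
    rwa [h2] at h
  have hmem : ∀ F D, (F, D) ∈ Γ → ∃ D' : W, (D' : K) = D ∧ S D' = F := fun F D h => by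
    refine ⟨e ⟨(F, D), h⟩, rfl, ?_⟩
    change ((e.symm (e ⟨(F, D), h⟩) : Γ) : H × K).1 = F
    rw [e.symm_apply_apply]
  -- If the second coordinates converge, the bound on `S` makes the first ones Cauchy, and
  -- closedness of `Γ` keeps the limit pair. Completeness of `W` is what gives `S` an adjoint.
  have hWc : IsClosed (W : Set K) := by
    refine IsSeqClosed.isClosed fun D D₀ hD hlim => ?_
    have hc0 : Continuous fun p : W => S p := S.continuous
    let D' : ℕ → W := fun n => ⟨D n, hD n⟩
    have hcau : CauchySeq D' := by
      have := hlim.cauchySeq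
      rw [Metric.cauchySeq_iff] at this ⊢
      exact this
    have hcau2 : CauchySeq (fun n => S (D' n)) := hcau.map S.uniformContinuous
    obtain ⟨F, hF⟩ := cauchySeq_tendsto_of_complete hcau2
    have : (F, D₀) ∈ Γ :=
      hΓ.mem_of_tendsto (hF.prodMk_nhds hlim) (Eventually.of_forall fun n => hSD (D' n))
    obtain ⟨D'', h1, _⟩ := hmem _ _ this
    rw [← h1]
    exact D''.2
  have : CompleteSpace W := hWc.completeSpace_coe
  -- The weak equation `⟪D, C⟫ = ⟪S D, G⟫` for all `D` in `W` says `C = S* G`, and then `E = S C = S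
  -- S* G`. If `S S* x = 0`, then `S* x = 0`, so `x` is orthogonal to the dense range of `S`.
  refine ⟨S ∘L S.adjoint, ?_, fun x hx => ?_, fun E G => ⟨fun h => ?_, ?_⟩⟩
  · rw [ContinuousLinearMap.nonneg_iff_isPositive]
    exact ContinuousLinearMap.isPositive_self_comp_adjoint S
  · have h0 : S.adjoint x = 0 := by
      rw [← inner_self_eq_zero (𝕜 := ℂ), ContinuousLinearMap.adjoint_inner_left]
      have : S (S.adjoint x) = 0 := hx
      rw [this, inner_zero_right]
    refine hd.eq_zero_of_inner_right (𝕜 := ℂ) fun v hv => ?_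
    obtain ⟨p, hp, hpv⟩ := hv
    obtain ⟨D', _, h2⟩ := hmem p.1 p.2 hp
    have : v = S D' := by rw [h2]; exact hpv.symm
    rw [this, ← ContinuousLinearMap.adjoint_inner_right, h0, inner_zero_right]
  · refine ⟨S.adjoint G, ?_, fun F D hFD => ?_⟩
    · rw [← h]
      exact hSD _
    · obtain ⟨D', rfl, rfl⟩ := hmem F D hFD
      exact ContinuousLinearMap.adjoint_inner_right S D' G
  · rintro ⟨C, hEC, hC⟩
    obtain ⟨C', rfl, rfl⟩ := hmem E C hEC
    have : S.adjoint G = C' := by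
      refine ext_inner_left ℂ fun D => ?_
      rw [ContinuousLinearMap.adjoint_inner_right]
      exact (hC _ _ (hSD D)).symm
    rw [← this]
    rfl

end BoundedInverse

end MaxwellSlab

end

/-! ### The scalar Riesz integral -/

noncomputable section

namespace MaxwellSlab

/-- `t ↦ (t / (1 + |q|² t))^{5/2}`, the scalar symbol of `(A + |q|²)^{-5/2}` in terms of
`t = A⁻¹`. -/
def rieszSymbol (q : R3) (t : ℝ) : ℝ := (t / (1 + ‖q‖ ^ 2 * t)) ^ (5 / 2 : ℝ)

theorem one_add_norm_sq_mul_pos (q : R3) {t : ℝ} (ht : 0 ≤ t) : 0 < 1 + ‖q‖ ^ 2 * t := by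
  positivity

theorem rieszSymbol_nonneg (q : R3) {t : ℝ} (ht : 0 ≤ t) : 0 ≤ rieszSymbol q t := by
  unfold rieszSymbol
  positivity

/-- Clearing denominators, `M (1 + r² t) - t (1 + r²) = (M - t) + r² t (M - 1)`, which is why `M ≥
1` is required as well as `t ≤ M`. The bound is uniform in `t` and decays like `|q|⁻⁵`, which is
integrable on `ℝ³`. -/
theorem rieszSymbol_le {M t : ℝ} (hM : 1 ≤ M) (ht : 0 ≤ t) (htM : t ≤ M) (q : R3) :
    rieszSymbol q t ≤ M ^ (5 / 2 : ℝ) * (1 + ‖q‖ ^ 2) ^ (-(5 : ℝ) / 2) := by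
  have h0 : t / (1 + ‖q‖ ^ 2 * t) ≤ M * (1 + ‖q‖ ^ 2)⁻¹ := by
    rw [← div_eq_mul_inv, div_le_div_iff₀ (by positivity) (by positivity)]
    nlinarith [mul_nonneg (sq_nonneg ‖q‖) (mul_nonneg ht (sub_nonneg.2 hM))]
  refine (Real.rpow_le_rpow (by positivity) h0 (by norm_num)).trans_eq ?_
  rw [Real.mul_rpow (by positivity) (by positivity), Real.inv_rpow (by positivity),
    ← Real.rpow_neg (by positivity)]
  norm_num

theorem integrable_rieszBound (c : ℝ) :
    Integrable fun q : R3 => c * (1 + ‖q‖ ^ 2) ^ (-(5 : ℝ) / 2) :=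
  (integrable_rpow_neg_one_add_norm_sq (by simp; norm_num)).const_mul c

/-- In dimension three the exponent `5/2` makes the radial integrand an exact derivative: with `s =
t y² / (1 + t y²)` it is the derivative of `(t/3) s^(3/2)`. -/
theorem hasDerivAt_rieszPrimitive {t y : ℝ} (ht : 0 < t) (hy : 0 < y) :
    HasDerivAt (fun y : ℝ => t / 3 * (t * y ^ 2 / (1 + t * y ^ 2)) ^ (3 / 2 : ℝ))
      (y ^ 2 * (t / (1 + y ^ 2 * t)) ^ (5 / 2 : ℝ)) y := by
  have hd : 0 < 1 + t * y ^ 2 := by positivity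
  have h1 : HasDerivAt (fun y : ℝ => t * y ^ 2) (t * (2 * y)) y := by
    simpa using (hasDerivAt_pow 2 y).const_mul t
  have h2 := (h1.div (h1.const_add 1) hd.ne').rpow_const (p := 3 / 2)
    (Or.inr (by norm_num))
  refine (h2.const_mul (t / 3)).congr_deriv ?_
  have e1 : (3 / 2 - 1 : ℝ) = 1 / 2 := by norm_num
  have e2 : t * y ^ 2 / (1 + t * y ^ 2) = y ^ 2 * (t / (1 + t * y ^ 2)) := by ring
  have e3 : (t / (1 + y ^ 2 * t)) ^ (5 / 2 : ℝ) =
      (t / (1 + t * y ^ 2)) ^ 2 * (t / (1 + t * y ^ 2)) ^ (1 / 2 : ℝ) := by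
    rw [mul_comm (y ^ 2), ← Real.rpow_natCast (t / (1 + t * y ^ 2)) 2,
      ← Real.rpow_add (by positivity)]
    norm_num
  have e4 : (y ^ 2) ^ (1 / 2 : ℝ) = y := by
    rw [← Real.sqrt_eq_rpow, Real.sqrt_sq hy.le]
  simp only [Pi.div_apply]
  rw [e1, e3, e2, Real.mul_rpow (by positivity) (by positivity), e4]
  field_simp
  ring

theorem tendsto_rieszPrimitive {t : ℝ} (ht : 0 < t) :
    Tendsto (fun y : ℝ => t / 3 * (t * y ^ 2 / (1 + t * y ^ 2)) ^ (3 / 2 : ℝ)) atTop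
      (𝓝 (t / 3)) := by
  have h1 : Tendsto (fun y : ℝ => 1 + t * y ^ 2) atTop atTop :=
    tendsto_atTop_add_const_left _ _
      ((tendsto_pow_atTop (by norm_num)).const_mul_atTop ht)
  have h2 : Tendsto (fun y : ℝ => 1 - (1 + t * y ^ 2)⁻¹) atTop (𝓝 (1 - 0)) :=
    tendsto_const_nhds.sub (tendsto_inv_atTop_zero.comp h1)
  have h3 : (fun y : ℝ => 1 - (1 + t * y ^ 2)⁻¹) = fun y => t * y ^ 2 / (1 + t * y ^ 2) := by
    funext y
    have : 1 + t * y ^ 2 ≠ 0 := by positivity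
    field_simp
    ring
  rw [h3, sub_zero] at h2
  have h4 := (h2.rpow_const (p := (3 / 2 : ℝ)) (Or.inl one_ne_zero)).const_mul (t / 3)
  simpa using h4

/-- In polar coordinates the sphere contributes `3 · 4π/3 = 4π` and the radial primitive rises from
`0` to `t/3`. Linearity in `t` is what turns the nonlocal Riesz integral into a multiple of the
inverse operator. -/
theorem integral_rieszSymbol {t : ℝ} (ht : 0 ≤ t) :
    ∫ q : R3, rieszSymbol q t = 4 * Real.pi / 3 * t := by
  rcases ht.eq_or_lt with rfl | ht
  · simp [rieszSymbol, Real.zero_rpow]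
  have h1 := integral_fun_norm_addHaar (volume : Measure R3)
    (fun r => (t / (1 + r ^ 2 * t)) ^ (5 / 2 : ℝ))
  have h2 : ∫ y in Set.Ioi (0 : ℝ), y ^ 2 * (t / (1 + y ^ 2 * t)) ^ (5 / 2 : ℝ) = t / 3 := by
    have hc : ContinuousWithinAt
        (fun y : ℝ => t / 3 * (t * y ^ 2 / (1 + t * y ^ 2)) ^ (3 / 2 : ℝ)) (Set.Ici 0) 0 := by
      refine Continuous.continuousWithinAt ?_
      refine continuous_const.mul (Continuous.rpow_const ?_ fun y => Or.inr (by norm_num))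
      exact Continuous.div (by fun_prop) (by fun_prop) fun y => by positivity
    rw [integral_Ioi_of_hasDerivAt_of_nonneg hc (fun y hy => hasDerivAt_rieszPrimitive ht hy)
      (fun y _ => by positivity) (tendsto_rieszPrimitive ht)]
    simp [Real.zero_rpow]
  have h3 : (volume : Measure R3).real (Metric.ball 0 1) = Real.pi * 4 / 3 := by
    rw [Measure.real, EuclideanSpace.volume_ball_fin_three]
    simp
    positivity
  unfold rieszSymbol
  rw [h1, h3]
  simp only [finrank_euclideanSpace, Fintype.card_fin, smul_eq_mul, nsmul_eq_mul]
  norm_num only [Nat.add_one_sub_one]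
  rw [h2]
  ring

theorem continuous_rieszSymbol_uncurry {s : Set ℝ} (hs : ∀ t ∈ s, 0 ≤ t) :
    ContinuousOn (Function.uncurry rieszSymbol) (Set.univ ×ˢ s) := by
  unfold rieszSymbol
  refine ContinuousOn.rpow_const ?_ fun _ _ => Or.inr (by norm_num)
  refine ContinuousOn.div (by fun_prop) (by fun_prop) fun p hp => ?_
  exact (one_add_norm_sq_mul_pos p.1 (hs _ hp.2)).ne'

/-! ### The Riesz integral in the functional calculus of `T` -/

section Operators

variable {H : Type*} [NormedAddCommGroup H] [InnerProductSpace ℂ H] [CompleteSpace H]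
  {T : H →L[ℂ] H} {A : H →ₗ.[ℂ] H}

theorem resolventOf_rpow (hT : 0 ≤ T) (q : R3) :
    resolventOf T (‖q‖ ^ 2) ^ (5 / 2 : ℝ) = cfc (rieszSymbol q) T := by
  have hsa : IsSelfAdjoint T := .of_nonneg hT
  rw [CFC.rpow_eq_cfc_real (resolventOf_nonneg hT (by positivity)), resolventOf,
    ← cfc_comp' (fun x : ℝ => x ^ (5 / 2 : ℝ)) _ T
      (ContinuousOn.rpow_const (by fun_prop) fun _ _ => Or.inr (by norm_num))
      (continuousOn_div_one_add hT (by positivity))]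
  rfl

/-- The summand `1` makes the bound at least `1`, as `rieszSymbol_le` requires. The zero space is
separate because there the identity does not have norm one; its spectrum is empty. -/
theorem norm_le_of_mem_spectrum {t : ℝ} (ht : t ∈ spectrum ℝ T) : t ≤ ‖T‖ + 1 := by
  rcases subsingleton_or_nontrivial H with hH | hH
  · have : Subsingleton (H →L[ℂ] H) := ⟨fun a b => by ext x; exact Subsingleton.elim _ _⟩
    rw [spectrum.of_subsingleton] at ht
    exact ht.elim
  · have := (Real.le_norm_self t).trans (spectrum.norm_le_norm_of_mem ht)
    linarith

theorem norm_rieszSymbol_le (hT : 0 ≤ T) (q : R3) {t : ℝ} (ht : t ∈ spectrum ℝ T) :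
    ‖rieszSymbol q t‖ ≤ (‖T‖ + 1) ^ (5 / 2 : ℝ) * (1 + ‖q‖ ^ 2) ^ (-(5 : ℝ) / 2) := by
  have h0 := spectrum_nonneg hT ht
  rw [Real.norm_of_nonneg (rieszSymbol_nonneg q h0)]
  exact rieszSymbol_le (by linarith [norm_nonneg T]) h0 (norm_le_of_mem_spectrum ht) q

theorem norm_cfc_rieszSymbol_le (hT : 0 ≤ T) (q : R3) :
    ‖cfc (rieszSymbol q) T‖ ≤ (‖T‖ + 1) ^ (5 / 2 : ℝ) * (1 + ‖q‖ ^ 2) ^ (-(5 : ℝ) / 2) :=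
  norm_cfc_le (by positivity) fun _ ht => norm_rieszSymbol_le hT q ht

/-- The spectrum is compact, so joint continuity gives continuity of `x ↦ f x` in the supremum norm
over the spectrum, and the functional calculus is continuous in that norm. -/
theorem continuous_cfc_of_uncurry {X : Type*} [TopologicalSpace X] {f : X → ℝ → ℝ}
    (hf : ContinuousOn (Function.uncurry f) (Set.univ ×ˢ spectrum ℝ T)) (hT : IsSelfAdjoint T) :
    Continuous fun x => cfc (f x) T := by
  simp_rw [cfc_eq_cfcL_mkD _ T hT]
  exact (cfcL hT).continuous.comp (ContinuousMap.continuous_mkD_restrict_of_uncurry _ _ hf)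

theorem integrable_cfc_rieszSymbol (hT : 0 ≤ T) :
    Integrable (fun q : R3 => cfc (rieszSymbol q) T) := by
  have hsa : IsSelfAdjoint T := .of_nonneg hT
  exact integrable_cfc _ _ T (continuous_rieszSymbol_uncurry fun _ => spectrum_nonneg hT)
    (ae_of_all _ fun q t ht => norm_rieszSymbol_le hT q ht) (integrable_rieszBound _).2

/-- The functional calculus commutes with the integral, so the operator integral is the scalar one
evaluated at `T`. -/
theorem integral_cfc_rieszSymbol (hT : 0 ≤ T) :
    ∫ q : R3, cfc (rieszSymbol q) T = (4 * Real.pi / 3) • T := by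
  have hsa : IsSelfAdjoint T := .of_nonneg hT
  rw [← cfc_integral _ _ T (continuous_rieszSymbol_uncurry fun _ => spectrum_nonneg hT)
    (ae_of_all _ fun q t ht => norm_rieszSymbol_le hT q ht) (integrable_rieszBound _).2,
    ← cfc_const_mul_id (4 * Real.pi / 3) T]
  exact cfc_congr fun t ht => integral_rieszSymbol (spectrum_nonneg hT ht)

theorem IsBoundedInverse.negPow_shift (h : IsBoundedInverse A T) (hT : 0 ≤ T) (q : R3) :
    negPow (MaxwellSlab.shift A (‖q‖ ^ 2)) (5 / 2) = cfc (rieszSymbol q) T := by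
  rw [negPow, (h.shift hT (by positivity)).boundedInv_eq, resolventOf_rpow hT]

end Operators

end MaxwellSlab

end

noncomputable section

namespace MaxwellSlab

/-! ### Multiplication operators and their powers -/

section Multiplication

open BoundedContinuousFunction

theorem isSelfAdjoint_of_forall_nonneg {X : Type*} [TopologicalSpace X] {H : Type*}
    [NormedAddCommGroup H] [InnerProductSpace ℂ H] [CompleteSpace H]
    {b : X →ᵇ (H →L[ℂ] H)} (hb : ∀ x, 0 ≤ b x) : IsSelfAdjoint b := by
  ext1 x
  exact (IsSelfAdjoint.of_nonneg (hb x)).star_eq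

variable {X : Type*} [TopologicalSpace X] [SecondCountableTopology X] [MeasurableSpace X]
  [OpensMeasurableSpace X] {μ : Measure X}
  {H : Type*} [NormedAddCommGroup H] [InnerProductSpace ℂ H]

theorem memLp_apply_of_bounded (b : X →ᵇ (H →L[ℂ] H)) (f : Lp H 2 μ) :
    MemLp (fun x => b x (f x)) 2 μ := by
  refine (Lp.memLp f).of_le_mul (c := ‖b‖) ?_
    (ae_of_all _ fun x => (b x).le_of_opNorm_le (b.norm_coe_le_norm x) _)
  exact (isBoundedBilinearMap_apply (𝕜 := ℂ) (E := H) (F := H)).continuous.comp_aestronglyMeasurable₂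
    b.continuous.aestronglyMeasurable (Lp.aestronglyMeasurable f)

variable (μ) in
/-- Multiplication by a bounded continuous operator valued function on `L²(X; H)`. -/
def mulOp (b : X →ᵇ (H →L[ℂ] H)) : Lp H 2 μ →L[ℂ] Lp H 2 μ :=
  LinearMap.mkContinuous
    { toFun := fun f => (memLp_apply_of_bounded b f).toLp _
      map_add' := fun f g => by
        rw [← MemLp.toLp_add]
        refine MemLp.toLp_congr _ _ ?_
        filter_upwards [Lp.coeFn_add f g] with x hx
        simp only [hx, Pi.add_apply, map_add]
      map_smul' := fun c f => by
        rw [RingHom.id_apply, ← MemLp.toLp_const_smul]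
        refine MemLp.toLp_congr _ _ ?_
        filter_upwards [Lp.coeFn_smul c f] with x hx
        simp only [hx, Pi.smul_apply, map_smul] } ‖b‖ fun f => by
      refine Lp.norm_le_mul_norm_of_ae_le_mul ?_
      filter_upwards [MemLp.coeFn_toLp (memLp_apply_of_bounded b f)] with x hx
      change ‖(memLp_apply_of_bounded b f).toLp _ x‖ ≤ _
      rw [hx]
      exact (b x).le_of_opNorm_le (b.norm_coe_le_norm x) _

theorem coeFn_mulOp (b : X →ᵇ (H →L[ℂ] H)) (f : Lp H 2 μ) :
    mulOp μ b f =ᵐ[μ] fun x => b x (f x) :=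
  MemLp.coeFn_toLp (memLp_apply_of_bounded b f)

variable [CompleteSpace H]

variable (μ) in
/-- `mulOp` as a homomorphism of C⋆-algebras. -/
def mulHom : (X →ᵇ (H →L[ℂ] H)) →⋆ₐ[ℂ] (Lp H 2 μ →L[ℂ] Lp H 2 μ) where
  toFun := mulOp μ
  map_one' := by
    ext1 f
    refine Lp.ext ?_
    filter_upwards [coeFn_mulOp (1 : X →ᵇ (H →L[ℂ] H)) f] with x hx
    exact hx
  map_zero' := by
    ext1 f
    refine Lp.ext ?_
    filter_upwards [coeFn_mulOp (0 : X →ᵇ (H →L[ℂ] H)) f, Lp.coeFn_zero H 2 μ] with x hx h0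
    exact hx.trans h0.symm
  map_mul' b c := by
    ext1 f
    refine Lp.ext ?_
    change mulOp μ (b * c) f =ᵐ[μ] mulOp μ b (mulOp μ c f)
    filter_upwards [coeFn_mulOp (b * c) f, coeFn_mulOp c f, coeFn_mulOp b (mulOp μ c f)]
      with x h1 h2 h3
    rw [h1, h3, h2]
    rfl
  map_add' b c := by
    ext1 f
    refine Lp.ext ?_
    change mulOp μ (b + c) f =ᵐ[μ] ((mulOp μ b f + mulOp μ c f : Lp H 2 μ) : X → H)
    filter_upwards [coeFn_mulOp (b + c) f, coeFn_mulOp c f, coeFn_mulOp b f,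
      Lp.coeFn_add (mulOp μ b f) (mulOp μ c f)] with x h1 h2 h3 h4
    rw [h1, h4, Pi.add_apply, h3, h2]
    rfl
  commutes' r := by
    ext1 f
    refine Lp.ext ?_
    change mulOp μ (algebraMap ℂ (X →ᵇ (H →L[ℂ] H)) r) f =ᵐ[μ] ((r • f : Lp H 2 μ) : X → H)
    filter_upwards [coeFn_mulOp (algebraMap ℂ (X →ᵇ (H →L[ℂ] H)) r) f, Lp.coeFn_smul r f]
      with x h1 h2
    rw [h1, h2]
    rfl
  map_star' b := by
    rw [ContinuousLinearMap.star_eq_adjoint, ContinuousLinearMap.eq_adjoint_iff]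
    intro f g
    rw [L2.inner_def, L2.inner_def]
    refine integral_congr_ae ?_
    filter_upwards [coeFn_mulOp (star b) f, coeFn_mulOp b g] with x h1 h2
    rw [h1, h2, BoundedContinuousFunction.star_apply, ContinuousLinearMap.star_eq_adjoint,
      ContinuousLinearMap.adjoint_inner_left]

theorem re_inner_mulOp_nonneg {b : X →ᵇ (H →L[ℂ] H)} (hb : ∀ x, 0 ≤ b x) (f : Lp H 2 μ) :
    0 ≤ RCLike.re ⟪mulOp μ b f, f⟫_ℂ := by
  rw [L2.inner_def]
  have h := integral_re (𝕜 := ℂ) (L2.integrable_inner (𝕜 := ℂ) (mulOp μ b f) f)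
  rw [← h]
  refine integral_nonneg_of_ae ?_
  filter_upwards [coeFn_mulOp b f] with x hx
  rw [hx]
  exact ((ContinuousLinearMap.nonneg_iff_isPositive (b x)).1 (hb x)).2 (f x)

/-- Evaluation at a point as a homomorphism of C⋆-algebras. -/
def evalHom (x : X) : (X →ᵇ (H →L[ℂ] H)) →⋆ₐ[ℂ] (H →L[ℂ] H) where
  toFun b := b x
  map_one' := rfl
  map_zero' := rfl
  map_mul' _ _ := rfl
  map_add' _ _ := rfl
  commutes' _ := rfl
  map_star' _ := rfl

theorem StarAlgHom.continuous_of_cstarAlgebra {A B : Type*} [CStarAlgebra A] [CStarAlgebra B]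
    (φ : A →⋆ₐ[ℂ] B) : Continuous φ :=
  AddMonoidHomClass.continuous_of_bound φ 1 fun a => by
    rw [one_mul]
    exact NonUnitalStarAlgHom.norm_apply_le φ a

/-- The functional calculus is carried out once, in the common source algebra; star homomorphisms of
C⋆-algebras are contractive and so commute with it. The same element `c` thus computes the function
of the global operator and of each fibre. -/
theorem StarAlgHom.exists_map_eq_cfc {A ι M : Type*} [CStarAlgebra A] [NormedAddCommGroup M]
    [InnerProductSpace ℂ M] [CompleteSpace M] (φ : A →⋆ₐ[ℂ] (M →L[ℂ] M))
    (ψ : ι → A →⋆ₐ[ℂ] (H →L[ℂ] H)) {a : A} (ha : IsSelfAdjoint a) {f : ℝ → ℝ}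
    (hf : Continuous f) :
    ∃ c : A, φ c = cfc f (φ a) ∧ ∀ i, ψ i c = cfc f (ψ i a) :=
  ⟨cfc f a, StarAlgHomClass.map_cfc (S := ℂ) φ f a hf.continuousOn (StarAlgHom.continuous_of_cstarAlgebra φ) ha
    (ha.map φ), fun i => StarAlgHomClass.map_cfc (S := ℂ) (ψ i) f a hf.continuousOn
    (StarAlgHom.continuous_of_cstarAlgebra (ψ i)) ha (ha.map (ψ i))⟩

/-- If operator valued functions are represented by multiplication operators, up to a
unitary, then their powers are represented by the pointwise powers. -/
theorem exists_mulOp_eq_rpow {M : Type*} [NormedAddCommGroup M]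
    [InnerProductSpace ℂ M] [CompleteSpace M] (φ : (X →ᵇ (H →L[ℂ] H)) →⋆ₐ[ℂ] (M →L[ℂ] M))
    {b : X →ᵇ (H →L[ℂ] H)} (hb : ∀ x, 0 ≤ b x) (hφ : 0 ≤ φ b) {s : ℝ} (hs : 0 ≤ s) :
    ∃ c : X →ᵇ (H →L[ℂ] H), φ c = φ b ^ s ∧ ∀ x, c x = b x ^ s := by
  obtain ⟨c, h1, h2⟩ := StarAlgHom.exists_map_eq_cfc φ (evalHom (X := X) (H := H))
    (isSelfAdjoint_of_forall_nonneg hb) (Real.continuous_rpow_const hs)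
  refine ⟨c, ?_, fun x => ?_⟩
  · rw [h1, CFC.rpow_eq_cfc_real hφ]
  · rw [CFC.rpow_eq_cfc_real (hb x)]
    exact h2 x

end Multiplication

/-! ### The Laplacian on the Fourier side -/

section Laplacian

open FourierTransform

theorem hasTemperateGrowth_norm_sq :
    (fun x : R3 => Complex.ofReal (‖x‖ ^ 2)).HasTemperateGrowth := by
  fun_prop

theorem locallyIntegrable_norm_sq_mul (f : L2R3) :
    LocallyIntegrable (fun q : R3 => (4 * Real.pi ^ 2 * ‖q‖ ^ 2 : ℝ) * f q) :=
  (locallyIntegrableOn_univ.1 (LocallyIntegrableOn.continuousOn_mul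
    (((Lp.memLp f).locallyIntegrable (by norm_num)).locallyIntegrableOn _)
    (by fun_prop) isOpen_univ.isLocallyClosed))

/-- The Fourier transform with kernel `exp(-2πi q·y)` turns `-Δ` into multiplication by `|2πq|²`.
Requiring the product to be the transform of a square integrable function encodes the domain. -/
theorem mem_negLaplacianGraph_iff_fourier {f h : L2R3} :
    (f, h) ∈ negLaplacianGraph ↔
      (𝓕 h : L2R3) =ᵐ[volume] fun q => (4 * Real.pi ^ 2 * ‖q‖ ^ 2 : ℝ) * (𝓕 f : L2R3) q := by
  rw [mem_negLaplacianGraph, TemperedDistribution.laplacian_eq_fourierMultiplierCLM,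
    TemperedDistribution.fourierMultiplierCLM_apply]
  have e1 : -(2 * Real.pi) ^ 2 • 𝓕⁻ (TemperedDistribution.smulLeftCLM ℂ
      (fun x : R3 => Complex.ofReal (‖x‖ ^ 2)) (𝓕 (f : 𝓢'(R3, ℂ)))) = -(h : 𝓢'(R3, ℂ)) ↔
      ((2 * Real.pi) ^ 2 : ℂ) • TemperedDistribution.smulLeftCLM ℂ
        (fun x : R3 => Complex.ofReal (‖x‖ ^ 2)) ((𝓕 f : L2R3) : 𝓢'(R3, ℂ)) =
        ((𝓕 h : L2R3) : 𝓢'(R3, ℂ)) := by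
    rw [← Lp.fourier_toTemperedDistribution_eq, ← Lp.fourier_toTemperedDistribution_eq,
      ← neg_inj, neg_neg, ← neg_smul, neg_neg]
    have e2 : ((2 * Real.pi) ^ 2 : ℝ) • 𝓕⁻ (TemperedDistribution.smulLeftCLM ℂ
      (fun x : R3 => Complex.ofReal (‖x‖ ^ 2)) (𝓕 (f : 𝓢'(R3, ℂ)))) =
      𝓕⁻ (((2 * Real.pi) ^ 2 : ℂ) • TemperedDistribution.smulLeftCLM ℂ
      (fun x : R3 => Complex.ofReal (‖x‖ ^ 2)) (𝓕 (f : 𝓢'(R3, ℂ)))) := by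
      rw [FourierTransform.fourierInv_smul]
      have : ((2 * Real.pi) ^ 2 : ℂ) = (((2 * Real.pi) ^ 2 : ℝ) : ℂ) := by push_cast; rfl
      rw [this]
      ext φ
      exact (Complex.coe_smul _ _).symm
    rw [e2]
    constructor
    · intro hh
      rw [← hh, fourier_fourierInv_eq]
    · intro hh
      rw [hh, fourierInv_fourier_eq]
  rw [e1]
  have e3 : ∀ φ : 𝓢(R3, ℂ), (((2 * Real.pi) ^ 2 : ℂ) • TemperedDistribution.smulLeftCLM ℂ
        (fun x : R3 => Complex.ofReal (‖x‖ ^ 2)) ((𝓕 f : L2R3) : 𝓢'(R3, ℂ))) φ =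
        ∫ q, φ q • ((4 * Real.pi ^ 2 * ‖q‖ ^ 2 : ℝ) * (𝓕 f : L2R3) q) := by
    intro φ
    change ((2 * Real.pi) ^ 2 : ℂ) • (TemperedDistribution.smulLeftCLM ℂ
        (fun x : R3 => Complex.ofReal (‖x‖ ^ 2)) ((𝓕 f : L2R3) : 𝓢'(R3, ℂ))) φ = _
    rw [TemperedDistribution.smulLeftCLM_apply_apply, Lp.toTemperedDistribution_apply,
      ← integral_smul]
    refine integral_congr_ae (ae_of_all _ fun q => ?_)
    simp only [SchwartzMap.smulLeftCLM_apply_apply hasTemperateGrowth_norm_sq, smul_eq_mul]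
    push_cast
    ring
  constructor
  -- Both transforms are locally integrable functions, so equality as distributions, tested on real
  -- smooth functions of compact support, gives equality almost everywhere.
  · intro hh
    refine ae_eq_of_integral_contDiff_smul_eq ((Lp.memLp _).locallyIntegrable (by norm_num))
      (locallyIntegrable_norm_sq_mul _) fun g hg hc => ?_
    have hg1 : HasCompactSupport (Complex.ofRealCLM ∘ g) := hc.comp_left rfl
    have hg2 : ContDiff ℝ ∞ (Complex.ofRealCLM ∘ g) := by fun_prop
    have h1 := congrArg (fun D : 𝓢'(R3, ℂ) => D (hg1.toSchwartzMap hg2)) hh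
    simp only [e3, Lp.toTemperedDistribution_apply] at h1
    simpa using h1.symm
  · intro hh
    ext φ
    rw [e3, Lp.toTemperedDistribution_apply]
    refine integral_congr_ae ?_
    filter_upwards [hh] with q hq
    rw [hq]

/-- `Submodule.toLinearPMap` returns the given graph only if it is single valued; here `f = 0`
forces the transform of the second entry, hence that entry, to vanish. -/
theorem negLaplacian_graph : negLaplacian.graph = negLaplacianGraph := by
  refine Submodule.toLinearPMap_graph_eq _ fun x hx h0 => ?_
  have hx' : (x.1, x.2) ∈ negLaplacianGraph := hx
  rw [h0, mem_negLaplacianGraph_iff_fourier] at hx'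
  have hF : (𝓕 x.2 : L2R3) = 0 := by
    refine (Lp.eq_zero_iff_ae_eq_zero).2 ?_
    have h00 : (𝓕 (0 : L2R3) : L2R3) = 0 := (Lp.fourierTransformₗᵢ R3 ℂ).map_zero
    rw [h00] at hx'
    filter_upwards [hx', Lp.coeFn_zero ℂ 2 (volume : Measure R3)] with q h1 h2
    rw [h1, h2]
    simp
  rw [← norm_eq_zero, ← Lp.norm_fourier_eq, hF, norm_zero]

end Laplacian

end MaxwellSlab

end

/-! ### The Hilbert space tensor product as `L²(ℝ³; H)` -/

noncomputable section

namespace MaxwellSlab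

open FourierTransform

/-- Bounded sets suffice, by exhausting the space with balls. This is the form needed for functions
carrying the unbounded weight `|q|²`, which are only locally integrable. -/
theorem ae_eq_zero_of_forall_bounded_setIntegral_eq_zero {E H : Type*} [NormedAddCommGroup E]
    [MeasurableSpace E] [BorelSpace E] {μ : Measure E} [NormedAddCommGroup H] [NormedSpace ℝ H]
    [CompleteSpace H] {w : E → H}
    (hw : ∀ N : ℕ, IntegrableOn w (Metric.ball 0 N) μ)
    (h : ∀ s, MeasurableSet s → Bornology.IsBounded s → ∫ x in s, w x ∂μ = 0) : w =ᵐ[μ] 0 := by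
  have h1 : ∀ N : ℕ, ∀ᵐ x ∂μ, x ∈ Metric.ball (0 : E) N → w x = 0 := fun N => by
    refine (ae_restrict_iff' measurableSet_ball).1 ?_
    refine Integrable.ae_eq_zero_of_forall_setIntegral_eq_zero (hw N) fun s hs _ => ?_
    rw [Measure.restrict_restrict hs]
    exact h _ (hs.inter measurableSet_ball) (Metric.isBounded_ball.subset Set.inter_subset_right)
  filter_upwards [ae_all_iff.2 h1] with x hx
  obtain ⟨N, hN⟩ := exists_nat_gt ‖x‖
  exact hx N (by simpa using hN)

section Model

variable {H : Type*} [NormedAddCommGroup H] [InnerProductSpace ℂ H] [CompleteSpace H]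

/-- The element `x ↦ g(x) u` of `L²(ℝ³; H)`. -/
def smulField (u : H) (g : L2R3) : Lp H 2 (volume : Measure R3) :=
  (ContinuousLinearMap.toSpanSingleton ℂ u).compLp g

theorem coeFn_smulField (u : H) (g : L2R3) :
    smulField u g =ᵐ[volume] fun x => g x • u := by
  filter_upwards [(ContinuousLinearMap.toSpanSingleton ℂ u).coeFn_compLp g] with x hx
  exact hx

theorem inner_smulField (u v : H) (f g : L2R3) :
    ⟪smulField u f, smulField v g⟫_ℂ = ⟪u, v⟫_ℂ * ⟪f, g⟫_ℂ := by
  rw [L2.inner_def, L2.inner_def, ← integral_const_mul]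
  refine integral_congr_ae ?_
  filter_upwards [coeFn_smulField u f, coeFn_smulField v g] with x h1 h2
  rw [h1, h2, inner_smul_left, inner_smul_right, RCLike.inner_apply]
  ring

variable (H) in
/-- The map `u ⊗ f ↦ 𝓕 f(·) u` on the algebraic tensor product. -/
def modelAlg : H ⊗[ℂ] L2R3 →ₗ[ℂ] Lp H 2 (volume : Measure R3) :=
  TensorProduct.lift <| LinearMap.mk₂ ℂ (fun u f => smulField u (𝓕 f : L2R3))
    (fun u v f => by
      refine Lp.ext ?_
      filter_upwards [coeFn_smulField (u + v) (𝓕 f : L2R3), coeFn_smulField u (𝓕 f : L2R3),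
        coeFn_smulField v (𝓕 f : L2R3),
        Lp.coeFn_add (smulField u (𝓕 f : L2R3)) (smulField v (𝓕 f : L2R3))] with x h1 h2 h3 h4
      rw [h1, h4, Pi.add_apply, h2, h3, smul_add])
    (fun c u f => by
      refine Lp.ext ?_
      filter_upwards [coeFn_smulField (c • u) (𝓕 f : L2R3), coeFn_smulField u (𝓕 f : L2R3),
        Lp.coeFn_smul c (smulField u (𝓕 f : L2R3))] with x h1 h2 h3
      rw [h1, h3, Pi.smul_apply, h2, smul_comm])
    (fun u f g => by
      rw [FourierTransform.fourier_add]
      exact ((ContinuousLinearMap.toSpanSingleton ℂ u).compLpL 2 (volume : Measure R3)).map_add _ _)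
    (fun c u f => by
      rw [FourierTransform.fourier_smul]
      exact ((ContinuousLinearMap.toSpanSingleton ℂ u).compLpL 2
        (volume : Measure R3)).map_smul _ _)

theorem modelAlg_tmul (u : H) (f : L2R3) :
    modelAlg H (u ⊗ₜ[ℂ] f) = smulField u (𝓕 f : L2R3) := rfl

/-- Both sides are sesquilinear, and on elementary tensors the identity is Plancherel's. -/
theorem inner_modelAlg (x y : H ⊗[ℂ] L2R3) : ⟪modelAlg H x, modelAlg H y⟫_ℂ = ⟪x, y⟫_ℂ := by
  induction x using TensorProduct.induction_on with
  | zero => rw [map_zero, inner_zero_left, inner_zero_left]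
  | add a b ha hb => rw [map_add, inner_add_left, inner_add_left, ha, hb]
  | tmul u f =>
    induction y using TensorProduct.induction_on with
    | zero => rw [map_zero, inner_zero_right, inner_zero_right]
    | add a b ha hb => rw [map_add, inner_add_right, inner_add_right, ha, hb]
    | tmul v g =>
      rw [modelAlg_tmul, modelAlg_tmul, inner_smulField, TensorProduct.inner_tmul,
        Lp.inner_fourier_eq]

variable (H) in
/-- The inclusion of the algebraic tensor product into the Hilbert space tensor product. -/
def tensorIncl : H ⊗[ℂ] L2R3 →ₗᵢ[ℂ] HilbertTensor H L2R3 :=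
  (UniformSpace.Completion.toComplₗᵢ : H ⊗[ℂ] L2R3 →ₗᵢ[ℂ] UniformSpace.Completion (H ⊗[ℂ] L2R3))

theorem denseRange_tensorIncl : DenseRange (tensorIncl H) :=
  UniformSpace.Completion.denseRange_coe

theorem norm_modelAlg (x : H ⊗[ℂ] L2R3) : ‖modelAlg H x‖ = ‖x‖ := by
  rw [@norm_eq_sqrt_re_inner ℂ, @norm_eq_sqrt_re_inner ℂ, inner_modelAlg]

variable (H) in
/-- The isometry `u ⊗ f ↦ 𝓕 f(·) u` from the Hilbert space tensor product into `L²(ℝ³; H)`. -/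
def modelIsometry : HilbertTensor H L2R3 →ₗᵢ[ℂ] Lp H 2 (volume : Measure R3) where
  toLinearMap := ((modelAlg H).extendOfNorm (tensorIncl H).toLinearMap).toLinearMap
  norm_map' x := by
    have hn : ∀ y, ‖modelAlg H y‖ ≤ 1 * ‖(tensorIncl H).toLinearMap y‖ := fun y => by
      rw [one_mul, norm_modelAlg]
      exact ((tensorIncl H).norm_map y).ge
    refine denseRange_tensorIncl.induction_on (p := fun x =>
      ‖(modelAlg H).extendOfNorm (tensorIncl H).toLinearMap x‖ = ‖x‖) x ?_ fun y => ?_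
    · exact isClosed_eq (by fun_prop) (by fun_prop)
    · have := LinearMap.extendOfNorm_eq (f := modelAlg H) (e := (tensorIncl H).toLinearMap)
        denseRange_tensorIncl ⟨1, hn⟩ y
      rw [LinearIsometry.coe_toLinearMap] at this
      rw [this, norm_modelAlg, LinearIsometry.norm_map]

theorem modelIsometry_elem (u : H) (f : L2R3) :
    modelIsometry H (elem u f) = smulField u (𝓕 f : L2R3) := by
  have hn : ∀ y, ‖modelAlg H y‖ ≤ 1 * ‖(tensorIncl H).toLinearMap y‖ := fun y => by
    rw [one_mul, norm_modelAlg]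
    exact ((tensorIncl H).norm_map y).ge
  exact LinearMap.extendOfNorm_eq (f := modelAlg H) (e := (tensorIncl H).toLinearMap)
        denseRange_tensorIncl ⟨1, hn⟩ (u ⊗ₜ[ℂ] f)

theorem coeFn_modelIsometry_elem (u : H) (f : L2R3) :
    modelIsometry H (elem u f) =ᵐ[volume] fun q => (𝓕 f : L2R3) q • u := by
  rw [modelIsometry_elem]
  exact coeFn_smulField _ _

theorem integrableOn_ball (v : Lp H 2 (volume : Measure R3)) (N : ℕ) :
    IntegrableOn v (Metric.ball 0 N) :=
  integrableOn_Lp_of_measure_ne_top v (by norm_num) measure_ball_lt_top.ne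

/-- The range of an isometry on a complete space is closed. It contains `1_s y` for every bounded
measurable `s` and every vector `y`, and a field orthogonal to all of these has zero integral over
every such `s`. -/
theorem modelIsometry_surjective : Function.Surjective (modelIsometry H) := by
  have hcl : IsClosed (LinearMap.range (modelIsometry H).toLinearMap :
      Set (Lp H 2 (volume : Measure R3))) := by
    have := (modelIsometry H).isometry.isClosedEmbedding.isClosed_range
    simpa using! this
  have htop : (LinearMap.range (modelIsometry H).toLinearMap).topologicalClosure = ⊤ := by
    rw [Submodule.topologicalClosure_eq_top_iff, Submodule.eq_bot_iff]
    intro v hv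
    rw [Lp.eq_zero_iff_ae_eq_zero]
    refine ae_eq_zero_of_forall_bounded_setIntegral_eq_zero (integrableOn_ball v)
      fun s hs hb => ?_
    refine ext_inner_left ℂ fun y => ?_
    have hμ : (volume : Measure R3) s ≠ ⊤ := hb.measure_lt_top.ne
    have h1 := hv _ ⟨elem y (𝓕⁻ (indicatorConstLp 2 hs hμ (1 : ℂ)) : L2R3), rfl⟩
    rw [inner_zero_right, ← integral_inner (integrableOn_Lp_of_measure_ne_top v (by norm_num) hμ),
      ← h1, L2.inner_def, ← integral_indicator hs]
    refine integral_congr_ae ?_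
    have h2 := coeFn_modelIsometry_elem y (𝓕⁻ (indicatorConstLp 2 hs hμ (1 : ℂ)) : L2R3)
    rw [fourier_fourierInv_eq] at h2
    filter_upwards [h2, indicatorConstLp_coeFn (p := 2) (hs := hs) (hμs := hμ) (c := (1 : ℂ))]
      with q h3 h4
    rw [LinearIsometry.coe_toLinearMap, h3, h4]
    by_cases hq : q ∈ s <;> simp [hq]
  rw [hcl.submodule_topologicalClosure_eq] at htop
  exact LinearMap.range_eq_top.1 htop

variable (H) in
/-- The Hilbert space tensor product `H ⊗ L²(ℝ³)` is `L²(ℝ³; H)`, through the Fourier transform. -/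
def modelEquiv : HilbertTensor H L2R3 ≃ₗᵢ[ℂ] Lp H 2 (volume : Measure R3) :=
  LinearIsometryEquiv.ofSurjective (modelIsometry H) modelIsometry_surjective

theorem coeFn_modelEquiv_elem (u : H) (f : L2R3) :
    modelEquiv H (elem u f) =ᵐ[volume] fun q => (𝓕 f : L2R3) q • u :=
  coeFn_modelIsometry_elem u f

open BoundedContinuousFunction

/-- Conjugation with a unitary operator. -/
def conjHom {M M' : Type*} [NormedAddCommGroup M] [InnerProductSpace ℂ M] [CompleteSpace M]
    [NormedAddCommGroup M'] [InnerProductSpace ℂ M'] [CompleteSpace M'] (e : M ≃ₗᵢ[ℂ] M') :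
    (M →L[ℂ] M) →⋆ₐ[ℂ] (M' →L[ℂ] M') :=
  StarAlgHomClass.toStarAlgHom e.conjStarAlgEquiv

variable (H) in
/-- The action of bounded operator valued functions of the Fourier variable on the Hilbert space
tensor product. -/
def fiberHom : (R3 →ᵇ (H →L[ℂ] H)) →⋆ₐ[ℂ] (HilbertTensor H L2R3 →L[ℂ] HilbertTensor H L2R3) :=
  (conjHom (modelEquiv H).symm).comp (mulHom volume)

theorem coeFn_fiberHom (b : R3 →ᵇ (H →L[ℂ] H)) (x : HilbertTensor H L2R3) :
    modelEquiv H (fiberHom H b x) =ᵐ[volume] fun q => b q (modelEquiv H x q) := by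
  have : modelEquiv H (fiberHom H b x) = mulOp volume b (modelEquiv H x) :=
    (modelEquiv H).apply_symm_apply _
  rw [this]
  exact coeFn_mulOp _ _

theorem fiberHom_nonneg {b : R3 →ᵇ (H →L[ℂ] H)} (hb : ∀ q, 0 ≤ b q) : 0 ≤ fiberHom H b := by
  rw [ContinuousLinearMap.nonneg_iff_isPositive]
  refine ⟨?_, fun f => ?_⟩
  · rw [← ContinuousLinearMap.isSelfAdjoint_iff_isSymmetric]
    exact (isSelfAdjoint_of_forall_nonneg hb).map (fiberHom H)
  · have h := re_inner_mulOp_nonneg (μ := volume) hb (modelEquiv H f)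
    have h2 : modelEquiv H (fiberHom H b f) = mulOp volume b (modelEquiv H f) :=
      (modelEquiv H).apply_symm_apply _
    rw [← h2, LinearIsometryEquiv.inner_map_map] at h
    exact h

end Model

end MaxwellSlab

end

/-! ### The inverse of `A ⊗ I + I ⊗ (-Δ)` -/

noncomputable section

namespace MaxwellSlab

open FourierTransform BoundedContinuousFunction

section Ambient

variable {H : Type*} [NormedAddCommGroup H] [InnerProductSpace ℂ H] [CompleteSpace H]
  {T : H →L[ℂ] H} {A : H →ₗ.[ℂ] H}

theorem norm_resolventOf_le (hT : 0 ≤ T) {c : ℝ} (hc : 0 ≤ c) : ‖resolventOf T c‖ ≤ ‖T‖ + 1 := by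
  refine norm_cfc_le (by positivity) fun t ht => ?_
  have h0 := spectrum_nonneg hT ht
  have h1 := one_add_mul_pos hT hc ht
  rw [Real.norm_of_nonneg (div_nonneg h0 h1.le)]
  refine (div_le_self h0 ?_).trans (norm_le_of_mem_spectrum ht)
  linarith [mul_nonneg hc h0]

/-- The operator valued symbol `q ↦ (A + |2πq|²)⁻¹` of the inverse of `A ⊗ I + I ⊗ (-Δ)`. -/
def fiberInverse (hT : 0 ≤ T) : R3 →ᵇ (H →L[ℂ] H) :=
  BoundedContinuousFunction.ofNormedAddCommGroup
    (fun q : R3 => resolventOf T (‖(2 * Real.pi) • q‖ ^ 2))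
    (by
      refine continuous_cfc_of_uncurry (X := R3) (ContinuousOn.div (by fun_prop) (by fun_prop)
        fun p hp => ?_) (.of_nonneg hT)
      exact (one_add_mul_pos hT (by positivity) hp.2).ne')
    (‖T‖ + 1) fun q => norm_resolventOf_le hT (by positivity)

theorem fiberInverse_apply (hT : 0 ≤ T) (q : R3) :
    fiberInverse hT q = resolventOf T (‖(2 * Real.pi) • q‖ ^ 2) := rfl

theorem fiberInverse_nonneg (hT : 0 ≤ T) (q : R3) : 0 ≤ fiberInverse hT q :=
  resolventOf_nonneg hT (by positivity)

theorem norm_two_pi_smul_sq (q : R3) : ‖(2 * Real.pi) • q‖ ^ 2 = 4 * Real.pi ^ 2 * ‖q‖ ^ 2 := by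
  rw [norm_smul, Real.norm_of_nonneg (by positivity)]
  ring

theorem negLaplacian_apply_mem (f : negLaplacian.domain) :
    ((f : L2R3), negLaplacian f) ∈ negLaplacianGraph := by
  rw [← negLaplacian_graph]
  exact LinearPMap.mem_graph _ f

theorem exists_negLaplacian_eq {f h : L2R3} (hf : (f, h) ∈ negLaplacianGraph) :
    ∃ f' : negLaplacian.domain, (f' : L2R3) = f ∧ negLaplacian f' = h := by
  rw [← negLaplacian_graph] at hf
  exact (LinearPMap.mem_graph_iff _).1 hf

/-- The function with Fourier transform the indicator of a bounded set is in the domain of the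
Laplacian. -/
theorem exists_negLaplacian_fourierInv_indicator {s : Set R3} (hs : MeasurableSet s)
    (hb : Bornology.IsBounded s) : ∃ f : negLaplacian.domain,
      (𝓕 (f : L2R3) : L2R3) =ᵐ[volume] s.indicator (fun _ => (1 : ℂ)) ∧
      (𝓕 (negLaplacian f) : L2R3) =ᵐ[volume]
        s.indicator (fun q => ((4 * Real.pi ^ 2 * ‖q‖ ^ 2 : ℝ) : ℂ)) := by
  have hμ : (volume : Measure R3) s ≠ ⊤ := hb.measure_lt_top.ne
  obtain ⟨R, hR⟩ := hb.exists_norm_le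
  have h2 : MemLp (s.indicator (fun q : R3 => ((4 * Real.pi ^ 2 * ‖q‖ ^ 2 : ℝ) : ℂ))) 2 volume := by
    rw [memLp_indicator_iff_restrict hs]
    have : IsFiniteMeasure ((volume : Measure R3).restrict s) :=
      isFiniteMeasure_restrict.2 hμ
    refine MemLp.of_bound (Continuous.aestronglyMeasurable (by fun_prop))
      (4 * Real.pi ^ 2 * R ^ 2) ?_
    filter_upwards [ae_restrict_mem hs] with q hq
    rw [Complex.norm_real, Real.norm_of_nonneg (by positivity)]
    have := hR q hq
    gcongr
  set f₁ : L2R3 := 𝓕⁻ (indicatorConstLp 2 hs hμ (1 : ℂ) : L2R3) with hf₁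
  set f₂ : L2R3 := 𝓕⁻ (h2.toLp _ : L2R3) with hf₂
  have e1 : (𝓕 f₁ : L2R3) =ᵐ[volume] s.indicator (fun _ => (1 : ℂ)) := by
    rw [hf₁, fourier_fourierInv_eq]
    exact indicatorConstLp_coeFn
  have e2 : (𝓕 f₂ : L2R3) =ᵐ[volume]
      s.indicator (fun q => ((4 * Real.pi ^ 2 * ‖q‖ ^ 2 : ℝ) : ℂ)) := by
    rw [hf₂, fourier_fourierInv_eq]
    exact MemLp.coeFn_toLp h2
  have hmem : (f₁, f₂) ∈ negLaplacianGraph := by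
    rw [mem_negLaplacianGraph_iff_fourier]
    filter_upwards [e1, e2] with q h3 h4
    rw [h3, h4]
    by_cases hq : q ∈ s <;> simp [hq]
  obtain ⟨f, h6, h5⟩ := exists_negLaplacian_eq hmem
  exact ⟨f, by rw [h6]; exact e1, by rw [h5]; exact e2⟩

theorem fiberInverse_injective (hT : 0 ≤ T) (hA : IsBoundedInverse A T)
    {x : HilbertTensor H L2R3} (hx : fiberHom H (fiberInverse hT) x = 0) : x = 0 := by
  rw [← (modelEquiv H).map_eq_zero_iff, Lp.eq_zero_iff_ae_eq_zero]
  have h := coeFn_fiberHom (fiberInverse hT) x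
  rw [hx, map_zero] at h
  filter_upwards [h, Lp.coeFn_zero H 2 (volume : Measure R3)] with q h1 h2
  rw [h2] at h1
  exact (hA.shift hT (by positivity)).eq_zero_of_apply_eq_zero h1.symm

theorem coeFn_modelEquiv_tensorSum (u v : H) (f : negLaplacian.domain) :
    modelEquiv H (elem v (f : L2R3) + elem u (negLaplacian f)) =ᵐ[volume]
      fun q => (𝓕 (f : L2R3) : L2R3) q • (v + ((‖(2 * Real.pi) • q‖ ^ 2 : ℝ) : ℂ) • u) := by
  rw [map_add]
  filter_upwards [coeFn_modelEquiv_elem v (f : L2R3), coeFn_modelEquiv_elem u (negLaplacian f),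
    Lp.coeFn_add (modelEquiv H (elem v (f : L2R3))) (modelEquiv H (elem u (negLaplacian f))),
    mem_negLaplacianGraph_iff_fourier.1 (negLaplacian_apply_mem f)] with q h1 h2 h3 h4
  rw [h3, Pi.add_apply, h1, h2, h4, smul_add, smul_smul, norm_two_pi_smul_sq, mul_comm]

/-- At frequency `q` the argument is the scalar `f̂(q)` times `A u + |2πq|² u`. With `u = T (A u)`,
the fibre resolvent sends this to `f̂(q) u`. -/
theorem fiberInverse_apply_tensorSum (hT : 0 ≤ T) (hA : IsBoundedInverse A T) (u : A.domain)
    (f : negLaplacian.domain) : fiberHom H (fiberInverse hT)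
      (elem (A u) (f : L2R3) + elem (u : H) (negLaplacian f)) = elem (u : H) (f : L2R3) := by
  apply (modelEquiv H).injective
  refine Lp.ext ?_
  filter_upwards [coeFn_fiberHom (fiberInverse hT)
    (elem (A u) (f : L2R3) + elem (u : H) (negLaplacian f)),
    coeFn_modelEquiv_tensorSum (u : H) (A u) f, coeFn_modelEquiv_elem (u : H) (f : L2R3)]
    with q h1 h2 h3
  rw [h1, h2, h3, map_smul, fiberInverse_apply]
  have h4 := resolventOf_apply_add (c := ‖(2 * Real.pi) • q‖ ^ 2) hT (by positivity) (A u)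
  rw [hA.2 u] at h4
  rw [h4]

/-- The closed graph is to be the flipped graph of `R`. One inclusion is a closed condition checked
on elementary tensors. The other amounts to density of the range of the algebraic operator: a vector
orthogonal to that range satisfies `(1 + |2πq|² T) V(q) = 0` for almost every `q`, hence vanishes.
-/
theorem isBoundedInverse_tensorSum (hT : 0 ≤ T) (hA : IsBoundedInverse A T) :
    IsBoundedInverse (tensorSum A negLaplacian) (fiberHom H (fiberInverse hT)) := by
  set R := fiberHom H (fiberInverse hT) with hR
  set S : Set (HilbertTensor H L2R3 × HilbertTensor H L2R3) :=
    {p | ∃ (u : A.domain) (f : negLaplacian.domain),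
      p = (elem (u : H) (f : L2R3), elem (A u) (f : L2R3) + elem (u : H) (negLaplacian f))} with hS
  change IsBoundedInverse (Submodule.span ℂ S).topologicalClosure.toLinearPMap R
  refine isBoundedInverse_toLinearPMap (fun x hx => fiberInverse_injective hT hA hx) ?_ ?_
  · let E : Submodule ℂ (HilbertTensor H L2R3 × HilbertTensor H L2R3) :=
      LinearMap.eqLocus (R.toLinearMap ∘ₗ LinearMap.snd ℂ _ _) (LinearMap.fst ℂ _ _)
    have hE : IsClosed (E : Set (HilbertTensor H L2R3 × HilbertTensor H L2R3)) :=
      isClosed_eq (R.continuous.comp continuous_snd) continuous_fst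
    have hle : (Submodule.span ℂ S).topologicalClosure ≤ E := by
      refine Submodule.topologicalClosure_minimal _ (Submodule.span_le.2 ?_) hE
      rintro _ ⟨u, f, rfl⟩
      exact fiberInverse_apply_tensorSum hT hA u f
    exact fun p hp => hle hp
  · let G : Submodule ℂ (HilbertTensor H L2R3) :=
      (Submodule.span ℂ S).topologicalClosure.comap (R.toLinearMap.prod LinearMap.id)
    have hG : IsClosed (G : Set (HilbertTensor H L2R3)) :=
      (Submodule.span ℂ S).isClosed_topologicalClosure.preimage (R.continuous.prodMk continuous_id)
    have htop : G.topologicalClosure = ⊤ := by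
      rw [Submodule.topologicalClosure_eq_top_iff, Submodule.eq_bot_iff]
      intro v hv
      set V := modelEquiv H v with hV
      have hTs : ∀ x y, ⟪T x, y⟫_ℂ = ⟪x, T y⟫_ℂ :=
        (ContinuousLinearMap.isSelfAdjoint_iff_isSymmetric.1 (IsSelfAdjoint.of_nonneg hT))
      -- Writing `u = T y` avoids the unbounded operator: after moving the self-adjoint `T` to the
      -- other side, orthogonality to `A u ⊗ f + u ⊗ (-Δ f)` says that the integral of `conj(f̂) ⟪y,
      -- w⟫` is zero.
      set w : R3 → H := fun q => V q + ((‖(2 * Real.pi) • q‖ ^ 2 : ℝ) : ℂ) • T (V q) with hw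
      have hint : ∀ s : Set R3, Bornology.IsBounded s → MeasurableSet s → IntegrableOn w s := by
        intro s hb hs
        have h0 : IntegrableOn V s :=
          integrableOn_Lp_of_measure_ne_top V (by norm_num) hb.measure_lt_top.ne
        refine h0.add ?_
        obtain ⟨C, hC⟩ := hb.exists_norm_le
        refine (T.integrable_comp h0).bdd_smul ((2 * Real.pi * C) ^ 2) ?_ ?_
        · exact Continuous.aestronglyMeasurable (by fun_prop)
        · filter_upwards [ae_restrict_mem hs] with q hq
          rw [Complex.norm_real, norm_pow, norm_norm, norm_smul,
            Real.norm_of_nonneg (by positivity)]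
          have := hC q hq
          gcongr
      have hzero : w =ᵐ[volume] 0 := by
        refine ae_eq_zero_of_forall_bounded_setIntegral_eq_zero
          (fun N => hint _ Metric.isBounded_ball measurableSet_ball) fun s hs hb => ?_
        refine ext_inner_left ℂ fun y => ?_
        -- Taking `f̂ = 1_s` gives vanishing integrals of `w` over every bounded set `s`;
        -- boundedness of `s` puts `f` in the domain of the Laplacian.
        obtain ⟨f, hf, -⟩ := exists_negLaplacian_fourierInv_indicator hs hb
        obtain ⟨hd, hAy⟩ := hA.1 y
        have hmem : elem y (f : L2R3) + elem (T y) (negLaplacian f) ∈ G := by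
          have h1 := fiberInverse_apply_tensorSum hT hA ⟨T y, hd⟩ f
          have h2 : (R.toLinearMap.prod LinearMap.id)
              (elem y (f : L2R3) + elem (T y) (negLaplacian f)) ∈ S := by
            refine ⟨⟨T y, hd⟩, f, ?_⟩
            rw [hAy] at h1 ⊢
            exact Prod.ext h1 rfl
          exact Submodule.le_topologicalClosure _ (Submodule.subset_span h2)
        have h0 := hv _ hmem
        rw [← (modelEquiv H).inner_map_map, L2.inner_def] at h0
        rw [inner_zero_right, ← integral_inner (hint s hb hs), ← h0, ← integral_indicator hs]
        refine integral_congr_ae ?_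
        filter_upwards [hf, coeFn_modelEquiv_tensorSum (T y) y f] with q h3 h4
        rw [h4, h3]
        by_cases hq : q ∈ s
        · simp only [hq, Set.indicator_of_mem, one_smul, hw]
          rw [inner_add_left, inner_add_right, inner_smul_left, inner_smul_right, hTs,
            Complex.conj_ofReal]
        · simp [hq]
      rw [← (modelEquiv H).map_eq_zero_iff, Lp.eq_zero_iff_ae_eq_zero]
      filter_upwards [hzero] with q hq
      -- Applying `(1 + |2πq|² T)⁻¹` to `w(q) = 0` recovers `V(q) = 0`.
      have h5 := congrArg (fun B : H →L[ℂ] H => B (V q))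
        (inv_mul_one_add (c := ‖(2 * Real.pi) • q‖ ^ 2) hT (by positivity))
      have h6 : cfc (fun t : ℝ => (1 + ‖(2 * Real.pi) • q‖ ^ 2 * t)⁻¹) T (w q) = V q := h5
      rw [hq] at h6
      rw [← hV, ← h6]
      exact map_zero _
    rw [hG.submodule_topologicalClosure_eq] at htop
    intro x
    have : x ∈ G := htop ▸ Submodule.mem_top
    exact this

theorem isStrictlyPositiveOp_tensorSum (hT : 0 ≤ T) (hA : IsBoundedInverse A T) :
    IsStrictlyPositiveOp (tensorSum A negLaplacian) :=
  (isBoundedInverse_tensorSum hT hA).isStrictlyPositiveOp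
    (fiberHom_nonneg (fiberInverse_nonneg hT))

/-- Matrix elements of `(A ⊗ I + I ⊗ (-Δ))^{-5/2}` between elementary tensors. -/
theorem inner_negPow_tensorSum (hT : 0 ≤ T) (hA : IsBoundedInverse A T) (J K : H) (f g : L2R3) :
    ⟪elem J f, negPow (tensorSum A negLaplacian) (5 / 2) (elem K g)⟫_ℂ =
      ∫ q : R3, ⟪(𝓕 f : L2R3) q, (𝓕 g : L2R3) q⟫_ℂ *
        ⟪J, cfc (rieszSymbol ((2 * Real.pi) • q)) T K⟫_ℂ := by
  -- The power is taken in the algebra of bounded continuous symbols, so one symbol `c` represents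
  -- the ambient power and equals the power of each fibre resolvent.
  obtain ⟨c, hc1, hc2⟩ := exists_mulOp_eq_rpow (fiberHom H) (fiberInverse_nonneg hT)
    (fiberHom_nonneg (fiberInverse_nonneg hT)) (s := 5 / 2) (by norm_num)
  rw [negPow, (isBoundedInverse_tensorSum hT hA).boundedInv_eq, ← hc1,
    ← (modelEquiv H).inner_map_map, L2.inner_def]
  refine integral_congr_ae ?_
  filter_upwards [coeFn_fiberHom c (elem K g), coeFn_modelEquiv_elem J f,
    coeFn_modelEquiv_elem K g] with q h1 h2 h3
  rw [h1, h2, h3, hc2, fiberInverse_apply, resolventOf_rpow hT, map_smul, inner_smul_left,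
    inner_smul_right, RCLike.inner_apply]
  ring

end Ambient

end MaxwellSlab

end

noncomputable section

namespace MaxwellSlab

open FourierTransform

/-! ### The Fourier transform of the mollifier -/

section Mollifier

theorem contDiff_mollify {η : R3 → ℂ} (hη : ContDiff ℝ ∞ η) (ε : ℝ) :
    ContDiff ℝ ∞ (mollify η ε) :=
  contDiff_const.mul (hη.comp (contDiff_const_smul _))

theorem hasCompactSupport_mollify {η : R3 → ℂ} (hc : HasCompactSupport η) {ε : ℝ} (hε : 0 < ε) :
    HasCompactSupport (mollify η ε) :=
  (hc.comp_smul (inv_ne_zero hε.ne')).mul_left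

theorem fourier_mollify (η : R3 → ℂ) {ε : ℝ} (hε : 0 < ε) (q : R3) :
    𝓕 (mollify η ε) q = 𝓕 η (ε • q) := by
  have h := Measure.integral_comp_inv_smul (volume : Measure R3)
    (fun y : R3 => Complex.exp (↑(-2 * Real.pi * inner ℝ y (ε • q)) * Complex.I) • η y) ε
  rw [Real.fourier_eq', Real.fourier_eq']
  have h2 : ∀ v : R3, Complex.exp (↑(-2 * Real.pi * inner ℝ v q) * Complex.I) • mollify η ε v =
      (((ε ^ 3)⁻¹ : ℝ) : ℂ) * (Complex.exp (↑(-2 * Real.pi * inner ℝ (ε⁻¹ • v) (ε • q)) *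
        Complex.I) • η (ε⁻¹ • v)) := by
    intro v
    have : inner ℝ (ε⁻¹ • v) (ε • q) = inner ℝ v q := by
      rw [real_inner_smul_left, real_inner_smul_right, inv_mul_cancel_left₀ hε.ne']
    rw [this, mollify, smul_eq_mul, smul_eq_mul]
    ring
  simp_rw [h2]
  rw [integral_const_mul, h]
  simp only [finrank_euclideanSpace, Fintype.card_fin, abs_of_pos (pow_pos hε 3),
    Complex.real_smul]
  rw [← mul_assoc, ← Complex.ofReal_mul, inv_mul_cancel₀ (pow_pos hε 3).ne', Complex.ofReal_one,
    one_mul]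

theorem coeFn_fourier_mollify {η : R3 → ℂ} (hη : ContDiff ℝ ∞ η) (hc : HasCompactSupport η) {ε : ℝ}
    (hε : 0 < ε) :
    (𝓕 ((memLp_mollify hη.continuous hc ε).toLp (mollify η ε)) : L2R3) =ᵐ[volume]
      fun q => 𝓕 η (ε • q) := by
  set S : 𝓢(R3, ℂ) := (hasCompactSupport_mollify hc hε).toSchwartzMap (contDiff_mollify hη ε)
  have h1 : (memLp_mollify hη.continuous hc ε).toLp (mollify η ε) = S.toLp 2 := rfl
  rw [h1, SchwartzMap.toLp_fourier_eq]
  filter_upwards [(𝓕 S).coeFn_toLp 2 volume] with q hq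
  rw [hq, SchwartzMap.fourier_coe]
  exact fourier_mollify η hε q

end Mollifier

/-! ### Removing the mollifier -/

section Limit

variable {H : Type*} [NormedAddCommGroup H] [InnerProductSpace ℂ H] [CompleteSpace H]
  {T : H →L[ℂ] H} {A : H →ₗ.[ℂ] H}

/-- The substitution `q ↦ 2πq` in dimension three has Jacobian `(2π)³`; this is the origin of the
factor in the definition of `VMx`. -/
theorem integral_inner_cfc_two_pi_smul (hT : 0 ≤ T) (J K : H) :
    ∫ q : R3, ⟪J, cfc (rieszSymbol ((2 * Real.pi) • q)) T K⟫_ℂ =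
      ⟪J, (((2 * Real.pi) ^ 3)⁻¹ • ∫ q : R3, cfc (rieszSymbol q) T) K⟫_ℂ := by
  rw [Measure.integral_comp_smul (volume : Measure R3)
    (fun q => ⟪J, cfc (rieszSymbol q) T K⟫_ℂ) (2 * Real.pi)]
  have hint := integrable_cfc_rieszSymbol hT
  have h1 : ⟪J, (∫ q : R3, cfc (rieszSymbol q) T) K⟫_ℂ =
      ∫ q : R3, ⟪J, cfc (rieszSymbol q) T K⟫_ℂ := by
    rw [ContinuousLinearMap.integral_apply hint, integral_inner]
    exact hint.apply_continuousLinearMap K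
  have h2 : ∀ (r : ℝ) (x : H), ⟪J, r • x⟫_ℂ = r • ⟪J, x⟫_ℂ := fun r x =>
    inner_smul_real_right _ _ _
  rw [_root_.smul_apply, h2, h1]
  simp only [finrank_euclideanSpace, Fintype.card_fin]
  rw [abs_of_pos (by positivity)]

/-- The mollifier enters only through `|η̂(εq)|²`, which is bounded uniformly in `ε` and tends to
`|η̂(0)|² = 1`. Only the integral of `η` survives in the limit. -/
theorem tendsto_inner_mollify (hT : 0 ≤ T) (hA : IsBoundedInverse A T) {η : R3 → ℂ}
    (hη : ContDiff ℝ ∞ η) (hc : HasCompactSupport η) (h1 : ∫ y, η y = 1) (J K : H) :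
    Tendsto (fun ε : ℝ => ⟪elem J ((memLp_mollify hη.continuous hc ε).toLp (mollify η ε)),
        negPow (tensorSum A negLaplacian) (5 / 2)
          (elem K ((memLp_mollify hη.continuous hc ε).toLp (mollify η ε)))⟫_ℂ) (𝓝[>] 0)
      (𝓝 ⟪J, (((2 * Real.pi) ^ 3)⁻¹ • ∫ q : R3, cfc (rieszSymbol q) T) K⟫_ℂ) := by
  set S : 𝓢(R3, ℂ) := 𝓕 (hc.toSchwartzMap hη) with hS
  have hSη : ∀ q, S q = 𝓕 η q := fun q => by
    rw [hS, SchwartzMap.fourier_coe]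
    rfl
  have hS0 : S 0 = 1 := by
    rw [hSη, Real.fourier_eq']
    simpa using h1
  set M : ℝ := SchwartzMap.seminorm ℂ 0 0 S
  have hM : ∀ q, ‖S q‖ ≤ M := fun q => SchwartzMap.norm_le_seminorm ℂ S q
  have hcont : Continuous fun q : R3 => cfc (rieszSymbol ((2 * Real.pi) • q)) T :=
    (continuous_cfc_of_uncurry (continuous_rieszSymbol_uncurry fun _ => spectrum_nonneg hT)
      (.of_nonneg hT)).comp (continuous_const_smul _)
  have hlim : Tendsto (fun ε : ℝ => ∫ q : R3, ⟪S (ε • q), S (ε • q)⟫_ℂ *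
      ⟪J, cfc (rieszSymbol ((2 * Real.pi) • q)) T K⟫_ℂ) (𝓝[>] 0)
      (𝓝 (∫ q : R3, ⟪J, cfc (rieszSymbol ((2 * Real.pi) • q)) T K⟫_ℂ)) := by
    -- The majorant is the squared supremum bound `M` of `η̂` times the `ε`-independent operator
    -- bound, integrable by the decay of order `|q|⁻⁵`.
    refine tendsto_integral_filter_of_dominated_convergence
      (fun q => M ^ 2 * (‖J‖ * (((‖T‖ + 1) ^ (5 / 2 : ℝ) *
        (1 + ‖(2 * Real.pi) • q‖ ^ 2) ^ (-(5 : ℝ) / 2)) * ‖K‖))) ?_ ?_ ?_ ?_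
    · refine Eventually.of_forall fun ε => Continuous.aestronglyMeasurable ?_
      have : Continuous fun q : R3 => S (ε • q) := S.continuous.comp (continuous_const_smul _)
      exact (this.inner this).mul (continuous_const.inner (hcont.clm_apply continuous_const))
    · refine Eventually.of_forall fun ε => ae_of_all _ fun q => ?_
      rw [norm_mul]
      refine mul_le_mul ?_ ?_ (norm_nonneg _) (by positivity)
      · refine (norm_inner_le_norm _ _).trans ?_
        rw [sq]
        exact mul_le_mul (hM _) (hM _) (norm_nonneg _) ((norm_nonneg _).trans (hM 0))
      · refine (norm_inner_le_norm _ _).trans ?_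
        gcongr
        exact ContinuousLinearMap.le_of_opNorm_le _ (norm_cfc_rieszSymbol_le hT _) _
    · have := ((integrable_rieszBound ((‖T‖ + 1) ^ (5 / 2 : ℝ))).comp_smul
        (R := 2 * Real.pi) (by positivity))
      exact ((this.mul_const ‖K‖).const_mul ‖J‖).const_mul (M ^ 2)
    · refine ae_of_all _ fun q => ?_
      have h0 : Tendsto (fun ε : ℝ => S (ε • q)) (𝓝[>] 0) (𝓝 1) := by
        have : Continuous fun ε : ℝ => S (ε • q) :=
          S.continuous.comp (continuous_id.smul continuous_const)
        have h := this.tendsto 0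
        rw [zero_smul, hS0] at h
        exact h.mono_left nhdsWithin_le_nhds
      have h2 := (h0.inner h0 (𝕜 := ℂ)).mul_const ⟪J, cfc (rieszSymbol ((2 * Real.pi) • q)) T K⟫_ℂ
      simpa using h2
  rw [integral_inner_cfc_two_pi_smul hT] at hlim
  refine hlim.congr' ?_
  filter_upwards [self_mem_nhdsWithin] with ε hε
  rw [inner_negPow_tensorSum hT hA]
  refine integral_congr_ae ?_
  filter_upwards [coeFn_fourier_mollify hη hc hε] with q hq
  rw [hq, hSη]

end Limit

end MaxwellSlab

end

noncomputable section

namespace MaxwellSlab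

/-! ### Separated waves on the cell -/

/-- The separated product `u(x₀) v(x₁) w(x₂)`. -/
def sepProd (u v w : ℝ → ℂ) (x : Fin 3 → ℝ) : ℂ := u (x 0) * v (x 1) * w (x 2)

/-- The plane wave `exp(i c t)`. -/
def expWave (c t : ℝ) : ℂ := Complex.exp ((c * t : ℝ) * Complex.I)

/-- The wave `cos(c t)`. -/
def cosWave (c t : ℝ) : ℂ := (Real.cos (c * t) : ℝ)

/-- The wave `sin(c t)`. -/
def sinWave (c t : ℝ) : ℂ := (Real.sin (c * t) : ℝ)

/-- The lateral frequencies of the slab. -/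
def latFreq (L : ℝ) (k : ℤ) : ℝ := 2 * Real.pi * k / L

/-- The plate frequencies of the slab. -/
def plateFreq (a : ℝ) (n : ℤ) : ℝ := Real.pi * n / a

theorem hasDerivAt_expWave (c t : ℝ) :
    HasDerivAt (expWave c) (Complex.I * c * expWave c t) t := by
  have h : HasDerivAt (fun t : ℝ => ((c * t : ℝ) : ℂ) * Complex.I) (c * Complex.I) t := by
    have := ((hasDerivAt_id t).const_mul c).ofReal_comp.mul_const Complex.I
    simpa using this
  have h2 := h.cexp
  refine h2.congr_deriv ?_
  rw [expWave]
  ring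

theorem hasDerivAt_cosWave (c t : ℝ) : HasDerivAt (cosWave c) (-c * sinWave c t) t := by
  have h : HasDerivAt (fun t : ℝ => Real.cos (c * t)) (-Real.sin (c * t) * c) t := by
    simpa using ((hasDerivAt_id t).const_mul c).cos
  refine h.ofReal_comp.congr_deriv ?_
  rw [sinWave]
  push_cast
  ring

theorem hasDerivAt_sinWave (c t : ℝ) : HasDerivAt (sinWave c) (c * cosWave c t) t := by
  have h : HasDerivAt (fun t : ℝ => Real.sin (c * t)) (Real.cos (c * t) * c) t := by
    simpa using ((hasDerivAt_id t).const_mul c).sin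
  refine h.ofReal_comp.congr_deriv ?_
  rw [cosWave]
  push_cast
  ring

theorem contDiff_expWave (c : ℝ) : ContDiff ℝ ∞ (expWave c) := by
  unfold expWave
  exact Complex.contDiff_exp.comp
    ((Complex.ofRealCLM.contDiff.comp (contDiff_const.mul contDiff_id)).mul contDiff_const)

theorem contDiff_cosWave (c : ℝ) : ContDiff ℝ ∞ (cosWave c) :=
  Complex.ofRealCLM.contDiff.comp (Real.contDiff_cos.comp (contDiff_const.mul contDiff_id))

theorem contDiff_sinWave (c : ℝ) : ContDiff ℝ ∞ (sinWave c) :=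
  Complex.ofRealCLM.contDiff.comp (Real.contDiff_sin.comp (contDiff_const.mul contDiff_id))

theorem contDiff_sepProd {u v w : ℝ → ℂ} (hu : ContDiff ℝ ∞ u) (hv : ContDiff ℝ ∞ v)
    (hw : ContDiff ℝ ∞ w) : ContDiff ℝ ∞ (sepProd u v w) :=
  ((hu.comp (contDiff_apply ℝ ℝ 0)).mul (hv.comp (contDiff_apply ℝ ℝ 1))).mul
    (hw.comp (contDiff_apply ℝ ℝ 2))

theorem hasFDerivAt_sepProd {u v w : ℝ → ℂ} {u' v' w' : ℂ} {x : Fin 3 → ℝ}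
    (hu : HasDerivAt u u' (x 0)) (hv : HasDerivAt v v' (x 1)) (hw : HasDerivAt w w' (x 2)) :
    HasFDerivAt (sepProd u v w)
      ((u (x 0) * v (x 1)) • (ContinuousLinearMap.proj (R := ℝ) (φ := fun _ : Fin 3 => ℝ) 2).smulRight w'
        + w (x 2) • (u (x 0) • (ContinuousLinearMap.proj (R := ℝ) (φ := fun _ : Fin 3 => ℝ) 1).smulRight v'
          + v (x 1) • (ContinuousLinearMap.proj (R := ℝ) (φ := fun _ : Fin 3 => ℝ) 0).smulRight u')) x := by
  have h0 : HasFDerivAt (fun y : Fin 3 → ℝ => u (y 0)) _ x :=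
    hu.hasFDerivAt.comp x (hasFDerivAt_apply (𝕜 := ℝ) (F' := fun _ : Fin 3 => ℝ) 0 x)
  have h1 : HasFDerivAt (fun y : Fin 3 → ℝ => v (y 1)) _ x :=
    hv.hasFDerivAt.comp x (hasFDerivAt_apply (𝕜 := ℝ) (F' := fun _ : Fin 3 => ℝ) 1 x)
  have h2 : HasFDerivAt (fun y : Fin 3 → ℝ => w (y 2)) _ x :=
    hw.hasFDerivAt.comp x (hasFDerivAt_apply (𝕜 := ℝ) (F' := fun _ : Fin 3 => ℝ) 2 x)
  refine ((h0.mul h1).mul h2).congr_fderiv ?_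
  ext y
  simp

theorem pderiv_sepProd {u v w : ℝ → ℂ} {u' v' w' : ℝ → ℂ} (hu : ∀ t, HasDerivAt u (u' t) t)
    (hv : ∀ t, HasDerivAt v (v' t) t) (hw : ∀ t, HasDerivAt w (w' t) t) :
    pderiv 0 (sepProd u v w) = sepProd u' v w ∧ pderiv 1 (sepProd u v w) = sepProd u v' w ∧
      pderiv 2 (sepProd u v w) = sepProd u v w' := by
  have h := fun x : Fin 3 → ℝ => (hasFDerivAt_sepProd (hu (x 0)) (hv (x 1)) (hw (x 2))).fderiv
  refine ⟨?_, ?_, ?_⟩ <;>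
  · funext x
    rw [pderiv, h x]
    simp [sepProd]
    try ring

theorem sepProd_const_mul₀ (c : ℂ) (u v w : ℝ → ℂ) (x : Fin 3 → ℝ) :
    sepProd (fun t => c * u t) v w x = c * sepProd u v w x := by
  simp only [sepProd]
  ring

theorem sepProd_const_mul₁ (c : ℂ) (u v w : ℝ → ℂ) (x : Fin 3 → ℝ) :
    sepProd u (fun t => c * v t) w x = c * sepProd u v w x := by
  simp only [sepProd]
  ring

theorem sepProd_const_mul₂ (c : ℂ) (u v w : ℝ → ℂ) (x : Fin 3 → ℝ) :
    sepProd u v (fun t => c * w t) x = c * sepProd u v w x := by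
  simp only [sepProd]
  ring

theorem expWave_latFreq_add_period {L : ℝ} (hL : L ≠ 0) (k : ℤ) (t : ℝ) :
    expWave (latFreq L k) (t + L) = expWave (latFreq L k) t := by
  have h : ((latFreq L k * (t + L) : ℝ) : ℂ) * Complex.I =
      ((latFreq L k * t : ℝ) : ℂ) * Complex.I + k * (2 * Real.pi * Complex.I) := by
    have : latFreq L k * (t + L) = latFreq L k * t + 2 * Real.pi * k := by
      rw [latFreq]
      field_simp
    rw [this]
    push_cast
    ring
  rw [expWave, expWave, h, Complex.exp_add, Complex.exp_int_mul_two_pi_mul_I, mul_one]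

theorem isLateralPeriodic_sepProd {L : ℝ} (hL : L ≠ 0) (k l : ℤ) (w : ℝ → ℂ) :
    IsLateralPeriodic L (sepProd (expWave (latFreq L k)) (expWave (latFreq L l)) w) := by
  intro x
  constructor <;> simp [sepProd, expWave_latFreq_add_period hL]

theorem expWave_mul (c d t : ℝ) : expWave c t * expWave d t = expWave (c + d) t := by
  rw [expWave, expWave, expWave, ← Complex.exp_add]
  push_cast
  ring_nf

theorem conj_expWave (c t : ℝ) : (starRingEnd ℂ) (expWave c t) = expWave (-c) t := by
  rw [expWave, expWave, ← Complex.exp_conj, map_mul, Complex.conj_I, Complex.conj_ofReal]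
  push_cast
  ring_nf

theorem cosWave_mul (c d t : ℝ) :
    cosWave c t * cosWave d t = (cosWave (c + d) t + cosWave (c - d) t) / 2 := by
  rw [cosWave, cosWave, cosWave, cosWave, add_mul, sub_mul, Real.cos_add, Real.cos_sub]
  push_cast
  ring

theorem sinWave_mul (c d t : ℝ) :
    sinWave c t * sinWave d t = (cosWave (c - d) t - cosWave (c + d) t) / 2 := by
  rw [sinWave, sinWave, cosWave, cosWave, add_mul, sub_mul, Real.cos_add, Real.cos_sub]
  push_cast
  ring

theorem sinWave_mul_cosWave (c d t : ℝ) :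
    sinWave c t * cosWave d t = (sinWave (c + d) t + sinWave (c - d) t) / 2 := by
  rw [sinWave, sinWave, sinWave, cosWave, add_mul, sub_mul, Real.sin_add, Real.sin_sub]
  push_cast
  ring

theorem latFreq_add (L : ℝ) (k l : ℤ) : latFreq L (k + l) = latFreq L k + latFreq L l := by
  simp only [latFreq]
  push_cast
  ring

theorem latFreq_neg (L : ℝ) (k : ℤ) : latFreq L (-k) = -latFreq L k := by
  simp only [latFreq]
  push_cast
  ring

theorem plateFreq_add (a : ℝ) (k l : ℤ) : plateFreq a (k + l) = plateFreq a k + plateFreq a l := by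
  simp only [plateFreq]
  push_cast
  ring

theorem plateFreq_sub (a : ℝ) (k l : ℤ) : plateFreq a (k - l) = plateFreq a k - plateFreq a l := by
  simp only [plateFreq]
  push_cast
  ring

theorem plateFreq_neg (a : ℝ) (k : ℤ) : plateFreq a (-k) = -plateFreq a k := by
  simp only [plateFreq]
  push_cast
  ring

theorem cosWave_neg (c t : ℝ) : cosWave (-c) t = cosWave c t := by
  rw [cosWave, cosWave, neg_mul, Real.cos_neg]

theorem sinWave_neg (c t : ℝ) : sinWave (-c) t = -sinWave c t := by
  rw [sinWave, sinWave, neg_mul, Real.sin_neg, Complex.ofReal_neg]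

/-! ### Integrals over the cell -/

theorem cellMeasure_eq_pi (L a : ℝ) :
    cellMeasure L a = Measure.pi fun i => volume.restrict (Set.Icc 0 (![L, L, a] i)) := by
  rw [← Measure.restrict_pi_pi, ← volume_pi, cellMeasure, cell, ← Set.pi_univ_Icc]
  rfl

theorem integral_sepProd (L a : ℝ) (u v w : ℝ → ℂ) :
    ∫ x, sepProd u v w x ∂(cellMeasure L a) =
      (∫ t in Set.Icc 0 L, u t) * (∫ t in Set.Icc 0 L, v t) * ∫ t in Set.Icc 0 a, w t := by
  have h := integral_fintype_prod_eq_prod (ι := Fin 3) (E := fun _ => ℝ)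
    (fun i => (![u, v, w] : Fin 3 → ℝ → ℂ) i)
    (μ := fun i => volume.restrict (Set.Icc 0 (![L, L, a] i)))
  rw [cellMeasure_eq_pi]
  simp only [Fin.prod_univ_three] at h
  exact h

theorem integral_expWave_eq_zero {L : ℝ} (hL : 0 < L) {k : ℤ} (hk : k ≠ 0) :
    ∫ t in Set.Icc 0 L, expWave (latFreq L k) t = 0 := by
  rw [integral_Icc_eq_integral_Ioc, ← intervalIntegral.integral_of_le hL.le]
  have hc : (latFreq L k : ℂ) * Complex.I ≠ 0 := by
    refine mul_ne_zero (Complex.ofReal_ne_zero.2 ?_) Complex.I_ne_zero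
    have : (k : ℝ) ≠ 0 := Int.cast_ne_zero.2 hk
    rw [latFreq]
    positivity
  have h1 : ∀ t : ℝ, expWave (latFreq L k) t = Complex.exp ((latFreq L k * Complex.I) * t) := by
    intro t
    rw [expWave]
    push_cast
    ring_nf
  have h2 := expWave_latFreq_add_period hL.ne' k 0
  rw [zero_add, h1, h1] at h2
  simp_rw [h1]
  rw [integral_exp_mul_complex hc, h2, sub_self, zero_div]

theorem integral_cosWave_eq_zero {a : ℝ} (ha : 0 < a) {n : ℤ} (hn : n ≠ 0) :
    ∫ t in Set.Icc 0 a, cosWave (plateFreq a n) t = 0 := by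
  rw [integral_Icc_eq_integral_Ioc, ← intervalIntegral.integral_of_le ha.le]
  have hc : plateFreq a n ≠ 0 := by
    have : (n : ℝ) ≠ 0 := Int.cast_ne_zero.2 hn
    rw [plateFreq]
    positivity
  have h : ∫ t in (0 : ℝ)..a, Real.cos (plateFreq a n * t) = 0 := by
    rw [intervalIntegral.integral_comp_mul_left _ hc, integral_cos]
    have : plateFreq a n * a = n * Real.pi := by
      rw [plateFreq]
      field_simp
    rw [this, mul_zero, Real.sin_int_mul_pi]
    simp
  unfold cosWave
  rw [intervalIntegral.integral_ofReal, h, Complex.ofReal_zero]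

/-! ### Parseval's identity for complete orthogonal families -/

/-- The nonzero vectors, normalized, form a Hilbert basis. Zero vectors are admitted and contribute
`0 / 0 = 0`, as do the sine modes with `n = 0`; this lets sine and cosine families share one index
set. -/
theorem hasSum_sq_inner_div_sq_norm {ι E : Type*} [NormedAddCommGroup E] [InnerProductSpace ℂ E]
    [CompleteSpace E] {v : ι → E} (hv : ∀ i j, i ≠ j → ⟪v i, v j⟫_ℂ = 0)
    (hc : ∀ x, (∀ i, ⟪v i, x⟫_ℂ = 0) → x = 0) (x : E) :
    HasSum (fun i => ‖⟪v i, x⟫_ℂ‖ ^ 2 / ‖v i‖ ^ 2) (‖x‖ ^ 2) := by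
  let s : Set ι := {i | v i ≠ 0}
  let w : s → E := fun i => ((‖v i‖⁻¹ : ℝ) : ℂ) • v i
  have hw : Orthonormal ℂ w := by
    refine ⟨fun i => ?_, fun i j hij => ?_⟩
    · rw [norm_smul, Complex.norm_real, norm_inv, norm_norm,
        inv_mul_cancel₀ (norm_ne_zero_iff.2 i.2)]
    · change ⟪((‖v i‖⁻¹ : ℝ) : ℂ) • v i, ((‖v j‖⁻¹ : ℝ) : ℂ) • v j⟫_ℂ = 0
      rw [inner_smul_left, inner_smul_right, hv _ _ (fun h => hij (Subtype.ext h)), mul_zero,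
        mul_zero]
  have hsp : (Submodule.span ℂ (Set.range w))ᗮ = ⊥ := by
    rw [Submodule.eq_bot_iff]
    intro y hy
    refine hc y fun i => ?_
    by_cases hi : v i = 0
    · rw [hi, inner_zero_left]
    · have h := hy _ (Submodule.subset_span ⟨(⟨i, hi⟩ : s), rfl⟩)
      rw [inner_smul_left] at h
      refine (mul_eq_zero.1 h).resolve_left ?_
      simpa using hi
  let b := HilbertBasis.mkOfOrthogonalEqBot hw hsp
  have hb : ⇑b = w := HilbertBasis.coe_mkOfOrthogonalEqBot hw hsp
  have h1 := b.hasSum_inner_mul_inner x x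
  rw [inner_self_eq_norm_sq_to_K] at h1
  have h2 : ∀ i : s, ⟪x, b i⟫_ℂ * ⟪b i, x⟫_ℂ =
      ((‖⟪v i, x⟫_ℂ‖ ^ 2 / ‖v i‖ ^ 2 : ℝ) : ℂ) := by
    intro i
    rw [hb, ← inner_conj_symm x, Complex.conj_mul', inner_smul_left, Complex.conj_ofReal, norm_mul,
      Complex.norm_real, norm_inv, norm_norm]
    push_cast
    ring
  simp_rw [h2] at h1
  have h3 : HasSum (fun i : s => ‖⟪v i, x⟫_ℂ‖ ^ 2 / ‖v i‖ ^ 2) (‖x‖ ^ 2) := by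
    refine Complex.hasSum_ofReal.1 ?_
    simpa using h1
  refine (hasSum_subtype_iff_of_support_subset (s := s) ?_).1 h3
  intro i hi
  by_contra h
  have : v i = 0 := by simpa [s] using h
  simp [this] at hi

end MaxwellSlab

end

noncomputable section

namespace MaxwellSlab

/-! ### Completeness of the separated waves -/

/-- The separated wave with a cosine profile. -/
def cosMode (L a : ℝ) (k l n : ℤ) : (Fin 3 → ℝ) → ℂ :=
  sepProd (expWave (latFreq L k)) (expWave (latFreq L l)) (cosWave (plateFreq a n))

/-- The separated wave with a sine profile. -/
def sinMode (L a : ℝ) (k l n : ℤ) : (Fin 3 → ℝ) → ℂ :=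
  sepProd (expWave (latFreq L k)) (expWave (latFreq L l)) (sinWave (plateFreq a n))

theorem contDiff_cosMode (L a : ℝ) (k l n : ℤ) : ContDiff ℝ ∞ (cosMode L a k l n) :=
  contDiff_sepProd (contDiff_expWave _) (contDiff_expWave _) (contDiff_cosWave _)

theorem contDiff_sinMode (L a : ℝ) (k l n : ℤ) : ContDiff ℝ ∞ (sinMode L a k l n) :=
  contDiff_sepProd (contDiff_expWave _) (contDiff_expWave _) (contDiff_sinWave _)

/-- The product formula for cosines makes the span of these modes an algebra, as Stone–Weierstrass
requires. Sines would not do: a product of two sines is a combination of cosines. -/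
theorem cosMode_mul (L a : ℝ) (k l n k' l' n' : ℤ) :
    cosMode L a k l n * cosMode L a k' l' n' =
      (2⁻¹ : ℂ) • (cosMode L a (k + k') (l + l') (n + n') +
        cosMode L a (k + k') (l + l') (n - n')) := by
  funext x
  have h := cosWave_mul (plateFreq a n) (plateFreq a n') (x 2)
  simp only [cosMode, sepProd, Pi.mul_apply, Pi.smul_apply, Pi.add_apply, smul_eq_mul,
    latFreq_add, plateFreq_add, plateFreq_sub, ← expWave_mul]
  linear_combination (expWave (latFreq L k) (x 0) * expWave (latFreq L k') (x 0) *
    expWave (latFreq L l) (x 1) * expWave (latFreq L l') (x 1)) * h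

theorem star_cosMode (L a : ℝ) (k l n : ℤ) :
    star (cosMode L a k l n) = cosMode L a (-k) (-l) n := by
  funext x
  simp only [cosMode, sepProd, Pi.star_apply, star_mul', Complex.star_def, conj_expWave, latFreq_neg]
  rw [cosWave, Complex.conj_ofReal]

theorem cosMode_zero (L a : ℝ) : cosMode L a 0 0 0 = 1 := by
  funext x
  simp [cosMode, sepProd, latFreq, plateFreq, expWave, cosWave]

theorem cosMode_neg (L a : ℝ) (k l n : ℤ) : cosMode L a k l (-n) = cosMode L a k l n := by
  funext x
  simp only [cosMode, sepProd, plateFreq_neg, cosWave_neg]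

theorem sinMode_neg (L a : ℝ) (k l n : ℤ) (x : Fin 3 → ℝ) :
    sinMode L a k l (-n) x = -sinMode L a k l n x := by
  simp only [sinMode, sepProd, plateFreq_neg, sinWave_neg]
  ring

/-- The trigonometric polynomials with cosine profiles. -/
def cosPoly (L a : ℝ) : Submodule ℂ ((Fin 3 → ℝ) → ℂ) :=
  Submodule.span ℂ (Set.range fun i : ℤ × ℤ × ℤ => cosMode L a i.1 i.2.1 i.2.2)

theorem cosMode_mem_cosPoly (L a : ℝ) (k l n : ℤ) : cosMode L a k l n ∈ cosPoly L a :=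
  Submodule.subset_span ⟨(k, l, n), rfl⟩

theorem mul_mem_cosPoly {L a : ℝ} {f g : (Fin 3 → ℝ) → ℂ} (hf : f ∈ cosPoly L a)
    (hg : g ∈ cosPoly L a) : f * g ∈ cosPoly L a := by
  refine Submodule.span_induction₂ (p := fun f g _ _ => f * g ∈ cosPoly L a)
    ?_ ?_ ?_ ?_ ?_ ?_ ?_ hf hg
  · rintro _ _ ⟨i, rfl⟩ ⟨j, rfl⟩
    rw [cosMode_mul]
    exact Submodule.smul_mem _ _
      (Submodule.add_mem _ (cosMode_mem_cosPoly _ _ _ _ _) (cosMode_mem_cosPoly _ _ _ _ _))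
  · intro y _
    rw [zero_mul]
    exact Submodule.zero_mem _
  · intro y _
    rw [mul_zero]
    exact Submodule.zero_mem _
  · intro x y z _ _ _ h1 h2
    rw [add_mul]
    exact Submodule.add_mem _ h1 h2
  · intro x y z _ _ _ h1 h2
    rw [mul_add]
    exact Submodule.add_mem _ h1 h2
  · intro r x y _ _ h
    rw [smul_mul_assoc]
    exact Submodule.smul_mem _ _ h
  · intro r x y _ _ h
    rw [mul_smul_comm]
    exact Submodule.smul_mem _ _ h

theorem star_mem_cosPoly {L a : ℝ} {f : (Fin 3 → ℝ) → ℂ} (hf : f ∈ cosPoly L a) :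
    star f ∈ cosPoly L a := by
  induction hf using Submodule.span_induction with
  | mem x hx =>
    obtain ⟨i, rfl⟩ := hx
    rw [star_cosMode]
    exact cosMode_mem_cosPoly _ _ _ _ _
  | zero => rw [star_zero]; exact Submodule.zero_mem _
  | add x y _ _ h1 h2 => rw [star_add]; exact Submodule.add_mem _ h1 h2
  | smul r x _ h => rw [star_smul]; exact Submodule.smul_mem _ _ h

theorem one_mem_cosPoly (L a : ℝ) : 1 ∈ cosPoly L a := by
  rw [← cosMode_zero L a]
  exact cosMode_mem_cosPoly _ _ _ _ _

/-- The map that identifies the opposite lateral faces of the cell. -/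
def glue (L a : ℝ) (x : Fin 3 → ℝ) : ℂ × ℂ × ℂ :=
  (expWave (latFreq L 1) (x 0), expWave (latFreq L 1) (x 1), cosWave (plateFreq a 1) (x 2))

theorem continuous_glue (L a : ℝ) : Continuous (glue L a) :=
  ((contDiff_expWave _).continuous.comp (continuous_apply 0)).prodMk
    (((contDiff_expWave _).continuous.comp (continuous_apply 1)).prodMk
      ((contDiff_cosWave _).continuous.comp (continuous_apply 2)))

/-- Equal exponentials give `s - t = m L` with `m` an integer. Having `s` in the open interval and
`t` in the closed one forces `|s - t| < L`; with both in the closed interval the two endpoints would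
be identified. -/
theorem eq_of_expWave_eq {L s t : ℝ} (hs : s ∈ Set.Ioo 0 L) (ht : t ∈ Set.Icc 0 L)
    (h : expWave (latFreq L 1) s = expWave (latFreq L 1) t) : s = t := by
  have hL : 0 < L := hs.1.trans hs.2
  obtain ⟨m, hm⟩ := Complex.exp_eq_exp_iff_exists_int.1 h
  have h1 : latFreq L 1 * s = latFreq L 1 * t + m * (2 * Real.pi) := by
    have h2 : (((latFreq L 1 * s : ℝ) : ℂ)) * Complex.I =
        ((latFreq L 1 * t + m * (2 * Real.pi) : ℝ) : ℂ) * Complex.I := by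
      rw [hm]
      push_cast
      ring
    exact_mod_cast mul_right_cancel₀ Complex.I_ne_zero h2
  have h3 : s = t + m * L := by
    rw [latFreq] at h1
    have hpi := Real.pi_pos
    field_simp at h1
    push_cast at h1
    linarith
  have h4 : (m : ℝ) * L < 1 * L := by
    rw [one_mul]
    linarith [hs.2, ht.1]
  have h5 : (-1 : ℝ) * L < m * L := by linarith [hs.1, ht.2]
  have h6 : (m : ℝ) < 1 := lt_of_mul_lt_mul_right h4 hL.le
  have h7 : (-1 : ℝ) < m := lt_of_mul_lt_mul_right h5 hL.le
  have h8 : m = 0 := by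
    have h9 : m < 1 := by exact_mod_cast h6
    have h10 : -1 < m := by exact_mod_cast h7
    omega
  rw [h3, h8]
  simp

theorem eq_of_cosWave_eq {a s t : ℝ} (ha : 0 < a) (hs : s ∈ Set.Icc 0 a) (ht : t ∈ Set.Icc 0 a)
    (h : cosWave (plateFreq a 1) s = cosWave (plateFreq a 1) t) : s = t := by
  have h1 : Real.cos (plateFreq a 1 * s) = Real.cos (plateFreq a 1 * t) := Complex.ofReal_injective h
  have hp : 0 < plateFreq a 1 := by
    rw [plateFreq]
    have := Real.pi_pos
    simp only [Int.cast_one]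
    positivity
  have h2 : ∀ r ∈ Set.Icc 0 a, plateFreq a 1 * r ∈ Set.Icc 0 Real.pi := by
    intro r hr
    refine ⟨mul_nonneg hp.le hr.1, ?_⟩
    have : plateFreq a 1 * a = Real.pi := by
      rw [plateFreq]
      field_simp
      simp
    rw [← this]
    exact mul_le_mul_of_nonneg_left hr.2 hp.le
  exact mul_left_cancel₀ hp.ne' (Real.injOn_cos (h2 s hs) (h2 t ht) h1)

/-- The open period cell. -/
def openCell (L a : ℝ) : Set (Fin 3 → ℝ) := Set.univ.pi fun i => Set.Ioo 0 (![L, L, a] i)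

theorem isOpen_openCell (L a : ℝ) : IsOpen (openCell L a) :=
  isOpen_set_pi Set.finite_univ fun _ _ => isOpen_Ioo

theorem ae_mem_openCell (L a : ℝ) : ∀ᵐ x ∂(cellMeasure L a), x ∈ openCell L a := by
  have h : (openCell L a : Set (Fin 3 → ℝ)) =ᵐ[volume] cell L a :=
    Measure.univ_pi_Ioo_ae_eq_Icc (μ := fun _ : Fin 3 => (volume : Measure ℝ)) (f := 0)
  refine (ae_restrict_iff' (measurableSet_Icc : MeasurableSet (cell L a))).2 ?_
  filter_upwards [h] with x hx hxc
  exact (hx.symm ▸ hxc : openCell L a x)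

theorem mem_cell_iff {L a : ℝ} {x : Fin 3 → ℝ} :
    x ∈ cell L a ↔ x 0 ∈ Set.Icc 0 L ∧ x 1 ∈ Set.Icc 0 L ∧ x 2 ∈ Set.Icc 0 a := by
  simp only [cell, Set.mem_Icc, Pi.le_def, Fin.forall_fin_succ]
  simp
  tauto

theorem mem_openCell_iff {L a : ℝ} {x : Fin 3 → ℝ} :
    x ∈ openCell L a ↔ x 0 ∈ Set.Ioo 0 L ∧ x 1 ∈ Set.Ioo 0 L ∧ x 2 ∈ Set.Ioo 0 a := by
  simp [openCell, Fin.forall_fin_succ]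

theorem eq_of_glue_eq {L a : ℝ} {x y : Fin 3 → ℝ} (hx : x ∈ openCell L a)
    (hy : y ∈ cell L a) (h : glue L a x = glue L a y) : x = y := by
  rw [mem_openCell_iff] at hx
  rw [mem_cell_iff] at hy
  simp only [glue, Prod.mk.injEq] at h
  have ha : 0 < a := hx.2.2.1.trans hx.2.2.2
  funext i
  fin_cases i
  · exact eq_of_expWave_eq hx.1 hy.1 h.1
  · exact eq_of_expWave_eq hx.2.1 hy.2.1 h.2.1
  · exact eq_of_cosWave_eq ha (Set.Ioo_subset_Icc_self hx.2.2) hy.2.2 h.2.2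

/-- The modes cannot separate opposite lateral faces, so Stone–Weierstrass is applied on the image
of the glueing map. A function supported in the open cell vanishes on the glued faces and therefore
descends to that image. -/
theorem exists_cosPoly_approx {L a : ℝ} {g : (Fin 3 → ℝ) → ℂ} (hg : Continuous g)
    (hs : ∀ x, g x ≠ 0 → x ∈ openCell L a) {ε : ℝ} (hε : 0 < ε) :
    ∃ p ∈ cosPoly L a, ∀ x ∈ cell L a, ‖g x - p x‖ ≤ ε := by
  have hc : CompactSpace (cell L a) :=
    isCompact_iff_compactSpace.1 (isCompact_Icc : IsCompact (Set.Icc 0 ![L, L, a]))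
  let Y := glue L a '' cell L a
  have hY : CompactSpace Y := isCompact_iff_compactSpace.1
    ((isCompact_Icc : IsCompact (Set.Icc 0 ![L, L, a])).image (continuous_glue L a))
  let θ : C(cell L a, Y) := ⟨fun x => ⟨glue L a x, x, x.2, rfl⟩,
    ((continuous_glue L a).comp continuous_subtype_val).subtype_mk _⟩
  -- A continuous surjection from a compact space onto a Hausdorff one is a quotient map, so
  -- functions constant on its fibres descend continuously.
  have hθ : Topology.IsQuotientMap θ := by
    refine θ.continuous.isClosedMap.isQuotientMap θ.continuous ?_
    rintro ⟨_, x, hx, rfl⟩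
    exact ⟨⟨x, hx⟩, rfl⟩
  let g' : C(cell L a, ℂ) := ⟨fun x => g x, hg.comp continuous_subtype_val⟩
  have hfac : Function.FactorsThrough g' θ := by
    intro x y hxy
    have h : glue L a x = glue L a y := congrArg Subtype.val hxy
    change g x = g y
    by_cases h1 : g x = 0
    · by_cases h2 : g y = 0
      · rw [h1, h2]
      · rw [eq_of_glue_eq (hs _ h2) x.2 h.symm]
    · rw [eq_of_glue_eq (hs _ h1) y.2 h]
  let G : C(Y, ℂ) := hθ.lift g' hfac
  have hG : ∀ x, G (θ x) = g x := fun x => DFunLike.congr_fun (hθ.lift_comp g' hfac) x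
  let A : StarSubalgebra ℂ C(Y, ℂ) :=
    { carrier := {F | ∃ p ∈ cosPoly L a, ∀ x, F (θ x) = p x}
      mul_mem' := by
        rintro F F' ⟨p, hp, h⟩ ⟨p', hp', h'⟩
        exact ⟨p * p', mul_mem_cosPoly hp hp', fun x => by simp [h, h']⟩
      one_mem' := ⟨1, one_mem_cosPoly L a, fun x => by simp⟩
      add_mem' := by
        rintro F F' ⟨p, hp, h⟩ ⟨p', hp', h'⟩
        exact ⟨p + p', Submodule.add_mem _ hp hp', fun x => by simp [h, h']⟩
      zero_mem' := ⟨0, Submodule.zero_mem _, fun x => by simp⟩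
      algebraMap_mem' := fun r => ⟨r • 1, Submodule.smul_mem _ _ (one_mem_cosPoly L a),
        fun x => by simp⟩
      star_mem' := by
        rintro F ⟨p, hp, h⟩
        exact ⟨star p, star_mem_cosPoly hp, fun x => by simp [h]⟩ }
  -- The three coordinates of the glueing map are themselves modes, of index `(1,0,0)`, `(0,1,0)`
  -- and `(0,0,1)`.
  have hsep : A.SeparatesPoints := by
    have hz : ∀ t : ℝ, expWave 0 t = 1 ∧ cosWave 0 t = 1 := fun t => by simp [expWave, cosWave]
    have hl : latFreq L 0 = 0 := by simp [latFreq]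
    have hp : plateFreq a 0 = 0 := by simp [plateFreq]
    have h0 : (⟨fun y => y.1.1, by fun_prop⟩ : C(Y, ℂ)) ∈ A :=
      ⟨cosMode L a 1 0 0, cosMode_mem_cosPoly _ _ _ _ _, fun x => by
        simp [cosMode, sepProd, hl, hp, hz, θ, glue]⟩
    have h1 : (⟨fun y => y.1.2.1, by fun_prop⟩ : C(Y, ℂ)) ∈ A :=
      ⟨cosMode L a 0 1 0, cosMode_mem_cosPoly _ _ _ _ _, fun x => by
        simp [cosMode, sepProd, hl, hp, hz, θ, glue]⟩
    have h2 : (⟨fun y => y.1.2.2, by fun_prop⟩ : C(Y, ℂ)) ∈ A :=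
      ⟨cosMode L a 0 0 1, cosMode_mem_cosPoly _ _ _ _ _, fun x => by
        simp [cosMode, sepProd, hl, hz, θ, glue]⟩
    intro y y' hyy
    by_contra! hcon
    refine hyy (Subtype.ext (Prod.ext ?_ (Prod.ext ?_ ?_)))
    · exact hcon _ ⟨_, h0, rfl⟩
    · exact hcon _ ⟨_, h1, rfl⟩
    · exact hcon _ ⟨_, h2, rfl⟩
  have htop := ContinuousMap.starSubalgebra_topologicalClosure_eq_top_of_separatesPoints A hsep
  have hmem : G ∈ closure (A : Set C(Y, ℂ)) := by
    have : G ∈ A.topologicalClosure := htop ▸ StarSubalgebra.mem_top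
    exact this
  obtain ⟨F, ⟨p, hp, hFp⟩, hF⟩ := Metric.mem_closure_iff.1 hmem ε hε
  refine ⟨p, hp, fun x hx => ?_⟩
  have h := (ContinuousMap.dist_apply_le_dist (f := G) (g := F) (θ ⟨x, hx⟩)).trans hF.le
  rwa [hG, hFp, dist_eq_norm] at h

theorem integrable_mul_of_continuous {L a : ℝ} {f g : (Fin 3 → ℝ) → ℂ}
    (hf : Integrable f (cellMeasure L a)) (hg : Continuous g) :
    Integrable (fun x => f x * g x) (cellMeasure L a) := by
  obtain ⟨C, hC⟩ := (isCompact_Icc : IsCompact (cell L a)).exists_bound_of_continuousOn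
    hg.continuousOn
  refine hf.mul_bdd hg.aestronglyMeasurable (c := C) ?_
  filter_upwards [ae_restrict_mem (measurableSet_Icc : MeasurableSet (cell L a))] with x hx
  exact hC x hx

theorem continuous_of_mem_cosPoly {L a : ℝ} {p : (Fin 3 → ℝ) → ℂ} (hp : p ∈ cosPoly L a) :
    Continuous p := by
  induction hp using Submodule.span_induction with
  | mem x hx =>
    obtain ⟨i, rfl⟩ := hx
    exact (contDiff_cosMode L a _ _ _).continuous
  | zero => exact continuous_zero
  | add x y _ _ h1 h2 => exact h1.add h2
  | smul r x _ h => exact h.const_smul r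

/-- An integrable function with vanishing cosine coefficients vanishes. -/
theorem ae_eq_zero_of_cosMode {L a : ℝ} {f : (Fin 3 → ℝ) → ℂ}
    (hf : Integrable f (cellMeasure L a))
    (h : ∀ (k l : ℤ) (n : ℕ), ∫ x, f x * cosMode L a k l n x ∂(cellMeasure L a) = 0) :
    f =ᵐ[cellMeasure L a] 0 := by
  have h1 : ∀ k l n : ℤ, ∫ x, f x * cosMode L a k l n x ∂(cellMeasure L a) = 0 := by
    intro k l n
    obtain ⟨m, rfl | rfl⟩ := n.eq_nat_or_neg
    · exact h k l m
    · rw [cosMode_neg]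
      exact h k l m
  have h2 : ∀ p ∈ cosPoly L a, ∫ x, f x * p x ∂(cellMeasure L a) = 0 := by
    intro p hp
    induction hp using Submodule.span_induction with
    | mem x hx =>
      obtain ⟨i, rfl⟩ := hx
      exact h1 _ _ _
    | zero => simp
    | add x y hx hy hx0 hy0 =>
      simp only [Pi.add_apply, mul_add]
      rw [integral_add (integrable_mul_of_continuous hf (continuous_of_mem_cosPoly hx))
        (integrable_mul_of_continuous hf (continuous_of_mem_cosPoly hy)), hx0, hy0, add_zero]
    | smul r x _ hx =>
      simp only [Pi.smul_apply, smul_eq_mul, mul_left_comm _ r]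
      rw [integral_const_mul, hx, mul_zero]
  -- A test function supported in the open cell is uniformly close to a trigonometric polynomial,
  -- against which `f` integrates to zero. The `+ 1` in the tolerance `ε / (M + 1)` covers `M = 0`.
  have h3 : ∀ᵐ x ∂(cellMeasure L a), x ∈ openCell L a → f x = 0 := by
    refine (isOpen_openCell L a).ae_eq_zero_of_integral_contDiff_smul_eq_zero
      (hf.locallyIntegrable.locallyIntegrableOn _) fun g hg _ hsupp => ?_
    have hgc : Continuous fun x => (g x : ℂ) := Complex.continuous_ofReal.comp hg.continuous
    have hgs : ∀ x, (g x : ℂ) ≠ 0 → x ∈ openCell L a := fun x hx =>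
      hsupp (subset_tsupport g (by simpa using hx))
    have h4 : ∀ x, g x • f x = f x * (g x : ℂ) := fun x => by
      rw [Complex.real_smul, mul_comm]
    simp_rw [h4]
    refine norm_le_zero_iff.1 (le_of_forall_pos_le_add fun ε hε => ?_)
    set M := ∫ x, ‖f x‖ ∂(cellMeasure L a) with hM
    have hM0 : 0 ≤ M := integral_nonneg fun _ => norm_nonneg _
    obtain ⟨p, hp, hpx⟩ := exists_cosPoly_approx hgc hgs (ε := ε / (M + 1)) (by positivity)
    have hpc := continuous_of_mem_cosPoly hp
    have h5 : ∫ x, f x * (g x : ℂ) ∂(cellMeasure L a) =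
        ∫ x, f x * ((g x : ℂ) - p x) ∂(cellMeasure L a) := by
      simp_rw [mul_sub]
      rw [integral_sub (integrable_mul_of_continuous hf hgc)
        (integrable_mul_of_continuous hf hpc), h2 p hp, sub_zero]
    rw [h5, zero_add]
    calc ‖∫ x, f x * ((g x : ℂ) - p x) ∂(cellMeasure L a)‖
        ≤ ∫ x, ‖f x‖ * (ε / (M + 1)) ∂(cellMeasure L a) := by
          refine norm_integral_le_of_norm_le (hf.norm.mul_const _) ?_
          filter_upwards [ae_restrict_mem (measurableSet_Icc : MeasurableSet (cell L a))] with x hx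
          rw [norm_mul]
          exact mul_le_mul_of_nonneg_left (hpx x hx) (norm_nonneg _)
      _ = M * (ε / (M + 1)) := by rw [integral_mul_const]
      _ ≤ ε := by
          rw [mul_div_assoc', div_le_iff₀ (by positivity)]
          nlinarith
  filter_upwards [h3, ae_mem_openCell L a] with x h4 h5
  exact h4 h5

/-- An integrable function with vanishing sine coefficients vanishes. -/
theorem ae_eq_zero_of_sinMode {L a : ℝ} {f : (Fin 3 → ℝ) → ℂ}
    (hf : Integrable f (cellMeasure L a))
    (h : ∀ (k l : ℤ) (n : ℕ), ∫ x, f x * sinMode L a k l n x ∂(cellMeasure L a) = 0) :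
    f =ᵐ[cellMeasure L a] 0 := by
  have h1 : ∀ k l n : ℤ, ∫ x, f x * sinMode L a k l n x ∂(cellMeasure L a) = 0 := by
    intro k l n
    obtain ⟨m, rfl | rfl⟩ := n.eq_nat_or_neg
    · exact h k l m
    · simp_rw [sinMode_neg, mul_neg]
      rw [integral_neg, h k l m, neg_zero]
  have hs : Continuous fun x : Fin 3 → ℝ => sinWave (plateFreq a 1) (x 2) :=
    (contDiff_sinWave _).continuous.comp (continuous_apply 2)
  -- Multiplying by `sin(πz/a)` turns the cosine coefficients into combinations of sine
  -- coefficients, so the product vanishes; the factor is positive inside the slab and can be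
  -- cancelled.
  have h2 : (fun x => f x * sinWave (plateFreq a 1) (x 2)) =ᵐ[cellMeasure L a] 0 := by
    refine ae_eq_zero_of_cosMode (integrable_mul_of_continuous hf hs) fun k l n => ?_
    have h3 : ∀ x, f x * sinWave (plateFreq a 1) (x 2) * cosMode L a k l n x =
        2⁻¹ * (f x * sinMode L a k l (1 + n) x + f x * sinMode L a k l (1 - n) x) := by
      intro x
      have := sinWave_mul_cosWave (plateFreq a 1) (plateFreq a n) (x 2)
      simp only [cosMode, sinMode, sepProd, plateFreq_add, plateFreq_sub]
      linear_combination (f x * expWave (latFreq L k) (x 0) * expWave (latFreq L l) (x 1)) * this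
    simp_rw [h3]
    rw [integral_const_mul, integral_add
      (integrable_mul_of_continuous hf (contDiff_sinMode L a _ _ _).continuous)
      (integrable_mul_of_continuous hf (contDiff_sinMode L a _ _ _).continuous), h1, h1]
    simp
  filter_upwards [h2, ae_mem_openCell L a] with x h3 h4
  refine (mul_eq_zero.1 h3).resolve_right ?_
  rw [mem_openCell_iff] at h4
  have ha : 0 < a := h4.2.2.1.trans h4.2.2.2
  refine Complex.ofReal_ne_zero.2 ?_
  refine (Real.sin_pos_of_pos_of_lt_pi ?_ ?_).ne'
  · have := h4.2.2.1
    rw [plateFreq]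
    have := Real.pi_pos
    simp only [Int.cast_one]
    positivity
  · have h5 := h4.2.2.2
    rw [plateFreq]
    have := Real.pi_pos
    simp only [Int.cast_one]
    rw [mul_one, div_mul_eq_mul_div, div_lt_iff₀ ha]
    exact mul_lt_mul_of_pos_left h5 this

end MaxwellSlab

end

noncomputable section

namespace MaxwellSlab

/-! ### The pairing as an inner product -/

theorem memLp_conjField (L a : ℝ) {g : Fin 3 → (Fin 3 → ℝ) → ℂ} (hg : ∀ i, Continuous (g i)) :
    MemLp (fun x => WithLp.toLp 2 fun i => (starRingEnd ℂ) (g i x) :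
      (Fin 3 → ℝ) → EuclideanSpace ℂ (Fin 3)) 2 (cellMeasure L a) := by
  have hc : Continuous (fun x => WithLp.toLp 2 fun i => (starRingEnd ℂ) (g i x) :
      (Fin 3 → ℝ) → EuclideanSpace ℂ (Fin 3)) :=
    (PiLp.continuous_toLp 2 _).comp
      (continuous_pi fun i => Complex.continuous_conj.comp (hg i))
  obtain ⟨C, hC⟩ := (isCompact_Icc : IsCompact (cell L a)).exists_bound_of_continuousOn
    hc.continuousOn
  refine MemLp.of_bound hc.aestronglyMeasurable C ?_
  filter_upwards [ae_restrict_mem (measurableSet_Icc : MeasurableSet (cell L a))] with x hx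
  exact hC x hx

/-- The complex conjugate of a continuous field, as a square integrable field. -/
def conjField (L a : ℝ) (g : Fin 3 → (Fin 3 → ℝ) → ℂ) (hg : ∀ i, Continuous (g i)) :
    FieldL2 L a :=
  (memLp_conjField L a hg).toLp _

theorem coeFn_conjField (L a : ℝ) {g : Fin 3 → (Fin 3 → ℝ) → ℂ} (hg : ∀ i, Continuous (g i)) :
    conjField L a g hg =ᵐ[cellMeasure L a]
      fun x => WithLp.toLp 2 fun i => (starRingEnd ℂ) (g i x) :=
  (memLp_conjField L a hg).coeFn_toLp

/-- Conjugating the test field turns the bilinear pairing into an inner product; continuity of the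
pairing and closedness of the spaces defined by it follow. -/
theorem inner_conjField {L a : ℝ} {g : Fin 3 → (Fin 3 → ℝ) → ℂ} (hg : ∀ i, Continuous (g i))
    (E : FieldL2 L a) : ⟪conjField L a g hg, E⟫_ℂ = pair E g := by
  rw [L2.inner_def, pair]
  refine integral_congr_ae ?_
  filter_upwards [coeFn_conjField L a hg] with x hx
  simp [hx, PiLp.inner_apply]

theorem continuous_pair {L a : ℝ} {g : Fin 3 → (Fin 3 → ℝ) → ℂ} (hg : ∀ i, Continuous (g i)) :
    Continuous fun E : FieldL2 L a => pair E g := by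
  simp_rw [← inner_conjField hg]
  fun_prop

theorem isClosed_curlGraph (L a : ℝ) :
    IsClosed (curlGraph L a : Set (FieldL2 L a × FieldL2 L a)) := by
  have h : (curlGraph L a : Set (FieldL2 L a × FieldL2 L a)) =
      ⋂ φ : (Fin 3 → ℝ) → EuclideanSpace ℂ (Fin 3), ⋂ (_ : IsTest L a φ), {p | pair p.2 (fun i x => φ x i) =
        pair p.1 (fun i x => curl φ x i)} := by
    ext p
    simp only [Set.mem_iInter, Set.mem_ofPred_eq]
    rfl
  rw [h]
  exact isClosed_iInter fun φ => isClosed_iInter fun hφ =>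
    isClosed_eq
      ((continuous_pair fun i => (contDiff_coord hφ.smooth i).continuous).comp continuous_snd)
      ((continuous_pair (continuous_curl hφ.smooth)).comp continuous_fst)

theorem isClosed_curlZeroGraph (L a : ℝ) :
    IsClosed (curlZeroGraph L a : Set (FieldL2 L a × FieldL2 L a)) :=
  (isClosed_curlGraph L a).inter (Submodule.isClosed_topologicalClosure _)

theorem isClosed_divFree (L a : ℝ) : IsClosed (divFree L a : Set (FieldL2 L a)) := by
  have h : (divFree L a : Set (FieldL2 L a)) =
      ⋂ φ, ⋂ (_ : IsTest L a φ), {E | pair E (fun i => pderiv i φ) = 0} := by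
    ext p
    simp only [Set.mem_iInter, Set.mem_ofPred_eq]
    rfl
  rw [h]
  exact isClosed_iInter fun φ => isClosed_iInter fun hφ =>
    isClosed_eq (continuous_pair (continuous_pderiv hφ.smooth)) continuous_const

/-! ### Integration by parts on the slab -/

/-- In the divergence theorem on the cell, opposite lateral faces cancel by periodicity, and the
normal component vanishes on the plates. -/
theorem integral_sum_pderiv_eq_zero {L a : ℝ} (hL : 0 ≤ L) (ha : 0 ≤ a)
    {f : Fin 3 → (Fin 3 → ℝ) → ℂ} (hf : ∀ i, ContDiff ℝ ∞ (f i))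
    (h0 : ∀ x, f 0 (x + Pi.single 0 L) = f 0 x) (h1 : ∀ x, f 1 (x + Pi.single 1 L) = f 1 x)
    (h2 : ∀ x, x 2 = 0 ∨ x 2 = a → f 2 x = 0) :
    ∫ x, ∑ i, pderiv i (f i) x ∂(cellMeasure L a) = 0 := by
  have hle : (0 : Fin 3 → ℝ) ≤ ![L, L, a] := by
    intro i
    fin_cases i <;> simpa
  have hc : Continuous fun x => ∑ i, pderiv i (f i) x :=
    continuous_finsetSum _ fun i _ => continuous_pderiv (hf i) i
  have h := integral_divergence_of_hasFDerivAt_off_countable' (0 : Fin 3 → ℝ) ![L, L, a] hle f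
    (fun i => fderiv ℝ (f i)) ∅ Set.countable_empty (fun i => (hf i).continuous.continuousOn)
    (fun x _ i => ((hf i).differentiable (by simp) x).hasFDerivAt)
    (hc.continuousOn.integrableOn_compact isCompact_Icc)
  refine h.trans (Finset.sum_eq_zero fun i _ => ?_)
  rw [sub_eq_zero]
  congr 1
  funext x
  fin_cases i
  · have : (Fin.insertNth (0 : Fin 3) L x : Fin 3 → ℝ) =
        Fin.insertNth (0 : Fin 3) (0 : ℝ) x + Pi.single 0 L := by
      funext j
      refine Fin.succAboveCases 0 ?_ (fun j => ?_) j <;> simp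
    simpa [this] using h0 _
  · have : (Fin.insertNth (1 : Fin 3) L x : Fin 3 → ℝ) =
        Fin.insertNth (1 : Fin 3) (0 : ℝ) x + Pi.single 1 L := by
      funext j
      refine Fin.succAboveCases 1 ?_ (fun j => ?_) j <;> simp
    simpa [this] using h1 _
  · exact (h2 _ (Or.inr (by simp))).trans (h2 _ (Or.inl (by simp))).symm

theorem pderiv_mul {f g : (Fin 3 → ℝ) → ℂ} (hf : ContDiff ℝ ∞ f) (hg : ContDiff ℝ ∞ g)
    (i : Fin 3) (x : Fin 3 → ℝ) :
    pderiv i (fun y => f y * g y) x = f x * pderiv i g x + pderiv i f x * g x := by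
  unfold pderiv
  rw [fderiv_fun_mul (hf.differentiable (by simp) x) (hg.differentiable (by simp) x)]
  simp [mul_comm]

theorem pderiv_sub {f g : (Fin 3 → ℝ) → ℂ} (hf : ContDiff ℝ ∞ f) (hg : ContDiff ℝ ∞ g)
    (i : Fin 3) (x : Fin 3 → ℝ) :
    pderiv i (fun y => f y - g y) x = pderiv i f x - pderiv i g x := by
  unfold pderiv
  rw [fderiv_fun_sub (hf.differentiable (by simp) x) (hg.differentiable (by simp) x)]
  rfl

theorem pderiv_const (c : ℂ) (i : Fin 3) (x : Fin 3 → ℝ) : pderiv i (fun _ => c) x = 0 := by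
  simp [pderiv]

/-- The difference of the integrands is the divergence of `Φ × ψ`. On the plates its normal
component involves only the tangential part of `Φ`, so `ψ` needs no boundary condition. -/
theorem integral_curl_mul_eq {L a : ℝ} (hL : 0 ≤ L) (ha : 0 ≤ a)
    {Φ ψ : (Fin 3 → ℝ) → EuclideanSpace ℂ (Fin 3)} (hΦ : IsSmoothPEC L a Φ)
    (hψ : ContDiff ℝ ∞ ψ) (hψL : IsLateralPeriodic L ψ) :
    ∫ x, ∑ i, curl Φ x i * ψ x i ∂(cellMeasure L a) =
      ∫ x, ∑ i, Φ x i * curl ψ x i ∂(cellMeasure L a) := by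
  have hp := fun i => contDiff_coord hΦ.smooth i
  have hq := fun i => contDiff_coord hψ i
  have hm := fun i j => (hp i).mul (hq j)
  have key := integral_sum_pderiv_eq_zero hL ha
    (f := ![fun x => Φ x 1 * ψ x 2 - Φ x 2 * ψ x 1, fun x => Φ x 2 * ψ x 0 - Φ x 0 * ψ x 2,
      fun x => Φ x 0 * ψ x 1 - Φ x 1 * ψ x 0])
    (by
      intro i
      fin_cases i
      · exact (hm 1 2).sub (hm 2 1)
      · exact (hm 2 0).sub (hm 0 2)
      · exact (hm 0 1).sub (hm 1 0))
    (fun x => by simp [(hΦ.periodic x).1, (hψL x).1])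
    (fun x => by simp [(hΦ.periodic x).2, (hψL x).2])
    (fun x hx => by simp [hΦ.tangential x hx])
  have hi : ∀ {f g : (Fin 3 → ℝ) → ℂ}, Continuous f → Continuous g →
      Integrable (fun x => f x * g x) (cellMeasure L a) := fun hf hg =>
    (hf.mul hg).continuousOn.integrableOn_compact (isCompact_Icc : IsCompact (cell L a))
  rw [← sub_eq_zero, ← integral_sub
    (integrable_finsetSum _ fun i _ => hi (continuous_curl hΦ.smooth i) (hq i).continuous)
    (integrable_finsetSum _ fun i _ => hi (hp i).continuous (continuous_curl hψ i)), ← key]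
  congr 1
  funext x
  simp only [Fin.sum_univ_three, Matrix.cons_val_zero, Matrix.cons_val_one, Matrix.cons_val]
  rw [pderiv_sub (hm 1 2) (hm 2 1), pderiv_sub (hm 2 0) (hm 0 2), pderiv_sub (hm 0 1) (hm 1 0)]
  simp only [pderiv_mul (hp _) (hq _)]
  simp only [curl, PiLp.toLp_apply, Matrix.cons_val_zero, Matrix.cons_val_one, Matrix.cons_val]
  ring

/-- The identity holds for smooth fields and passes to the graph closure. This is the form taken by
the perfect-conductor condition: test fields need not vanish near the plates. -/
theorem pair_eq_pair_curl {L a : ℝ} (hL : 0 ≤ L) (ha : 0 ≤ a)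
    {p : FieldL2 L a × FieldL2 L a} (hp : p ∈ curlZeroGraph L a)
    {ψ : (Fin 3 → ℝ) → EuclideanSpace ℂ (Fin 3)} (hψ : ContDiff ℝ ∞ ψ)
    (hψL : IsLateralPeriodic L ψ) :
    pair p.2 (fun i x => ψ x i) = pair p.1 (fun i x => curl ψ x i) := by
  have hc1 := fun i => (contDiff_coord hψ i).continuous
  have hc2 := continuous_curl hψ
  let S : Submodule ℂ (FieldL2 L a × FieldL2 L a) :=
    { carrier := {p | pair p.2 (fun i x => ψ x i) = pair p.1 (fun i x => curl ψ x i)}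
      zero_mem' := by simp [pair_zero]
      add_mem' := fun {p q} h1 h2 => by
        simp only [Set.mem_ofPred_eq] at h1 h2 ⊢
        rw [Prod.snd_add, Prod.fst_add, pair_add _ _ hc1, pair_add _ _ hc2, h1, h2]
      smul_mem' := fun c p h1 => by
        simp only [Set.mem_ofPred_eq] at h1 ⊢
        rw [Prod.smul_snd, Prod.smul_fst, pair_smul, pair_smul, h1] }
  have hS : IsClosed (S : Set (FieldL2 L a × FieldL2 L a)) :=
    isClosed_eq ((continuous_pair hc1).comp continuous_snd)
      ((continuous_pair hc2).comp continuous_fst)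
  have hle : (Submodule.span ℂ (smoothPECPairs L a)).topologicalClosure ≤ S := by
    refine Submodule.topologicalClosure_minimal _ (Submodule.span_le.2 ?_) hS
    rintro ⟨E, C⟩ ⟨Φ, hΦ, hE, hC⟩
    change pair C _ = pair E _
    have e1 : pair C (fun i x => ψ x i) =
        ∫ x, ∑ i, curl Φ x i * ψ x i ∂(cellMeasure L a) := by
      refine integral_congr_ae ?_
      filter_upwards [hC] with x hx
      simp only [show C x = curl Φ x from hx]
    have e2 : pair E (fun i x => curl ψ x i) =
        ∫ x, ∑ i, Φ x i * curl ψ x i ∂(cellMeasure L a) := by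
      refine integral_congr_ae ?_
      filter_upwards [hE] with x hx
      simp only [show E x = Φ x from hx]
    rw [e1, e2]
    exact integral_curl_mul_eq hL ha hΦ hψ hψL
  exact hle hp.2

/-! ### The static mode -/

theorem coeFn_staticMode (L a : ℝ) : staticMode L a =ᵐ[cellMeasure L a] fun _ =>
    (((L ^ 2 * a) ^ (-(1 / 2) : ℝ) : ℝ) : ℂ) • EuclideanSpace.single 2 (1 : ℂ) := by
  filter_upwards [Lp.coeFn_smul (((L ^ 2 * a) ^ (-(1 / 2) : ℝ) : ℝ) : ℂ)
    (Lp.const 2 (cellMeasure L a) (EuclideanSpace.single (2 : Fin 3) (1 : ℂ))),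
    Lp.coeFn_const (p := 2) (cellMeasure L a) (EuclideanSpace.single (2 : Fin 3) (1 : ℂ))]
    with x h1 h2
  rw [staticMode, h1, Pi.smul_apply, h2]
  rfl

theorem pair_staticMode {L a : ℝ} (g : Fin 3 → (Fin 3 → ℝ) → ℂ) :
    pair (staticMode L a) g =
      (((L ^ 2 * a) ^ (-(1 / 2) : ℝ) : ℝ) : ℂ) * ∫ x, g 2 x ∂(cellMeasure L a) := by
  rw [← integral_const_mul]
  refine integral_congr_ae ?_
  filter_upwards [coeFn_staticMode L a] with x hx
  simp [hx]

theorem staticMode_mem_curlZeroGraph {L a : ℝ} (hL : 0 ≤ L) (ha : 0 ≤ a) :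
    (staticMode L a, 0) ∈ curlZeroGraph L a := by
  refine ⟨fun φ hφ => ?_, Submodule.le_topologicalClosure _ (Submodule.subset_span
    ⟨fun _ => (((L ^ 2 * a) ^ (-(1 / 2) : ℝ) : ℝ) : ℂ) • EuclideanSpace.single 2 (1 : ℂ),
      ⟨contDiff_const, fun _ => ⟨rfl, rfl⟩, fun _ _ => by simp⟩, coeFn_staticMode L a, ?_⟩)⟩
  · have hq := fun i => contDiff_coord hφ.smooth i
    rw [pair_zero, pair_staticMode]
    -- The normal component of `∇ × φ` is the divergence of `(φ₁, -φ₀, 0)`, which has no flux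
    -- through the plates.
    have key := integral_sum_pderiv_eq_zero hL ha
      (f := ![fun x => φ x 1, fun x => 0 - φ x 0, fun x => 0])
      (by
        intro i
        fin_cases i
        · exact hq 1
        · exact contDiff_const.sub (hq 0)
        · exact contDiff_const)
      (fun x => by simp [(hφ.periodic x).1])
      (fun x => by simp [(hφ.periodic x).2])
      (fun x hx => by simp)
    simp only [Fin.sum_univ_three, Matrix.cons_val_zero, Matrix.cons_val_one, Matrix.cons_val]
      at key
    simp only [pderiv_sub contDiff_const (hq _), pderiv_const] at key
    simp only [curl, PiLp.toLp_apply, Matrix.cons_val]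
    rw [show (fun x => pderiv 0 (fun y => φ y 1) x - pderiv 1 (fun y => φ y 0) x) =
      fun x => pderiv 0 (fun x => φ x 1) x + (0 - pderiv 1 (fun y => φ y 0) x) + 0 from by
        funext x; ring, key, mul_zero]
  · filter_upwards [Lp.coeFn_zero (EuclideanSpace ℂ (Fin 3)) 2 (cellMeasure L a)] with x hx
    rw [hx]
    ext i
    fin_cases i <;> simp [curl, pderiv]

theorem staticMode_mem_divFree {L a : ℝ} (hL : 0 ≤ L) (ha : 0 ≤ a) :
    staticMode L a ∈ divFree L a := by
  intro φ hφ
  rw [pair_staticMode]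
  have key := integral_sum_pderiv_eq_zero hL ha (f := ![fun x => 0, fun x => 0, φ])
    (by
      intro i
      fin_cases i
      · exact contDiff_const
      · exact contDiff_const
      · exact hφ.smooth)
    (fun x => by simp) (fun x => by simp)
    (fun x hx => by
      obtain ⟨δ, hδ, h⟩ := hφ.support
      by_contra hne
      have := h x hne
      rcases hx with hx | hx <;> rw [hx] at this <;> linarith)
  simp only [Fin.sum_univ_three, Matrix.cons_val_zero, Matrix.cons_val_one, Matrix.cons_val,
    pderiv_const, zero_add] at key
  rw [key, mul_zero]

theorem staticMode_mem_VPEC {L a : ℝ} (hL : 0 ≤ L) (ha : 0 ≤ a) : staticMode L a ∈ VPEC L a :=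
  ⟨⟨_, staticMode_mem_curlZeroGraph hL ha, rfl⟩, staticMode_mem_divFree hL ha⟩

end MaxwellSlab

end

noncomputable section

namespace MaxwellSlab

/-! ### Cut-off near the plates -/

theorem exists_norm_deriv_smoothTransition_le :
    ∃ M : ℝ, 0 ≤ M ∧ ∀ t, |deriv Real.smoothTransition t| ≤ M := by
  have hc : Continuous (deriv Real.smoothTransition) :=
    (Real.smoothTransition.contDiff (n := 1)).continuous_deriv le_rfl
  obtain ⟨M, hM⟩ := (isCompact_Icc : IsCompact (Set.Icc (0 : ℝ) 1)).exists_bound_of_continuousOn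
    hc.continuousOn
  have hM0 : 0 ≤ M := (norm_nonneg _).trans (hM 0 (by simp))
  refine ⟨M, hM0, fun t => ?_⟩
  rcases lt_or_ge t 0 with h | h
  · have : Real.smoothTransition =ᶠ[𝓝 t] fun _ => 0 := by
      filter_upwards [eventually_lt_nhds h] with s hs
      exact Real.smoothTransition.zero_of_nonpos hs.le
    rw [this.deriv_eq]
    simpa
  rcases lt_or_ge 1 t with h' | h'
  · have : Real.smoothTransition =ᶠ[𝓝 t] fun _ => 1 := by
      filter_upwards [eventually_gt_nhds h'] with s hs
      exact Real.smoothTransition.one_of_one_le hs.le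
    rw [this.deriv_eq]
    simpa
  · exact hM t ⟨h, h'⟩

theorem deriv_smoothTransition_eq_zero {t : ℝ} (ht : 1 < t) :
    deriv Real.smoothTransition t = 0 := by
  have : Real.smoothTransition =ᶠ[𝓝 t] fun _ => 1 := by
    filter_upwards [eventually_gt_nhds ht] with s hs
    exact Real.smoothTransition.one_of_one_le hs.le
  rw [this.deriv_eq]
  simp

/-- A cut-off vanishing near `0` and `a` and tending to `1` inside `(0, a)` as `j → ∞`. -/
def cutoff (a : ℝ) (j : ℕ) (t : ℝ) : ℝ :=
  Real.smoothTransition (j * t - 1) * Real.smoothTransition (j * (a - t) - 1)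

/-- The derivative of the cut-off. -/
def cutoffDeriv (a : ℝ) (j : ℕ) (t : ℝ) : ℝ :=
  j * deriv Real.smoothTransition (j * t - 1) * Real.smoothTransition (j * (a - t) - 1) -
    Real.smoothTransition (j * t - 1) * (j * deriv Real.smoothTransition (j * (a - t) - 1))

theorem hasDerivAt_cutoff (a : ℝ) (j : ℕ) (t : ℝ) :
    HasDerivAt (cutoff a j) (cutoffDeriv a j t) t := by
  have hs : ∀ s, HasDerivAt Real.smoothTransition (deriv Real.smoothTransition s) s := fun s =>
    ((Real.smoothTransition.contDiff (n := 1)).differentiable (by simp) s).hasDerivAt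
  have h1 : HasDerivAt (fun t : ℝ => (j : ℝ) * t - 1) j t := by
    simpa using ((hasDerivAt_id t).const_mul (j : ℝ)).sub_const 1
  have h2 : HasDerivAt (fun t : ℝ => (j : ℝ) * (a - t) - 1) (-j) t := by
    simpa using (((hasDerivAt_id t).const_sub a).const_mul (j : ℝ)).sub_const 1
  refine (((hs _).comp t h1).mul ((hs _).comp t h2)).congr_deriv ?_
  simp only [cutoffDeriv, Function.comp]
  ring

theorem contDiff_cutoff (a : ℝ) (j : ℕ) : ContDiff ℝ ∞ (cutoff a j) :=
  (Real.smoothTransition.contDiff.comp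
    ((contDiff_const.mul contDiff_id).sub contDiff_const)).mul
    (Real.smoothTransition.contDiff.comp
      ((contDiff_const.mul (contDiff_const.sub contDiff_id)).sub contDiff_const))

theorem continuous_cutoffDeriv (a : ℝ) (j : ℕ) : Continuous (cutoffDeriv a j) := by
  have hc : Continuous (deriv Real.smoothTransition) :=
    (Real.smoothTransition.contDiff (n := 1)).continuous_deriv le_rfl
  have hs := Real.smoothTransition.continuous
  unfold cutoffDeriv
  fun_prop

theorem cutoff_eq_zero {a t : ℝ} {j : ℕ} (h : cutoff a j t ≠ 0) :
    1 ≤ j * t ∧ 1 ≤ j * (a - t) := by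
  constructor <;> by_contra! hlt <;> refine h ?_ <;> rw [cutoff]
  · rw [Real.smoothTransition.zero_of_nonpos (by linarith), zero_mul]
  · rw [Real.smoothTransition.zero_of_nonpos (x := j * (a - t) - 1) (by linarith), mul_zero]

theorem abs_cutoff_le (a : ℝ) (j : ℕ) (t : ℝ) : |cutoff a j t| ≤ 1 := by
  rw [cutoff, abs_of_nonneg (mul_nonneg (Real.smoothTransition.nonneg _)
    (Real.smoothTransition.nonneg _))]
  exact mul_le_one₀ (Real.smoothTransition.le_one _) (Real.smoothTransition.nonneg _)
    (Real.smoothTransition.le_one _)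

theorem eventually_lt_natCast_mul {t : ℝ} (ht : 0 < t) : ∀ᶠ j : ℕ in atTop, 2 < j * t :=
  (tendsto_natCast_atTop_atTop.atTop_mul_const ht).eventually_gt_atTop 2

theorem eventually_cutoff_eq {a t : ℝ} (ht : t ∈ Set.Ioo 0 a) :
    ∀ᶠ j : ℕ in atTop, cutoff a j t = 1 ∧ cutoffDeriv a j t = 0 := by
  -- Once `j t > 2` and `j (a - t) > 2`, both arguments exceed `1`, where the transition function is
  -- locally constant.
  filter_upwards [eventually_lt_natCast_mul ht.1,
    eventually_lt_natCast_mul (sub_pos.2 ht.2)] with j h1 h2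
  rw [cutoff, cutoffDeriv, deriv_smoothTransition_eq_zero (by linarith),
    deriv_smoothTransition_eq_zero (by linarith),
    Real.smoothTransition.one_of_one_le (by linarith),
    Real.smoothTransition.one_of_one_le (by linarith)]
  simp

/-- The derivative of the cut-off is compensated by a factor that vanishes on the plates. -/
theorem exists_norm_cutoffDeriv_mul_le {a K : ℝ} {w : ℝ → ℂ} (h0 : ∀ t, ‖w t‖ ≤ K * |t|)
    (h1 : ∀ t, ‖w t‖ ≤ K * |a - t|) :
    ∃ C, ∀ j : ℕ, ∀ t ∈ Set.Icc 0 a, ‖(cutoffDeriv a j t : ℂ) * w t‖ ≤ C := by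
  obtain ⟨M, hM0, hM⟩ := exists_norm_deriv_smoothTransition_le
  have hK : 0 ≤ K := by simpa using (norm_nonneg _).trans (h0 1)
  -- The derivative has size of order `j`, but only where `j s ≤ 2`; there the linear factor `K s`
  -- compensates for it.
  have key : ∀ (j : ℕ) (s : ℝ), 0 ≤ s →
      |j * deriv Real.smoothTransition (j * s - 1)| * (K * |s|) ≤ 2 * K * M := by
    intro j s hs
    rcases lt_or_ge 2 (j * s) with h | h
    · rw [deriv_smoothTransition_eq_zero (by linarith)]
      simp only [mul_zero, abs_zero, zero_mul]
      positivity
    · rw [abs_mul, abs_of_nonneg hs, Nat.abs_cast]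
      calc (j : ℝ) * |deriv Real.smoothTransition (j * s - 1)| * (K * s)
          = (j * s) * (K * |deriv Real.smoothTransition (j * s - 1)|) := by ring
        _ ≤ 2 * (K * M) := by
            gcongr
            exact hM _
        _ = 2 * K * M := by ring
  have hle : ∀ s, |Real.smoothTransition s| ≤ 1 := fun s => by
    rw [abs_of_nonneg (Real.smoothTransition.nonneg s)]
    exact Real.smoothTransition.le_one s
  refine ⟨2 * K * M + 2 * K * M, fun j t ht => ?_⟩
  rw [norm_mul, Complex.norm_real, Real.norm_eq_abs, cutoffDeriv]
  refine (mul_le_mul_of_nonneg_right (abs_sub _ _) (norm_nonneg _)).trans ?_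
  rw [add_mul]
  refine add_le_add ?_ ?_
  · rw [abs_mul]
    refine le_trans ?_ (key j t ht.1)
    exact mul_le_mul (mul_le_of_le_one_right (abs_nonneg _) (hle _)) (h0 t) (norm_nonneg _)
      (abs_nonneg _)
  · rw [abs_mul]
    refine le_trans ?_ (key j (a - t) (sub_nonneg.2 ht.2))
    exact mul_le_mul (mul_le_of_le_one_left (abs_nonneg _) (hle _)) (h1 t) (norm_nonneg _)
      (abs_nonneg _)

theorem tendsto_integral_mul_sepProd {L a C : ℝ} {f : (Fin 3 → ℝ) → ℂ} {u v w : ℝ → ℂ}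
    {W : ℕ → ℝ → ℂ} (hf : Integrable f (cellMeasure L a)) (hu : Continuous u)
    (hv : Continuous v) (hW : ∀ j, Continuous (W j))
    (hC : ∀ j, ∀ t ∈ Set.Icc 0 a, ‖W j t‖ ≤ C)
    (hlim : ∀ t ∈ Set.Ioo 0 a, ∀ᶠ j in atTop, W j t = w t) :
    Tendsto (fun j => ∫ x, f x * sepProd u v (W j) x ∂(cellMeasure L a)) atTop
      (𝓝 (∫ x, f x * sepProd u v w x ∂(cellMeasure L a))) := by
  have hcont : Continuous fun x : Fin 3 → ℝ => u (x 0) * v (x 1) := by fun_prop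
  have hfi := integrable_mul_of_continuous hf hcont
  refine tendsto_integral_of_dominated_convergence
    (fun x => ‖f x * (u (x 0) * v (x 1))‖ * C) (fun j => ?_) (hfi.norm.mul_const C)
    (fun j => ?_) ?_
  · refine hf.aestronglyMeasurable.mul (Continuous.aestronglyMeasurable ?_)
    have := hW j
    unfold sepProd
    fun_prop
  · filter_upwards [ae_mem_openCell L a] with x hx
    rw [mem_openCell_iff] at hx
    rw [sepProd, ← mul_assoc, norm_mul]
    exact mul_le_mul_of_nonneg_left (hC j _ (Set.Ioo_subset_Icc_self hx.2.2)) (norm_nonneg _)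
  · filter_upwards [ae_mem_openCell L a] with x hx
    rw [mem_openCell_iff] at hx
    refine tendsto_const_nhds.congr' ?_
    filter_upwards [hlim _ hx.2.2] with j hj
    rw [sepProd, sepProd, hj]

theorem isTest_sepProd_cutoff {L a : ℝ} (hL : L ≠ 0) (k l : ℤ) {w : ℝ → ℂ}
    (hw : ContDiff ℝ ∞ w) (j : ℕ) :
    IsTest L a (sepProd (expWave (latFreq L k)) (expWave (latFreq L l))
      fun t => (cutoff a j t : ℂ) * w t) where
  smooth := contDiff_sepProd (contDiff_expWave _) (contDiff_expWave _)
    ((Complex.ofRealCLM.contDiff.comp (contDiff_cutoff a j)).mul hw)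
  periodic := isLateralPeriodic_sepProd hL k l _
  support := by
    -- Using `1 / (j + 1)` instead of `1 / j` keeps the margin positive at `j = 0`, where the
    -- cut-off vanishes identically.
    refine ⟨((j : ℝ) + 1)⁻¹, by positivity, fun x hx => ?_⟩
    have h : cutoff a j (x 2) ≠ 0 := by
      rintro h
      exact hx (by simp [sepProd, h])
    obtain ⟨h1, h2⟩ := cutoff_eq_zero h
    have hj : (0 : ℝ) ≤ j := Nat.cast_nonneg j
    have h3 : 0 < x 2 := by
      by_contra! h
      nlinarith
    have h4 : 0 < a - x 2 := by
      by_contra! h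
      nlinarith
    constructor
    · rw [inv_le_iff_one_le_mul₀ (by positivity)]
      nlinarith
    · rw [le_sub_comm, inv_le_iff_one_le_mul₀ (by positivity)]
      nlinarith

/-! ### Consequences for square integrable fields -/

theorem integrable_coord {L a : ℝ} (E : FieldL2 L a) (i : Fin 3) :
    Integrable (fun x => E x i) (cellMeasure L a) := by
  simpa using integrable_coord_mul E i (g := fun _ => 1) continuous_const

theorem pair_single {L a : ℝ} (E : FieldL2 L a) (i : Fin 3) (g : (Fin 3 → ℝ) → ℂ) :
    pair E (Pi.single i g) = ∫ x, E x i * g x ∂(cellMeasure L a) := by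
  refine integral_congr_ae (Eventually.of_forall fun x => ?_)
  simp only
  rw [Finset.sum_eq_single i]
  · simp
  · intro j _ hj
    simp [hj]
  · simp

theorem contDiff_single {φ : (Fin 3 → ℝ) → ℂ} (hφ : ContDiff ℝ ∞ φ) (i : Fin 3) :
    ContDiff ℝ ∞ fun x => (EuclideanSpace.single i (φ x) : EuclideanSpace ℂ (Fin 3)) := by
  refine (contDiff_piLp (𝕜 := ℝ) 2).2 fun m => ?_
  by_cases hm : m = i
  · subst hm
    simpa using hφ
  · simpa [hm] using contDiff_const

theorem single_apply_eq_pi_single (φ : (Fin 3 → ℝ) → ℂ) (i : Fin 3) :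
    (fun m x => (EuclideanSpace.single i (φ x) : EuclideanSpace ℂ (Fin 3)) m) =
      Pi.single i φ := by
  funext m x
  by_cases hm : m = i
  · subst hm
    simp
  · simp [hm]

/-- The weak curl is unique. Testing one component at a time with a cut-off cosine mode and removing
the cut-off shows that all cosine coefficients of `C` vanish. -/
theorem eq_zero_of_mem_curlGraph {L a : ℝ} (hL : L ≠ 0) {C : FieldL2 L a}
    (hC : (0, C) ∈ curlGraph L a) : C = 0 := by
  have h : ∀ i, (fun x => C x i) =ᵐ[cellMeasure L a] 0 := by
    intro i
    refine ae_eq_zero_of_cosMode (integrable_coord C i) fun k l n => ?_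
    refine tendsto_nhds_unique (tendsto_integral_mul_sepProd (C := 1) (integrable_coord C i)
      (contDiff_expWave _).continuous (contDiff_expWave _).continuous
      (W := fun j t => (cutoff a j t : ℂ) * cosWave (plateFreq a n) t) (fun j => ?_)
      (fun j t _ => ?_) (fun t ht => ?_)) (tendsto_const_nhds.congr fun j => ?_)
    · exact (Complex.continuous_ofReal.comp (contDiff_cutoff a j).continuous).mul
        (contDiff_cosWave _).continuous
    · rw [norm_mul, Complex.norm_real, Real.norm_eq_abs, cosWave, Complex.norm_real,
        Real.norm_eq_abs]
      exact mul_le_one₀ (abs_cutoff_le a j t) (abs_nonneg _) (Real.abs_cos_le_one _)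
    · filter_upwards [eventually_cutoff_eq ht] with j hj
      rw [hj.1, Complex.ofReal_one, one_mul]
    · have ht := isTest_sepProd_cutoff (a := a) hL k l (contDiff_cosWave (plateFreq a n)) j
      set φ := sepProd (expWave (latFreq L k)) (expWave (latFreq L l))
        fun t => (cutoff a j t : ℂ) * cosWave (plateFreq a n) t with hφ
      have htest : IsTest L a fun x => EuclideanSpace.single i (φ x) := by
        refine ⟨?_, fun x => ?_, ?_⟩
        · exact contDiff_single ht.smooth i
        · simp only [(ht.periodic x).1, (ht.periodic x).2, and_self]
        · obtain ⟨δ, hδ, h⟩ := ht.support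
          exact ⟨δ, hδ, fun x hx => h x fun h0 => hx (by simp [h0])⟩
      have h1 := hC _ htest
      rw [pair_zero] at h1
      rw [← h1]
      rw [single_apply_eq_pi_single, pair_single]
  refine Lp.ext ?_
  filter_upwards [h 0, h 1, h 2, Lp.coeFn_zero (EuclideanSpace ℂ (Fin 3)) 2 (cellMeasure L a)]
    with x h0 h1 h2 h3
  rw [h3]
  ext i
  fin_cases i
  · exact h0
  · exact h1
  · exact h2

/-- For a divergence-free field the weak divergence equation may be tested with functions that
only vanish on the plates. -/
theorem integral_div_sinMode {L a : ℝ} (hL : L ≠ 0) {E : FieldL2 L a}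
    (hE : E ∈ divFree L a) (ha : a ≠ 0) (k l n : ℤ) :
    Complex.I * latFreq L k * ∫ x, E x 0 * sinMode L a k l n x ∂(cellMeasure L a) +
      Complex.I * latFreq L l * ∫ x, E x 1 * sinMode L a k l n x ∂(cellMeasure L a) +
      plateFreq a n * ∫ x, E x 2 * cosMode L a k l n x ∂(cellMeasure L a) = 0 := by
  set α := latFreq L k
  set β := latFreq L l
  set ζ := plateFreq a n with hζ
  -- The sine vanishes linearly at both plates, at `a` because `ζ a` is an integer multiple of `π`.
  -- This is the compensation needed for the derivative of the cut-off.
  have hs0 : ∀ t, ‖sinWave ζ t‖ ≤ |ζ| * |t| := fun t => by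
    rw [sinWave, Complex.norm_real, Real.norm_eq_abs, ← abs_mul]
    exact Real.abs_sin_le_abs
  have hs1 : ∀ t, ‖sinWave ζ t‖ ≤ |ζ| * |a - t| := fun t => by
    have h : Real.sin (ζ * a) = 0 := by
      rw [hζ, plateFreq, div_mul_cancel₀ _ ha, mul_comm, Real.sin_int_mul_pi]
    have h2 : Real.sin (ζ * (a - t)) = - (Real.cos (ζ * a) * Real.sin (ζ * t)) := by
      rw [mul_sub, Real.sin_sub, h]
      ring
    have h3 : |Real.cos (ζ * a)| = 1 := by
      have := Real.sin_sq_add_cos_sq (ζ * a)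
      rw [h] at this
      rw [← sq_eq_sq₀ (abs_nonneg _) zero_le_one, sq_abs]
      linarith
    rw [sinWave, Complex.norm_real, Real.norm_eq_abs, ← abs_mul]
    calc |Real.sin (ζ * t)| = |Real.sin (ζ * (a - t))| := by
          rw [h2, abs_neg, abs_mul, h3, one_mul]
      _ ≤ |ζ * (a - t)| := Real.abs_sin_le_abs
  obtain ⟨D, hD⟩ := exists_norm_cutoffDeriv_mul_le hs0 hs1
  have hcs : ∀ j, Continuous fun t => (cutoff a j t : ℂ) := fun j =>
    Complex.continuous_ofReal.comp (contDiff_cutoff a j).continuous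
  have hcd : ∀ j, Continuous fun t => (cutoffDeriv a j t : ℂ) := fun j =>
    Complex.continuous_ofReal.comp (continuous_cutoffDeriv a j)
  have hsn := (contDiff_sinWave ζ).continuous
  have hcn := (contDiff_cosWave ζ).continuous
  have hea := (contDiff_expWave α).continuous
  have heb := (contDiff_expWave β).continuous
  have hsb : ∀ t, ‖sinWave ζ t‖ ≤ 1 := fun t => by
    rw [sinWave, Complex.norm_real]
    exact Real.abs_sin_le_one _
  have hcb : ∀ t, ‖cosWave ζ t‖ ≤ 1 := fun t => by
    rw [cosWave, Complex.norm_real]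
    exact Real.abs_cos_le_one _
  have hcut : ∀ j t, ‖(cutoff a j t : ℂ)‖ ≤ 1 := fun j t => by
    rw [Complex.norm_real]
    exact abs_cutoff_le a j t
  have hlim1 : ∀ i, Tendsto (fun j : ℕ => ∫ x, E x i * sepProd (expWave α) (expWave β)
      (fun t => (cutoff a j t : ℂ) * sinWave ζ t) x ∂(cellMeasure L a)) atTop
      (𝓝 (∫ x, E x i * sinMode L a k l n x ∂(cellMeasure L a))) := fun i => by
    refine tendsto_integral_mul_sepProd (C := 1) (integrable_coord E i) hea heb
      (fun j => (hcs j).mul hsn) (fun j t _ => ?_) (fun t ht => ?_)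
    · rw [norm_mul]
      exact mul_le_one₀ (hcut j t) (norm_nonneg _) (hsb t)
    · filter_upwards [eventually_cutoff_eq ht] with j hj
      rw [hj.1, Complex.ofReal_one, one_mul]
  -- The term with the derivative of the cut-off is bounded uniformly in `j` and eventually zero at
  -- each interior point, so it leaves no boundary contribution.
  have hlim2 : Tendsto (fun j : ℕ => ∫ x, E x 2 * sepProd (expWave α) (expWave β)
      (fun t => (cutoffDeriv a j t : ℂ) * sinWave ζ t + cutoff a j t * (ζ * cosWave ζ t)) x
        ∂(cellMeasure L a)) atTop
      (𝓝 (∫ x, E x 2 * sepProd (expWave α) (expWave β) (fun t => ζ * cosWave ζ t) x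
        ∂(cellMeasure L a))) := by
    refine tendsto_integral_mul_sepProd (C := D + |ζ|) (integrable_coord E 2) hea heb
      (fun j => ((hcd j).mul hsn).add ((hcs j).mul (continuous_const.mul hcn)))
      (fun j t ht => ?_) (fun t ht => ?_)
    · refine (norm_add_le _ _).trans (add_le_add (hD j t ht) ?_)
      rw [norm_mul, norm_mul, Complex.norm_real ζ, Real.norm_eq_abs]
      calc _ ≤ 1 * (|ζ| * 1) := by
            gcongr
            · exact hcut j t
            · exact hcb t
        _ = |ζ| := by ring
    · filter_upwards [eventually_cutoff_eq ht] with j hj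
      rw [hj.1, hj.2]
      simp
  have hlim := (((hlim1 0).const_mul (Complex.I * α)).add
    ((hlim1 1).const_mul (Complex.I * β))).add hlim2
  have hfin : ∫ x, E x 2 * sepProd (expWave α) (expWave β) (fun t => ζ * cosWave ζ t) x
        ∂(cellMeasure L a) = ζ * ∫ x, E x 2 * cosMode L a k l n x ∂(cellMeasure L a) := by
    rw [← integral_const_mul]
    congr 1
    funext x
    rw [sepProd_const_mul₂]
    change _ = ζ * (E x 2 * sepProd (expWave α) (expWave β) (cosWave ζ) x)
    ring
  rw [hfin] at hlim
  -- For each `j` the sum is the pairing of `E` with the gradient of an admissible test function,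
  -- hence zero.
  refine tendsto_nhds_unique hlim (tendsto_const_nhds.congr fun j => ?_)
  have ht := isTest_sepProd_cutoff (a := a) hL k l (contDiff_sinWave ζ) j
  have hd := pderiv_sepProd (w := fun t => (cutoff a j t : ℂ) * sinWave ζ t)
    (hasDerivAt_expWave α) (hasDerivAt_expWave β)
    (fun t => (hasDerivAt_cutoff a j t).ofReal_comp.mul (hasDerivAt_sinWave ζ t))
  have h0 := hE _ ht
  rw [← h0, pair]
  have hint : ∀ i, Integrable (fun x => E x i * pderiv i (sepProd (expWave α) (expWave β)
      fun t => (cutoff a j t : ℂ) * sinWave ζ t) x) (cellMeasure L a) := fun i =>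
    integrable_coord_mul E i (continuous_pderiv ht.smooth i)
  rw [integral_finsetSum _ fun i _ => hint i, Fin.sum_univ_three]
  congr 1
  · congr 1
    · rw [← integral_const_mul]
      congr 1
      funext x
      rw [hd.1]
      rw [sepProd_const_mul₀]
      ring
    · rw [← integral_const_mul]
      congr 1
      funext x
      rw [hd.2.1]
      rw [sepProd_const_mul₁]
      ring
  · congr 1
    funext x
    rw [hd.2.2]

end MaxwellSlab

end

noncomputable section

namespace MaxwellSlab

/-! ### Orthogonality of the separated modes -/

theorem conj_cosMode_mul_cosMode (L a : ℝ) (k l n k' l' n' : ℤ) (x : Fin 3 → ℝ) :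
    (starRingEnd ℂ) (cosMode L a k' l' n' x) * cosMode L a k l n x =
      2⁻¹ * (cosMode L a (k - k') (l - l') (n - n') x +
        cosMode L a (k - k') (l - l') (n + n') x) := by
  have h := cosWave_mul (plateFreq a n) (plateFreq a n') (x 2)
  have hc : (starRingEnd ℂ) (cosWave (plateFreq a n') (x 2)) = cosWave (plateFreq a n') (x 2) :=
    Complex.conj_ofReal _
  simp only [cosMode, sepProd, map_mul, conj_expWave, hc, sub_eq_add_neg k, sub_eq_add_neg l,
    latFreq_add, latFreq_neg, plateFreq_add, plateFreq_sub, ← expWave_mul]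
  linear_combination (expWave (latFreq L k) (x 0) * expWave (-latFreq L k') (x 0) *
    expWave (latFreq L l) (x 1) * expWave (-latFreq L l') (x 1)) * h

theorem conj_sinMode_mul_sinMode (L a : ℝ) (k l n k' l' n' : ℤ) (x : Fin 3 → ℝ) :
    (starRingEnd ℂ) (sinMode L a k' l' n' x) * sinMode L a k l n x =
      2⁻¹ * (cosMode L a (k - k') (l - l') (n - n') x -
        cosMode L a (k - k') (l - l') (n + n') x) := by
  have h := sinWave_mul (plateFreq a n) (plateFreq a n') (x 2)
  have hc : (starRingEnd ℂ) (sinWave (plateFreq a n') (x 2)) = sinWave (plateFreq a n') (x 2) :=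
    Complex.conj_ofReal _
  simp only [cosMode, sinMode, sepProd, map_mul, conj_expWave, hc, sub_eq_add_neg k,
    sub_eq_add_neg l, latFreq_add, latFreq_neg, plateFreq_add, plateFreq_sub, ← expWave_mul]
  linear_combination (expWave (latFreq L k) (x 0) * expWave (-latFreq L k') (x 0) *
    expWave (latFreq L l) (x 1) * expWave (-latFreq L l') (x 1)) * h

theorem integrable_of_continuous {L a : ℝ} {f : (Fin 3 → ℝ) → ℂ} (hf : Continuous f) :
    Integrable f (cellMeasure L a) :=
  hf.continuousOn.integrableOn_compact (isCompact_Icc : IsCompact (cell L a))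

theorem integral_cosMode_eq_zero {L a : ℝ} (hL : 0 < L) (ha : 0 < a) {k l n : ℤ}
    (h : ¬(k = 0 ∧ l = 0 ∧ n = 0)) : ∫ x, cosMode L a k l n x ∂(cellMeasure L a) = 0 := by
  rw [cosMode, integral_sepProd]
  by_cases hk : k = 0
  · by_cases hl : l = 0
    · rw [integral_cosWave_eq_zero ha fun hn => h ⟨hk, hl, hn⟩, mul_zero]
    · rw [integral_expWave_eq_zero hL hl, mul_zero, zero_mul]
  · rw [integral_expWave_eq_zero hL hk, zero_mul, zero_mul]

theorem integral_cosMode_zero (L a : ℝ) :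
    ∫ x, cosMode L a 0 0 0 x ∂(cellMeasure L a) = ((cellMeasure L a).real Set.univ : ℂ) := by
  rw [cosMode_zero]
  simp

theorem integral_conj_cosMode_mul (L a : ℝ) (k l n k' l' n' : ℤ) :
    ∫ x, (starRingEnd ℂ) (cosMode L a k' l' n' x) * cosMode L a k l n x ∂(cellMeasure L a) =
      2⁻¹ * (∫ x, cosMode L a (k - k') (l - l') (n - n') x ∂(cellMeasure L a) +
        ∫ x, cosMode L a (k - k') (l - l') (n + n') x ∂(cellMeasure L a)) := by
  simp_rw [conj_cosMode_mul_cosMode]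
  rw [integral_const_mul, integral_add
    (integrable_of_continuous (contDiff_cosMode L a _ _ _).continuous)
    (integrable_of_continuous (contDiff_cosMode L a _ _ _).continuous)]

theorem integral_conj_sinMode_mul (L a : ℝ) (k l n k' l' n' : ℤ) :
    ∫ x, (starRingEnd ℂ) (sinMode L a k' l' n' x) * sinMode L a k l n x ∂(cellMeasure L a) =
      2⁻¹ * (∫ x, cosMode L a (k - k') (l - l') (n - n') x ∂(cellMeasure L a) -
        ∫ x, cosMode L a (k - k') (l - l') (n + n') x ∂(cellMeasure L a)) := by
  simp_rw [conj_sinMode_mul_sinMode]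
  rw [integral_const_mul, integral_sub
    (integrable_of_continuous (contDiff_cosMode L a _ _ _).continuous)
    (integrable_of_continuous (contDiff_cosMode L a _ _ _).continuous)]

/-- The squared norm of the cosine modes. -/
def cosNorm (L a : ℝ) (n : ℕ) : ℝ :=
  if n = 0 then (cellMeasure L a).real Set.univ else (cellMeasure L a).real Set.univ / 2

/-- The squared norm of the sine modes. -/
def sinNorm (L a : ℝ) (n : ℕ) : ℝ :=
  if n = 0 then 0 else (cellMeasure L a).real Set.univ / 2

theorem integral_conj_cosMode_mul_self {L a : ℝ} (hL : 0 < L) (ha : 0 < a) (k l : ℤ) (n : ℕ) :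
    ∫ x, (starRingEnd ℂ) (cosMode L a k l n x) * cosMode L a k l n x ∂(cellMeasure L a) =
      (cosNorm L a n : ℂ) := by
  rw [integral_conj_cosMode_mul, cosNorm, sub_self, sub_self, sub_self, integral_cosMode_zero]
  split_ifs with hn
  · subst hn
    rw [Nat.cast_zero, add_zero, integral_cosMode_zero]
    ring
  · rw [integral_cosMode_eq_zero hL ha (by omega)]
    push_cast
    ring

theorem integral_conj_sinMode_mul_self {L a : ℝ} (hL : 0 < L) (ha : 0 < a) (k l : ℤ) (n : ℕ) :
    ∫ x, (starRingEnd ℂ) (sinMode L a k l n x) * sinMode L a k l n x ∂(cellMeasure L a) =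
      (sinNorm L a n : ℂ) := by
  rw [integral_conj_sinMode_mul, sinNorm, sub_self, sub_self, sub_self, integral_cosMode_zero]
  split_ifs with hn
  · subst hn
    rw [Nat.cast_zero, add_zero, integral_cosMode_zero]
    simp
  · rw [integral_cosMode_eq_zero hL ha (by omega)]
    push_cast
    ring

theorem integral_conj_cosMode_mul_eq_zero {L a : ℝ} (hL : 0 < L) (ha : 0 < a)
    {p q : ℤ × ℤ × ℕ} (h : p ≠ q) :
    ∫ x, (starRingEnd ℂ) (cosMode L a q.1 q.2.1 q.2.2 x) * cosMode L a p.1 p.2.1 p.2.2 x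
      ∂(cellMeasure L a) = 0 := by
  have h' : ¬(p.1 = q.1 ∧ p.2.1 = q.2.1 ∧ p.2.2 = q.2.2) := fun hh =>
    h (Prod.ext hh.1 (Prod.ext hh.2.1 hh.2.2))
  rw [integral_conj_cosMode_mul, integral_cosMode_eq_zero hL ha (by omega),
    integral_cosMode_eq_zero hL ha (by omega)]
  simp

theorem integral_conj_sinMode_mul_eq_zero {L a : ℝ} (hL : 0 < L) (ha : 0 < a)
    {p q : ℤ × ℤ × ℕ} (h : p ≠ q) :
    ∫ x, (starRingEnd ℂ) (sinMode L a q.1 q.2.1 q.2.2 x) * sinMode L a p.1 p.2.1 p.2.2 x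
      ∂(cellMeasure L a) = 0 := by
  have h' : ¬(p.1 = q.1 ∧ p.2.1 = q.2.1 ∧ p.2.2 = q.2.2) := fun hh =>
    h (Prod.ext hh.1 (Prod.ext hh.2.1 hh.2.2))
  rw [integral_conj_sinMode_mul, integral_cosMode_eq_zero hL ha (by omega),
    integral_cosMode_eq_zero hL ha (by omega)]
  simp

/-! ### Parseval's identity for vector fields -/

theorem continuous_pi_single {g : (Fin 3 → ℝ) → ℂ} (hg : Continuous g) (i j : Fin 3) :
    Continuous ((Pi.single i g : Fin 3 → (Fin 3 → ℝ) → ℂ) j) := by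
  by_cases h : j = i
  · subst h
    simpa using hg
  · simp only [ne_eq, h, not_false_eq_true, Pi.single_eq_of_ne]
    exact continuous_zero

/-- The orthogonal family consists of the conjugated modes placed in a single component, indexed by
mode and component. Different components are orthogonal pointwise, so each may have its own complete
scalar family. -/
theorem hasSum_sq_coef {L a : ℝ} {m : ℤ × ℤ × ℕ → Fin 3 → (Fin 3 → ℝ) → ℂ}
    {N : ℤ × ℤ × ℕ → Fin 3 → ℝ} (hm : ∀ p i, Continuous (m p i))
    (horth : ∀ i p q, p ≠ q →
      ∫ x, (starRingEnd ℂ) (m q i x) * m p i x ∂(cellMeasure L a) = 0)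
    (hN : ∀ p i, ∫ x, (starRingEnd ℂ) (m p i x) * m p i x ∂(cellMeasure L a) = (N p i : ℂ))
    (hcomplete : ∀ i (f : (Fin 3 → ℝ) → ℂ), Integrable f (cellMeasure L a) →
      (∀ p, ∫ x, f x * m p i x ∂(cellMeasure L a) = 0) → f =ᵐ[cellMeasure L a] 0)
    (E : FieldL2 L a) :
    HasSum (fun p => ∑ i, ‖∫ x, E x i * m p i x ∂(cellMeasure L a)‖ ^ 2 / N p i) (‖E‖ ^ 2) := by
  let v : (ℤ × ℤ × ℕ) × Fin 3 → FieldL2 L a := fun r =>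
    conjField L a (Pi.single r.2 (m r.1 r.2)) (continuous_pi_single (hm _ _) _)
  have hv : ∀ r F, ⟪v r, F⟫_ℂ = ∫ x, F x r.2 * m r.1 r.2 x ∂(cellMeasure L a) := fun r F => by
    rw [inner_conjField, pair_single]
  have hvv : ∀ r s, ⟪v r, v s⟫_ℂ = ∫ x, (starRingEnd ℂ)
      ((Pi.single s.2 (m s.1 s.2) : Fin 3 → (Fin 3 → ℝ) → ℂ) r.2 x) * m r.1 r.2 x
        ∂(cellMeasure L a) := fun r s => by
    rw [hv]
    refine integral_congr_ae ?_
    filter_upwards [coeFn_conjField L a (continuous_pi_single (hm s.1 s.2) s.2)] with x hx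
    change (conjField L a _ _ x) r.2 * _ = _
    rw [hx]
  have h0 : ∀ r s, r ≠ s → ⟪v r, v s⟫_ℂ = 0 := by
    rintro ⟨p, i⟩ ⟨q, j⟩ hrs
    rw [hvv]
    by_cases hij : i = j
    · subst hij
      simp only [Pi.single_eq_same]
      exact horth i p q fun h => hrs (by rw [h])
    · simp [hij]
  have h1 : ∀ r, ‖v r‖ ^ 2 = N r.1 r.2 := by
    intro r
    have h := inner_self_eq_norm_sq_to_K (𝕜 := ℂ) (v r)
    rw [hvv] at h
    simp only [Pi.single_eq_same, hN] at h
    refine Complex.ofReal_injective ?_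
    rw [Complex.ofReal_pow]
    exact h.symm
  have h2 : ∀ F, (∀ r, ⟪v r, F⟫_ℂ = 0) → F = 0 := by
    intro F hF
    have h3 : ∀ i, (fun x => F x i) =ᵐ[cellMeasure L a] 0 := fun i =>
      hcomplete i _ (integrable_coord F i) fun p => (hv (p, i) F).symm.trans (hF (p, i))
    refine Lp.ext ?_
    filter_upwards [h3 0, h3 1, h3 2, Lp.coeFn_zero (EuclideanSpace ℂ (Fin 3)) 2 (cellMeasure L a)]
      with x h0 h1 h2 h3
    rw [h3]
    ext i
    fin_cases i
    · exact h0
    · exact h1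
    · exact h2
  have h3 := hasSum_sq_inner_div_sq_norm h0 h2 E
  simp only [h1, hv] at h3
  exact h3.prod_fiberwise fun p => hasSum_fintype _

/-- The profiles of the components of an electric field: sines for the tangential components and
cosines for the normal one. -/
def electricMode (L a : ℝ) (p : ℤ × ℤ × ℕ) : Fin 3 → (Fin 3 → ℝ) → ℂ :=
  ![sinMode L a p.1 p.2.1 p.2.2, sinMode L a p.1 p.2.1 p.2.2, cosMode L a p.1 p.2.1 p.2.2]

/-- The profiles of the components of a magnetic field: cosines for the tangential components and
sines for the normal one. -/
def magneticMode (L a : ℝ) (p : ℤ × ℤ × ℕ) : Fin 3 → (Fin 3 → ℝ) → ℂ :=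
  ![cosMode L a p.1 p.2.1 p.2.2, cosMode L a p.1 p.2.1 p.2.2, sinMode L a p.1 p.2.1 p.2.2]

theorem hasSum_electricMode {L a : ℝ} (hL : 0 < L) (ha : 0 < a) (E : FieldL2 L a) :
    HasSum (fun p => ∑ i, ‖∫ x, E x i * electricMode L a p i x ∂(cellMeasure L a)‖ ^ 2 /
      (![sinNorm L a p.2.2, sinNorm L a p.2.2, cosNorm L a p.2.2] : Fin 3 → ℝ) i)
      (‖E‖ ^ 2) := by
  refine hasSum_sq_coef
    (N := fun p => ![sinNorm L a p.2.2, sinNorm L a p.2.2, cosNorm L a p.2.2])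
    (fun p i => ?_) (fun i p q h => ?_) (fun p i => ?_) (fun i f hf h => ?_) E
  · fin_cases i
    · exact (contDiff_sinMode L a _ _ _).continuous
    · exact (contDiff_sinMode L a _ _ _).continuous
    · exact (contDiff_cosMode L a _ _ _).continuous
  · fin_cases i
    · exact integral_conj_sinMode_mul_eq_zero hL ha h
    · exact integral_conj_sinMode_mul_eq_zero hL ha h
    · exact integral_conj_cosMode_mul_eq_zero hL ha h
  · fin_cases i
    · exact integral_conj_sinMode_mul_self hL ha _ _ _
    · exact integral_conj_sinMode_mul_self hL ha _ _ _
    · exact integral_conj_cosMode_mul_self hL ha _ _ _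
  · fin_cases i
    · exact ae_eq_zero_of_sinMode hf fun k l n => h (k, l, n)
    · exact ae_eq_zero_of_sinMode hf fun k l n => h (k, l, n)
    · exact ae_eq_zero_of_cosMode hf fun k l n => h (k, l, n)

theorem hasSum_magneticMode {L a : ℝ} (hL : 0 < L) (ha : 0 < a) (C : FieldL2 L a) :
    HasSum (fun p => ∑ i, ‖∫ x, C x i * magneticMode L a p i x ∂(cellMeasure L a)‖ ^ 2 /
      (![cosNorm L a p.2.2, cosNorm L a p.2.2, sinNorm L a p.2.2] : Fin 3 → ℝ) i)
      (‖C‖ ^ 2) := by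
  refine hasSum_sq_coef
    (N := fun p => ![cosNorm L a p.2.2, cosNorm L a p.2.2, sinNorm L a p.2.2])
    (fun p i => ?_) (fun i p q h => ?_) (fun p i => ?_) (fun i f hf h => ?_) C
  · fin_cases i
    · exact (contDiff_cosMode L a _ _ _).continuous
    · exact (contDiff_cosMode L a _ _ _).continuous
    · exact (contDiff_sinMode L a _ _ _).continuous
  · fin_cases i
    · exact integral_conj_cosMode_mul_eq_zero hL ha h
    · exact integral_conj_cosMode_mul_eq_zero hL ha h
    · exact integral_conj_sinMode_mul_eq_zero hL ha h
  · fin_cases i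
    · exact integral_conj_cosMode_mul_self hL ha _ _ _
    · exact integral_conj_cosMode_mul_self hL ha _ _ _
    · exact integral_conj_sinMode_mul_self hL ha _ _ _
  · fin_cases i
    · exact ae_eq_zero_of_cosMode hf fun k l n => h (k, l, n)
    · exact ae_eq_zero_of_cosMode hf fun k l n => h (k, l, n)
    · exact ae_eq_zero_of_sinMode hf fun k l n => h (k, l, n)

/-! ### The curl in terms of coefficients -/

theorem pderiv_cosMode (L a : ℝ) (k l n : ℤ) (x : Fin 3 → ℝ) :
    pderiv 0 (cosMode L a k l n) x = Complex.I * latFreq L k * cosMode L a k l n x ∧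
    pderiv 1 (cosMode L a k l n) x = Complex.I * latFreq L l * cosMode L a k l n x ∧
    pderiv 2 (cosMode L a k l n) x = -plateFreq a n * sinMode L a k l n x := by
  obtain ⟨h0, h1, h2⟩ := pderiv_sepProd (hasDerivAt_expWave (latFreq L k))
    (hasDerivAt_expWave (latFreq L l)) (hasDerivAt_cosWave (plateFreq a n))
  rw [cosMode, sinMode, h0, h1, h2]
  exact ⟨sepProd_const_mul₀ _ _ _ _ _, sepProd_const_mul₁ _ _ _ _ _,
    sepProd_const_mul₂ _ _ _ _ _⟩

theorem pderiv_sinMode (L a : ℝ) (k l n : ℤ) (x : Fin 3 → ℝ) :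
    pderiv 0 (sinMode L a k l n) x = Complex.I * latFreq L k * sinMode L a k l n x ∧
    pderiv 1 (sinMode L a k l n) x = Complex.I * latFreq L l * sinMode L a k l n x := by
  obtain ⟨h0, h1, -⟩ := pderiv_sepProd (hasDerivAt_expWave (latFreq L k))
    (hasDerivAt_expWave (latFreq L l)) (hasDerivAt_sinWave (plateFreq a n))
  rw [sinMode, h0, h1]
  exact ⟨sepProd_const_mul₀ _ _ _ _ _, sepProd_const_mul₁ _ _ _ _ _⟩

theorem pair_eq_sum {L a : ℝ} (E : FieldL2 L a) {g : Fin 3 → (Fin 3 → ℝ) → ℂ}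
    (hg : ∀ i, Continuous (g i)) :
    pair E g = ∫ x, E x 0 * g 0 x ∂(cellMeasure L a) + ∫ x, E x 1 * g 1 x ∂(cellMeasure L a) +
      ∫ x, E x 2 * g 2 x ∂(cellMeasure L a) := by
  rw [pair, integral_finsetSum _ fun i _ => integrable_coord_mul E i (hg i), Fin.sum_univ_three]

/-- The curl is tested with a field having `φ` as its only component. No condition on `φ` at the
plates is needed, so cosine profiles are allowed. -/
theorem integral_curl_coord {L a : ℝ} (hL : 0 ≤ L) (ha : 0 ≤ a)
    {E C : FieldL2 L a} (hp : (E, C) ∈ curlZeroGraph L a) {φ : (Fin 3 → ℝ) → ℂ}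
    (hφ : ContDiff ℝ ∞ φ) (hφL : IsLateralPeriodic L φ) :
    ∫ x, C x 0 * φ x ∂(cellMeasure L a) = ∫ x, E x 1 * pderiv 2 φ x ∂(cellMeasure L a) -
      ∫ x, E x 2 * pderiv 1 φ x ∂(cellMeasure L a) ∧
    ∫ x, C x 1 * φ x ∂(cellMeasure L a) = ∫ x, E x 2 * pderiv 0 φ x ∂(cellMeasure L a) -
      ∫ x, E x 0 * pderiv 2 φ x ∂(cellMeasure L a) ∧
    ∫ x, C x 2 * φ x ∂(cellMeasure L a) = ∫ x, E x 0 * pderiv 1 φ x ∂(cellMeasure L a) -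
      ∫ x, E x 1 * pderiv 0 φ x ∂(cellMeasure L a) := by
  have h : ∀ i, ∫ x, C x i * φ x ∂(cellMeasure L a) =
      pair E (fun j x => curl (fun y => EuclideanSpace.single i (φ y)) x j) := fun i => by
    have := pair_eq_pair_curl hL ha hp (contDiff_single hφ i)
      (fun x => by simp only [(hφL x).1, (hφL x).2, and_self])
    rw [← this, single_apply_eq_pi_single, pair_single]
  have hc := fun i => continuous_curl (contDiff_single hφ i)
  have h' : ∀ i, ∫ x, C x i * φ x ∂(cellMeasure L a) = _ := fun i =>
    (h i).trans (pair_eq_sum E (hc i))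
  refine ⟨?_, ?_, ?_⟩
  · rw [h' 0]
    simp [curl, pderiv_const, integral_neg, sub_eq_add_neg]
  · rw [h' 1]
    simp [curl, pderiv_const, integral_neg, sub_eq_add_neg, add_comm]
  · rw [h' 2]
    simp [curl, pderiv_const, integral_neg, sub_eq_add_neg]

end MaxwellSlab

end

noncomputable section

namespace MaxwellSlab

/-! ### Coercivity of the curl on divergence-free fields -/

/-- After replacing `a₂` by `-i a₂` and dropping phases, this is Lagrange's identity `|k × a|² + |k
· a|² = |k|² |a|²` with `k = (α, β, ζ)`; the hypothesis is that the dot product vanishes. -/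
theorem sum_sq_norm_curl_eq {α β ζ : ℝ} {a₀ a₁ a₂ : ℂ}
    (h : Complex.I * α * a₀ + Complex.I * β * a₁ + ζ * a₂ = 0) :
    ‖-ζ * a₁ - Complex.I * β * a₂‖ ^ 2 + ‖Complex.I * α * a₂ + ζ * a₀‖ ^ 2 +
      ‖Complex.I * β * a₀ - Complex.I * α * a₁‖ ^ 2 =
      (α ^ 2 + β ^ 2 + ζ ^ 2) * (‖a₀‖ ^ 2 + ‖a₁‖ ^ 2 + ‖a₂‖ ^ 2) := by
  have h1 : ‖-ζ * a₁ - Complex.I * β * a₂‖ ^ 2 + ‖Complex.I * α * a₂ + ζ * a₀‖ ^ 2 +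
      ‖Complex.I * β * a₀ - Complex.I * α * a₁‖ ^ 2 +
      ‖Complex.I * α * a₀ + Complex.I * β * a₁ + ζ * a₂‖ ^ 2 =
      (α ^ 2 + β ^ 2 + ζ ^ 2) * (‖a₀‖ ^ 2 + ‖a₁‖ ^ 2 + ‖a₂‖ ^ 2) := by
    simp only [Complex.sq_norm, Complex.normSq_apply, Complex.add_re, Complex.add_im,
      Complex.sub_re, Complex.sub_im, Complex.mul_re, Complex.mul_im, Complex.neg_re,
      Complex.neg_im, Complex.I_re, Complex.I_im, Complex.ofReal_re, Complex.ofReal_im]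
    ring
  rw [h] at h1
  simpa using h1

/-- A lower bound of the spectrum of the reduced Maxwell operator. -/
def spectralGap (L a : ℝ) : ℝ := min ((2 * Real.pi / L) ^ 2) ((Real.pi / a) ^ 2)

theorem spectralGap_pos {L a : ℝ} (hL : 0 < L) (ha : 0 < a) : 0 < spectralGap L a := by
  have := Real.pi_pos
  exact lt_min (by positivity) (by positivity)

theorem one_le_sq_intCast {k : ℤ} (hk : k ≠ 0) : (1 : ℝ) ≤ (k : ℝ) ^ 2 := by
  exact_mod_cast Int.one_le_abs (pow_ne_zero 2 hk) |>.trans_eq (abs_of_nonneg (sq_nonneg k))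

theorem spectralGap_le (L a : ℝ) {k l n : ℤ} (h : ¬(k = 0 ∧ l = 0 ∧ n = 0)) :
    spectralGap L a ≤ latFreq L k ^ 2 + latFreq L l ^ 2 + plateFreq a n ^ 2 := by
  have hlat : ∀ m : ℤ, m ≠ 0 → spectralGap L a ≤ latFreq L m ^ 2 := fun m hm => by
    refine (min_le_left _ _).trans ?_
    rw [latFreq, mul_div_right_comm _ (m : ℝ), mul_pow]
    exact le_mul_of_one_le_right (sq_nonneg _) (one_le_sq_intCast hm)
  have hk := sq_nonneg (latFreq L k)
  have hl := sq_nonneg (latFreq L l)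
  have hn := sq_nonneg (plateFreq a n)
  by_cases h0 : k = 0
  · by_cases h1 : l = 0
    · have : spectralGap L a ≤ plateFreq a n ^ 2 := by
        refine (min_le_right _ _).trans ?_
        rw [plateFreq, mul_div_right_comm, mul_pow]
        exact le_mul_of_one_le_right (sq_nonneg _) (one_le_sq_intCast fun h2 => h ⟨h0, h1, h2⟩)
      linarith
    · linarith [hlat l h1]
  · linarith [hlat k h0]

theorem integral_coord_two_eq_zero {L a : ℝ} (hL : 0 < L) (ha : 0 < a) {E : FieldL2 L a}
    (h : ⟪staticMode L a, E⟫_ℂ = 0) : ∫ x, E x 2 ∂(cellMeasure L a) = 0 := by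
  have h1 : ⟪staticMode L a, E⟫_ℂ =
      (((L ^ 2 * a) ^ (-(1 / 2) : ℝ) : ℝ) : ℂ) * ∫ x, E x 2 ∂(cellMeasure L a) := by
    rw [L2.inner_def, ← integral_const_mul]
    refine integral_congr_ae ?_
    filter_upwards [coeFn_staticMode L a] with x hx
    rw [hx, inner_smul_left, Complex.conj_ofReal, EuclideanSpace.inner_single_left]
    simp
  rw [h1] at h
  refine (mul_eq_zero.1 h).resolve_left (Complex.ofReal_ne_zero.2 ?_)
  exact (Real.rpow_pos_of_pos (by positivity) _).ne'

theorem sinMode_zero (L a : ℝ) (k l : ℤ) (x : Fin 3 → ℝ) : sinMode L a k l 0 x = 0 := by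
  simp [sinMode, sepProd, plateFreq, sinWave]

/-- The two norms differ only at `n = 0`, where the numerator is zero. All components of a mode thus
share one denominator. -/
theorem sq_div_sinNorm (L a : ℝ) (k l : ℤ) (n : ℕ) (f : (Fin 3 → ℝ) → ℂ) :
    ‖∫ x, f x * sinMode L a k l n x ∂(cellMeasure L a)‖ ^ 2 / sinNorm L a n =
      ‖∫ x, f x * sinMode L a k l n x ∂(cellMeasure L a)‖ ^ 2 / cosNorm L a n := by
  by_cases hn : n = 0
  · subst hn
    simp [sinMode_zero]
  · simp [sinNorm, cosNorm, hn]

/-- The two Parseval sums are compared mode by mode. The coefficients of `C` are the algebraic curl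
of those of `E`, so on divergence-free fields each term is multiplied by the squared frequency. -/
theorem spectralGap_mul_sq_norm_le {L a : ℝ} (hL : 0 < L) (ha : 0 < a) {E C : FieldL2 L a}
    (hp : (E, C) ∈ curlZeroGraph L a) (hdiv : E ∈ divFree L a)
    (hs : ⟪staticMode L a, E⟫_ℂ = 0) : spectralGap L a * ‖E‖ ^ 2 ≤ ‖C‖ ^ 2 := by
  refine hasSum_le (fun p => ?_) ((hasSum_electricMode hL ha E).mul_left _)
    (hasSum_magneticMode hL ha C)
  obtain ⟨k, l, n⟩ := p
  simp only [Fin.sum_univ_three, electricMode, magneticMode, Matrix.cons_val_zero,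
    Matrix.cons_val_one, Matrix.cons_val, sq_div_sinNorm]
  rw [← add_div, ← add_div, ← add_div, ← add_div, ← mul_div_assoc]
  have hN : 0 ≤ cosNorm L a n := by
    rw [cosNorm]
    split_ifs <;> positivity
  refine div_le_div_of_nonneg_right ?_ hN
  -- Cosine tests for the tangential components of the curl and sine tests for the normal one
  -- differentiate into exactly the profiles used for `E`.
  have hcos := integral_curl_coord hL.le ha.le hp (contDiff_cosMode L a k l n)
    (isLateralPeriodic_sepProd hL.ne' k l _)
  have hsin := integral_curl_coord hL.le ha.le hp (contDiff_sinMode L a k l n)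
    (isLateralPeriodic_sepProd hL.ne' k l _)
  have hd := integral_div_sinMode hL.ne' hdiv ha.ne' k l n
  simp only [(pderiv_cosMode L a k l n _).1, (pderiv_cosMode L a k l n _).2.1,
    (pderiv_cosMode L a k l n _).2.2, (pderiv_sinMode L a k l n _).1,
    (pderiv_sinMode L a k l n _).2, mul_left_comm _ (_ * _ : ℂ) (cosMode _ _ _ _ _ _),
    mul_left_comm _ (_ * _ : ℂ) (sinMode _ _ _ _ _ _),
    mul_left_comm _ (-_ : ℂ) (sinMode _ _ _ _ _ _), integral_const_mul] at hcos hsin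
  rw [hcos.1, hcos.2.1, hsin.2.2, neg_mul _ (∫ x, E x 0 * _ ∂_), sub_neg_eq_add,
    sum_sq_norm_curl_eq hd]
  -- At zero frequency the sine coefficients vanish and the cosine coefficient is the mean of the
  -- normal component, zero by orthogonality to the static mode.
  by_cases h0 : k = 0 ∧ l = 0 ∧ (n : ℤ) = 0
  · obtain ⟨rfl, rfl, hn⟩ := h0
    rw [hn, cosMode_zero]
    simp [sinMode_zero, integral_coord_two_eq_zero hL ha hs]
  · exact mul_le_mul_of_nonneg_right (spectralGap_le L a h0) (by positivity)

/-! ### The inverse of the reduced Maxwell operator -/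

/-- The pairs `(F, ∇ × F)` with `F` in the reduced form domain. -/
def physCurlGraph (L a : ℝ) : Submodule ℂ (Hphys L a × FieldL2 L a) :=
  (curlZeroGraph L a).comap ((incl L a).toLinearMap.prodMap LinearMap.id) ⊓
    (divFree L a).comap ((incl L a).toLinearMap ∘ₗ LinearMap.fst ℂ _ _)

theorem mem_physCurlGraph {L a : ℝ} {F : Hphys L a} {D : FieldL2 L a} :
    (F, D) ∈ physCurlGraph L a ↔
      (incl L a F, D) ∈ curlZeroGraph L a ∧ incl L a F ∈ divFree L a :=
  Iff.rfl

/-- Membership in `VPEC` supplies some curl through the closure of smooth fields, while `curlGraph`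
supplies a distributional one. Uniqueness of the weak curl identifies the two. -/
theorem mem_physCurlGraph_iff {L a : ℝ} (hL : 0 < L) {F : Hphys L a} {D : FieldL2 L a} :
    (F, D) ∈ physCurlGraph L a ↔ incl L a F ∈ VPEC L a ∧ (incl L a F, D) ∈ curlGraph L a := by
  rw [mem_physCurlGraph]
  constructor
  · rintro ⟨h1, h2⟩
    exact ⟨⟨⟨_, h1, rfl⟩, h2⟩, h1.1⟩
  · rintro ⟨⟨⟨⟨E, D'⟩, h1, hE⟩, h2⟩, h3⟩
    refine ⟨?_, h2⟩
    have hE' : E = incl L a F := hE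
    subst hE'
    have h4 : (0, D - D') ∈ curlGraph L a := by
      simpa using (curlGraph L a).sub_mem h3 h1.1
    rw [sub_eq_zero.1 (eq_zero_of_mem_curlGraph hL.ne' h4)]
    exact h1

theorem isClosed_physCurlGraph (L a : ℝ) :
    IsClosed (physCurlGraph L a : Set (Hphys L a × FieldL2 L a)) :=
  ((isClosed_curlZeroGraph L a).preimage
    ((incl L a).continuous.prodMap continuous_id)).inter
    ((isClosed_divFree L a).preimage ((incl L a).continuous.comp continuous_fst))

theorem inner_staticMode_incl {L a : ℝ} (F : Hphys L a) : ⟪staticMode L a, incl L a F⟫_ℂ = 0 :=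
  Submodule.mem_orthogonal_singleton_iff_inner_right.1 (F : physSubmodule L a).2.2

/-- An approximant from `VPEC` is projected off the static mode. The projection stays in `VPEC`
because the static mode belongs to it, and it does not increase the distance to a field already
orthogonal to that mode. -/
theorem dense_physCurlGraph_fst {L a : ℝ} (hL : 0 < L) (ha : 0 < a) :
    Dense ((physCurlGraph L a).map (LinearMap.fst ℂ (Hphys L a) (FieldL2 L a)) :
      Set (Hphys L a)) := by
  intro F
  rw [Metric.mem_closure_iff]
  intro ε hε
  have hF : incl L a F ∈ HPEC L a := (F : physSubmodule L a).2.1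
  obtain ⟨E, hE, hFE⟩ := Metric.mem_closure_iff.1
    ((Submodule.topologicalClosure_coe (VPEC L a)) ▸ hF : incl L a F ∈ closure (VPEC L a : Set _))
    ε hε
  set S : Submodule ℂ (FieldL2 L a) := Submodule.span ℂ {staticMode L a} with hS
  have hS' : S ≤ VPEC L a := by
    rw [hS, Submodule.span_singleton_le_iff_mem]
    exact staticMode_mem_VPEC hL.le ha.le
  have h1 : Sᗮ.starProjection E ∈ VPEC L a := by
    rw [Submodule.starProjection_orthogonal_val]
    exact (VPEC L a).sub_mem hE (hS' (Submodule.starProjection_apply_mem _ _))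
  have h2 : Sᗮ.starProjection E ∈ physSubmodule L a :=
    ⟨Submodule.le_topologicalClosure _ h1, Submodule.starProjection_apply_mem _ _⟩
  let G : Hphys L a := (⟨_, h2⟩ : physSubmodule L a)
  have hG : incl L a G = Sᗮ.starProjection E := rfl
  refine ⟨G, ?_, ?_⟩
  · obtain ⟨⟨⟨_, D⟩, h3, rfl⟩, h4⟩ := h1
    exact ⟨(G, D), ⟨h3, h4⟩, rfl⟩
  · have h3 : Sᗮ.starProjection (incl L a F) = incl L a F :=
      Submodule.starProjection_eq_self_iff.2 (F : physSubmodule L a).2.2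
    rw [← (incl L a).dist_map, hG, ← h3, dist_eq_norm, ← map_sub]
    refine (Submodule.norm_starProjection_apply_le _ _).trans_lt ?_
    rwa [← dist_eq_norm]

/-- The reduced Maxwell operator has a bounded positive inverse. -/
theorem exists_isBoundedInverse_LMx {L a : ℝ} (hL : 0 < L) (ha : 0 < a) :
    ∃ T : Hphys L a →L[ℂ] Hphys L a, 0 ≤ T ∧ IsBoundedInverse (LMx L a) T := by
  have hg := spectralGap_pos hL ha
  obtain ⟨T, hT0, hT1, hT⟩ := exists_inverse_of_coercive (physCurlGraph L a)
    (isClosed_physCurlGraph L a) (c := (Real.sqrt (spectralGap L a))⁻¹)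
    (by
      rintro ⟨F, D⟩ hFD
      have h := spectralGap_mul_sq_norm_le hL ha hFD.1 hFD.2 (inner_staticMode_incl F)
      change spectralGap L a * ‖incl L a F‖ ^ 2 ≤ ‖D‖ ^ 2 at h
      rw [(incl L a).norm_map] at h
      rw [inv_mul_eq_div, le_div_iff₀ (Real.sqrt_pos.2 hg)]
      refine le_of_sq_le_sq ?_ (norm_nonneg _)
      rw [mul_pow, Real.sq_sqrt hg.le, mul_comm]
      exact h)
    (dense_physCurlGraph_fst hL ha)
  -- The weak equation defining the Maxwell graph is the one solved by `T`, once the form domain is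
  -- written as pairs in `physCurlGraph`.
  have key : ∀ E G, (E, G) ∈ maxwellGraph L a ↔ T G = E := by
    intro E G
    rw [hT]
    constructor
    · rintro ⟨h1, C, h2, h3⟩
      refine ⟨C, (mem_physCurlGraph_iff hL).2 ⟨h1, h2⟩, fun F D hFD => ?_⟩
      obtain ⟨h4, h5⟩ := (mem_physCurlGraph_iff hL).1 hFD
      exact h3 F D h4 h5
    · rintro ⟨C, h1, h2⟩
      obtain ⟨h4, h5⟩ := (mem_physCurlGraph_iff hL).1 h1
      exact ⟨h4, C, h5, fun F D h6 h7 => h2 F D ((mem_physCurlGraph_iff hL).2 ⟨h6, h7⟩)⟩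
  exact ⟨T, hT0, isBoundedInverse_toLinearPMap hT1 (fun p hp => (key p.1 p.2).1 hp)
    fun x => (key _ _).2 rfl⟩

theorem rieszIntegrand_eq {L a : ℝ} {T : Hphys L a →L[ℂ] Hphys L a} (hT : 0 ≤ T)
    (hA : IsBoundedInverse (LMx L a) T) :
    rieszIntegrand L a = fun q => cfc (rieszSymbol q) T :=
  funext fun q => hA.negPow_shift hT q

/-- The constant is `κ (2π)⁻³ · 4π/3 = κ / (6π²)`. -/
theorem VMx_eq {L a : ℝ} (κ : ℝ) {T : Hphys L a →L[ℂ] Hphys L a} (hT : 0 ≤ T)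
    (hA : IsBoundedInverse (LMx L a) T) : VMx L a κ = (κ / (6 * Real.pi ^ 2)) • T := by
  rw [VMx, rieszIntegrand_eq hT hA, integral_cfc_rieszSymbol hT, smul_smul]
  congr 1
  have := Real.pi_ne_zero
  field_simp
  ring

end MaxwellSlab

end

/-! ### Assembly of the proposition -/

theorem proposition4p3 (L a κ : ℝ) (hL : 0 < L) (ha : 0 < a) (hκ : 0 < κ) :
    MaxwellSlab.IsStrictlyPositiveOp (MaxwellSlab.LMx L a) ∧
    MaxwellSlab.IsStrictlyPositiveOp (MaxwellSlab.Lamb L a) ∧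
    (∀ q : MaxwellSlab.R3,
      MaxwellSlab.IsStrictlyPositiveOp (MaxwellSlab.shift (MaxwellSlab.LMx L a) (‖q‖ ^ 2))) ∧
    Integrable (MaxwellSlab.rieszIntegrand L a) volume ∧
    ∀ (η : MaxwellSlab.R3 → ℂ) (hη : ContDiff ℝ ∞ η) (hc : HasCompactSupport η),
      ∫ y, η y = 1 →
      ∀ J K : MaxwellSlab.Hphys L a,
        Tendsto (fun ε : ℝ =>
            ⟪MaxwellSlab.mollifiedLift hη hc ε J,
              κ • MaxwellSlab.negPow (MaxwellSlab.Lamb L a) (5 / 2)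
                (MaxwellSlab.mollifiedLift hη hc ε K)⟫_ℂ)
          (𝓝[>] 0) (𝓝 ⟪J, MaxwellSlab.VMx L a κ K⟫_ℂ) ∧
        ⟪J, MaxwellSlab.VMx L a κ K⟫_ℂ =
          ⟪J, (κ / (6 * Real.pi ^ 2)) • MaxwellSlab.boundedInv (MaxwellSlab.LMx L a) K⟫_ℂ := by
  obtain ⟨T, hT, hA⟩ := MaxwellSlab.exists_isBoundedInverse_LMx hL ha
  have hR := MaxwellSlab.rieszIntegrand_eq hT hA
  refine ⟨hA.isStrictlyPositiveOp hT, MaxwellSlab.isStrictlyPositiveOp_tensorSum hT hA,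
    fun q => (hA.shift hT (sq_nonneg _)).isStrictlyPositiveOp
      (MaxwellSlab.resolventOf_nonneg hT (sq_nonneg _)), ?_, fun η hη hc h1 J K => ⟨?_, ?_⟩⟩
  · rw [hR]
    exact MaxwellSlab.integrable_cfc_rieszSymbol hT
  · have h := (MaxwellSlab.tendsto_inner_mollify hT hA hη hc h1 J K).const_mul (κ : ℂ)
    have hV : ⟪J, MaxwellSlab.VMx L a κ K⟫_ℂ = (κ : ℂ) * ⟪J, (((2 * Real.pi) ^ 3)⁻¹ •
        ∫ q : MaxwellSlab.R3, cfc (MaxwellSlab.rieszSymbol q) T) K⟫_ℂ := by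
      rw [MaxwellSlab.VMx, hR, mul_smul, smul_apply,
        inner_smul_right_eq_smul, Complex.real_smul]
    rw [hV]
    refine h.congr fun ε => ?_
    rw [inner_smul_right_eq_smul, Complex.real_smul]
    rfl
  · rw [MaxwellSlab.VMx_eq κ hT hA, hA.boundedInv_eq]
    rfl
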